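/- Let $x_1,\dots,x_r\in\mathbb P^2_{\mathbb C}$ be $r\ge 10$ distinct points (for instance, points in very general position), and let $X$ be the blow-up of $\mathbb P^2$ at them. Let $N(X)$ be the space of real numerical classes of divisors (equivalently, of curves) on $X$, with its intersection product; it has the basis formed by the class $L_0$ of the pull-back of a line and the classes $E_1,\dots,E_r$ of the exceptional curves, with $L_0^2=1$, $L_0\cdot E_i=0$, $E_i\cdot E_j=-\delta_{ij}$, and the proper transform of an integral plane curve $D$ has class $\deg(D)L_0-\sum_i\operatorname{mult}_{x_i}(D)E_i$. Let $K=-3L_0+\sum_iE_i$ be the canonical class, and let $\overline{NE}(X)\subset N(X)$ be the Mori cone, that is, the closure of the convex cone spanned by the classes of integral curves on $X$. Let $$Q=\{\alpha\in N(X)\mid \alpha^2\ge 0,\ \alpha\cdot h\ge 0 \text{ for some ample class } h\}.$$ For $\alpha\in N(X)$ put $R(\alpha)=\mathbb R_{\ge0}\,\alpha$, and for a cone $V$ put $V|_{\alpha^{\ge0}}=\{\beta\in V\mid \alpha\cdot\beta\ge0\}$ and $\partial V=V\smallsetminus V^\circ$, where $V^\circ$ is the relative interior. A $(-1)$-ray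 is an isolated extremal ray of $\overline{NE}(X)$ spanned by an integral curve $C$ with $K\cdot C<0$. The $(-1)$-Curves Conjecture for $X$ is the assertion that $\overline{NE}(X)=Q+\sum R_i$, where the sum runs over all extremal rays $R_i$ of $\overline{NE}(X)$ on which $K$ is negative (away from $0$). Let $s=\sqrt{r-1}-3$, and let $L$ be the class of the pull-back of a line under an arbitrary birational morphism $X\to\mathbb P^2$. Then every $(-1)$-ray is contained in $Q+R(K-sL)$, and if the $(-1)$-Curves Conjecture holds for $X$, then $$\overline{NE}(X)|_{(K-sL)^{\ge0}}=Q|_{(K-sL)^{\ge0}}.$$ Moreover: (a) If $r=10$, then every $(-1)$-ray is contained in $\partial(Q+R(K))$, and if the $(-1)$-Curves Conjecture holds for $X$, then $\overline{NE}(X)|_{K^{\ge0}}=Q|_{K^{\ge0}}$. (b) If $r>10$, then every $(-1)$-ray meets $Q+R(K)$ only in $0$, and (unconditionally) $Q|_{K^{\ge0}}\subsetneq\overline{NE}(X)|_{K^{\ge0}}$. -/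

import Mathlib

open scoped Pointwise NNReal LinearAlgebra.Projectivization

noncomputable section

namespace BlowUpPlane

/-! ### Plane curves and multiplicities -/

/-- The complex projective plane. -/
abbrev Plane : Type := ℙ ℂ (Fin 3 → ℂ)

/-- Forms in the homogeneous coordinates of the plane are homogeneous elements of this ring. -/
abbrev PolyRing : Type := MvPolynomial (Fin 3) ℂ

/-- The Taylor expansion `F (v + X)` of `F` at the point `v` of the affine cone over the plane. -/
def taylorAt (v : Fin 3 → ℂ) (F : PolyRing) : PolyRing :=
  MvPolynomial.aeval (fun i => MvPolynomial.X i + MvPolynomial.C (v i)) F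

/-- The form `F` vanishes to order at least `k` at the point `p`. -/
def VanishesToOrder (p : Plane) (k : ℕ) (F : PolyRing) : Prop :=
  ∀ n < k, MvPolynomial.homogeneousComponent n (taylorAt p.rep F) = 0

/-- The multiplicity at `p` of a nonzero form `F`: the order of its Taylor expansion at `p`. -/
def multAt (p : Plane) (F : PolyRing) : ℕ :=
  sInf {n | MvPolynomial.homogeneousComponent n (taylorAt p.rep F) ≠ 0}

/-- An integral plane curve, given by an irreducible form. -/
structure PlaneCurve where
  form : PolyRing
  degree : ℕ
  isHomogeneous : form.IsHomogeneous degree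
  irreducible : Irreducible form

/-! ### The Néron–Severi space of the blow-up

`X` is the blow-up of the plane at `r` distinct points `x 0, …, x (r - 1)`, `L` is the pull-back
of a line and `E i` is the exceptional curve over `x i`. The space `N(X)` of real numerical classes
has the basis `L, E 0, …, E (r - 1)`, with `L² = 1`, `L · E i = 0`, `E i · E j = - δ_ij`. -/

/-- `N(X)`: the pair `(a, b)` is the class `a L + ∑ i, b i E i`. -/
abbrev NS (r : ℕ) : Type := ℝ × (Fin r → ℝ)

/-- The intersection product on `N(X)`. -/
def inter {r : ℕ} (α β : NS r) : ℝ := α.1 * β.1 - ∑ i, α.2 i * β.2 i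

/-- The canonical class `K = -3 L + ∑ i, E i`. -/
def canonicalClass (r : ℕ) : NS r := (-3, fun _ => 1)

/-- The integral curves on `X`: the exceptional curves and the proper transforms of the integral
plane curves. -/
inductive IntegralCurve (r : ℕ) : Type
  | exceptional (i : Fin r) : IntegralCurve r
  | properTransform (D : PlaneCurve) : IntegralCurve r

/-- The numerical class of an integral curve: `E i` for an exceptional curve, and
`deg(D) L - ∑ i, mult_{x i}(D) E i` for the proper transform of `D`. -/
def IntegralCurve.cls {r : ℕ} (x : Fin r → Plane) : IntegralCurve r → NS r
  | .exceptional i => (0, Pi.single i 1)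
  | .properTransform D => (D.degree, fun i => -(multAt (x i) D.form : ℝ))

/-! ### Cones in `N(X)` -/

/-- `R(α) = ℝ_{≥ 0} α`. -/
def ray {r : ℕ} (α : NS r) : Set (NS r) := {β | ∃ t : ℝ, 0 ≤ t ∧ β = t • α}

/-- The half-space `α^{≥ 0}`. -/
def nonnegHalfSpace {r : ℕ} (α : NS r) : Set (NS r) := {β | 0 ≤ inter α β}

/-- The boundary `∂V = V ∖ V°` of a closed cone, where `V°` is the relative interior. -/
def coneBoundary {r : ℕ} (V : Set (NS r)) : Set (NS r) := V \ intrinsicInterior ℝ V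

/-- The Mori cone: the closure of the convex cone spanned by the classes of integral curves. -/
def moriCone {r : ℕ} (x : Fin r → Plane) : Set (NS r) :=
  closure (Submodule.span ℝ≥0 (Set.range (IntegralCurve.cls x)) : Set (NS r))

/-- Ample real classes, described by Kleiman's criterion. -/
def IsAmple {r : ℕ} (x : Fin r → Plane) (h : NS r) : Prop :=
  ∀ γ ∈ moriCone x, γ ≠ 0 → 0 < inter h γ

/-- The quadric cone `Q`: classes with `α² ≥ 0` and `α · h ≥ 0` for some ample class `h`. -/
def quadricCone {r : ℕ} (x : Fin r → Plane) : Set (NS r) :=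
  {α | 0 ≤ inter α α ∧ ∃ h, IsAmple x h ∧ 0 ≤ inter α h}

/-- `R` is an extremal ray of the cone `V`. -/
def IsExtremalRay {r : ℕ} (V R : Set (NS r)) : Prop :=
  (∃ α, α ≠ 0 ∧ R = ray α) ∧ R ⊆ V ∧ ∀ β ∈ V, ∀ γ ∈ V, β + γ ∈ R → β ∈ R ∧ γ ∈ R

/-- `R` is isolated among the extremal rays of `V`: some generator of `R` has a neighbourhood
that meets no other extremal ray of `V`. -/
def IsIsolatedExtremalRay {r : ℕ} (V R : Set (NS r)) : Prop :=
  IsExtremalRay V R ∧ ∃ α ∈ R, α ≠ 0 ∧ ∃ U : Set (NS r), IsOpen U ∧ α ∈ U ∧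
    ∀ R', IsExtremalRay V R' → (R' ∩ U).Nonempty → R' = R

/-- The `(-1)`-rays: isolated extremal rays of the Mori cone that are spanned by an integral
curve `C` with `K · C < 0`. -/
def IsMinusOneRay {r : ℕ} (x : Fin r → Plane) (R : Set (NS r)) : Prop :=
  IsIsolatedExtremalRay (moriCone x) R ∧
    ∃ C : IntegralCurve r, R = ray (C.cls x) ∧ inter (canonicalClass r) (C.cls x) < 0

/-- The `K`-negative extremal rays of the Mori cone. -/
def IsKNegativeExtremalRay {r : ℕ} (x : Fin r → Plane) (R : Set (NS r)) : Prop :=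
  IsExtremalRay (moriCone x) R ∧ ∀ α ∈ R, α ≠ 0 → inter (canonicalClass r) α < 0

/-- The assertion of the `(-1)`-Curves Conjecture for the blow-up at the points `x i`: the Mori
cone is `Q + ∑ R_i`, where the `R_i` are the `K`-negative extremal rays of the Mori cone. -/
def MinusOneCurvesConjecture {r : ℕ} (x : Fin r → Plane) : Prop :=
  moriCone x = quadricCone x +
    (Submodule.span ℝ≥0 (⋃₀ {R | IsKNegativeExtremalRay x R}) : Set (NS r))

/-! ### Reductions to the plane -/

/-- `F = (F 0 : F 1 : F 2)` induces a birational morphism `X → ℙ²` under which the pull-back of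
a line has class `d L - ∑ i, m i E i`. That is: the `F j` are sections of the line bundle
`d L - ∑ i, m i E i` (forms of degree `d` that vanish to order at least `m i` at `x i`), these
sections have no common zero on `X`, and the rational map `F` of the plane has a rational
inverse `G`. A point of `X` is either a point of the plane other than the `x i`, or a tangent
direction at some `x i`, that is, a vector `w` not proportional to a representative of `x i`, up to
scaling and up to that representative; in the direction `w` the section given by a form takes the
value at `w` of the part of degree `m i` of the Taylor expansion of the form at `x i`. -/
structure IsReduction {r : ℕ} (x : Fin r → Plane) (d : ℕ) (m : Fin r → ℕ)
    (F : Fin 3 → PolyRing) : Prop where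
  homogeneous : ∀ j, (F j).IsHomogeneous d
  vanishing : ∀ i j, VanishesToOrder (x i) (m i) (F j)
  noBasePoint : ∀ p : Plane, (∀ i, p ≠ x i) → ∃ j, MvPolynomial.eval p.rep (F j) ≠ 0
  noBaseDirection : ∀ i, ∀ w : Fin 3 → ℂ, LinearIndependent ℂ ![(x i).rep, w] →
    ∃ j, MvPolynomial.eval w
      (MvPolynomial.homogeneousComponent (m i) (taylorAt (x i).rep (F j))) ≠ 0
  birational : ∃ (e : ℕ) (G : Fin 3 → PolyRing) (H H' : PolyRing),
    (∀ j, (G j).IsHomogeneous e) ∧ H ≠ 0 ∧ H' ≠ 0 ∧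
    (∀ j, MvPolynomial.aeval F (G j) = H * MvPolynomial.X j) ∧
    (∀ j, MvPolynomial.aeval G (F j) = H' * MvPolynomial.X j)

/-- `L` is the class of the pull-back of a line under some reduction `X → ℙ²`. -/
def IsLinePullback {r : ℕ} (x : Fin r → Plane) (L : NS r) : Prop :=
  ∃ (d : ℕ) (m : Fin r → ℕ) (F : Fin 3 → PolyRing), IsReduction x d m F ∧
    L = ((d : ℝ), fun i => -(m i : ℝ))

end BlowUpPlane

end

/-! The intersection form has signature (1, r), and the theorem comes down to signs of squares.
Counting conditions on forms shows that classes of positive square and positive degree are limits of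
effective classes. So `quadricCone` is the half light cone `lightCone`, and it lies in the Mori
cone.

An isolated extremal ray has negative square: otherwise second order perturbations inside the light
cone would put a line into the Mori cone (`inter_self_neg_of_isIsolatedExtremalRay`). A (-1)-ray is
therefore spanned by a curve C with C² < 0 and K·C < 0, and nonnegativity of the genus forces C² =
K·C = -1 (`inter_eq_neg_one`).

Put M = K - sL. As L² = 1, K·L = -3 and L is nonnegative on curves, M² = (s + 3)² - r = -1 and M·C =
-1 - s L·C ≤ -1. Hence (C - M)² = -2 - 2 M·C ≥ 0, so C = (C - M) + M lies in Q + R(M). Under the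
conjecture the whole Mori cone lies in Q + R(M), and β = q + tM with M·β ≥ 0 satisfies β² = q² + 2t
M·β + t² ≥ 0 (`moriCone_inter_nonnegHalfSpace`).

If r = 10, then M = K works, C - K is a null class, and its orthogonal hyperplane supports Q + R(K)
along C. If r > 10, then K² < -1 and (tC - uK)² = -(t - u)² + (K² + 1)u² is negative for t > 0, u ≥
0. Strictness in (b) comes from adding a multiple of an exceptional curve to a null class orthogonal
to it.

The geometric inputs are dimension counts for forms with assigned multiplicities
(`finrank_formsVanishing`). Applied to (A, B) ↦ AF + BG they give Bézout's inequality
(`sum_mul_le_mul_of_not_dvd`), and Bézout applied to adjoint curves gives the genus bound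
(`sum_mult_le_genus`). The values L² = 1 and K·L = -3 follow by restricting linear systems to the
pull-back of a general line, a rational curve parametrized by the inverse map
(`LineParametrization.numerics`). -/

noncomputable section

namespace BlowUpPlane

open MvPolynomial

/-! ### The order of a polynomial at the origin -/

section LowestTerms

variable {σ : Type*}

/-- All terms of `f` have degree at least `k`. -/
def LowVan (k : ℕ) (f : MvPolynomial σ ℂ) : Prop :=
  ∀ n < k, homogeneousComponent n f = 0

lemma lowVan_iff_coeff {k : ℕ} {f : MvPolynomial σ ℂ} :
    LowVan k f ↔ ∀ d : σ →₀ ℕ, d.degree < k → coeff d f = 0 := by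
  constructor
  · intro h d hd
    have := congrArg (coeff d) (h _ hd)
    simpa [coeff_homogeneousComponent] using this
  · intro h n hn
    ext d
    rw [coeff_homogeneousComponent]
    split_ifs with hd
    · simpa using h d (hd ▸ hn)
    · simp

lemma LowVan.mono {k l : ℕ} {f : MvPolynomial σ ℂ} (h : LowVan k f) (hl : l ≤ k) : LowVan l f :=
  fun n hn => h n (hn.trans_le hl)

lemma lowVan_zero (f : MvPolynomial σ ℂ) : LowVan 0 f := fun n hn => absurd hn (Nat.not_lt_zero n)

lemma LowVan.mul {k l : ℕ} {f g : MvPolynomial σ ℂ} (hf : LowVan k f) (hg : LowVan l g) :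
    LowVan (k + l) (f * g) := by
  classical
  rw [lowVan_iff_coeff] at *
  intro d hd
  rw [coeff_mul]
  refine Finset.sum_eq_zero fun ⟨a, b⟩ hab => ?_
  rw [Finset.HasAntidiagonal.mem_antidiagonal] at hab
  have hdeg : a.degree + b.degree = d.degree := by rw [← hab, map_add]
  rcases lt_or_ge a.degree k with h | h
  · simp [hf a h]
  · simp [hg b (by lia)]

/-- Only pairs of lowest terms reach degree `k + l`. Since polynomials form a domain, this makes
multiplicities additive and lets a factor of known order be cancelled in `LowVan.of_mul`. -/
lemma LowVan.homogeneousComponent_mul {k l : ℕ} {f g : MvPolynomial σ ℂ} (hf : LowVan k f)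
    (hg : LowVan l g) : homogeneousComponent (k + l) (f * g) =
      homogeneousComponent k f * homogeneousComponent l g := by
  classical
  rw [lowVan_iff_coeff] at *
  ext d
  rw [coeff_homogeneousComponent, coeff_mul, coeff_mul]
  split_ifs with hd
  · refine Finset.sum_congr rfl fun ⟨a, b⟩ hab => ?_
    rw [Finset.HasAntidiagonal.mem_antidiagonal] at hab
    have hdeg : a.degree + b.degree = d.degree := by rw [← hab, map_add]
    simp only [coeff_homogeneousComponent]
    by_cases ha : a.degree = k
    · rw [if_pos ha, if_pos (by lia)]
    · rw [if_neg ha, zero_mul]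
      rcases lt_or_ge a.degree k with h | h
      · simp [hf a h]
      · simp [hg b (by lia)]
  · symm
    refine Finset.sum_eq_zero fun ⟨a, b⟩ hab => ?_
    rw [Finset.HasAntidiagonal.mem_antidiagonal] at hab
    have hdeg : a.degree + b.degree = d.degree := by rw [← hab, map_add]
    simp only [coeff_homogeneousComponent]
    by_cases ha : a.degree = k
    · rw [if_neg (show ¬ b.degree = l by lia), mul_zero]
    · rw [if_neg ha, zero_mul]

lemma exists_lowVan {f : MvPolynomial σ ℂ} (hf : f ≠ 0) :
    ∃ k, LowVan k f ∧ homogeneousComponent k f ≠ 0 := by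
  classical
  have h : ∃ k, homogeneousComponent k f ≠ 0 := by
    by_contra! h
    apply hf
    rw [← sum_homogeneousComponent f]
    exact Finset.sum_eq_zero fun i _ => h i
  exact ⟨Nat.find h, fun n hn => by simpa using Nat.find_min h hn, Nat.find_spec h⟩

lemma LowVan.of_mul {k l : ℕ} {f g : MvPolynomial σ ℂ} (hf : LowVan k f)
    (hf0 : homogeneousComponent k f ≠ 0) (h : LowVan (k + l) (f * g)) : LowVan l g := by
  by_cases hg : g = 0
  · intro n _
    simp [hg]
  obtain ⟨j, hj, hj0⟩ := exists_lowVan hg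
  have := hf.homogeneousComponent_mul hj
  rcases lt_or_ge j l with hjl | hjl
  · rw [h (k + j) (by lia)] at this
    exact absurd this.symm (mul_ne_zero hf0 hj0)
  · exact hj.mono hjl

lemma LowVan.pow {k : ℕ} {f : MvPolynomial σ ℂ} (hf : LowVan k f) (n : ℕ) :
    LowVan (n * k) (f ^ n) := by
  induction n with
  | zero => simpa using lowVan_zero _
  | succ n ih => rw [pow_succ, Nat.succ_mul]; exact ih.mul hf

lemma LowVan.add {k : ℕ} {f g : MvPolynomial σ ℂ} (hf : LowVan k f) (hg : LowVan k g) :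
    LowVan k (f + g) := fun n hn => by rw [map_add, hf n hn, hg n hn, add_zero]

lemma LowVan.smul {k : ℕ} {f : MvPolynomial σ ℂ} (hf : LowVan k f) (c : ℂ) :
    LowVan k (c • f) := fun n hn => by rw [map_smul, hf n hn, smul_zero]

lemma lowVan_of_isHomogeneous {k : ℕ} {f : MvPolynomial σ ℂ} (hf : f.IsHomogeneous k) :
    LowVan k f := fun n hn => by
  rw [homogeneousComponent_of_mem hf, if_neg hn.ne]

lemma isHomogeneous_of_lowVan {k : ℕ} {f : MvPolynomial σ ℂ} (hf : LowVan k f)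
    (hd : f.totalDegree ≤ k) : f.IsHomogeneous k := by
  have : f = homogeneousComponent k f := by
    conv_lhs => rw [← sum_homogeneousComponent f]
    rcases hd.lt_or_eq with h | h
    · rw [homogeneousComponent_eq_zero _ _ h]
      exact Finset.sum_eq_zero fun i hi => hf i (by simp at hi; lia)
    · rw [Finset.sum_eq_single k]
      · intro b hb hbk
        exact hf b (by simp at hb; lia)
      · intro h'
        simp at h'
        lia
  rw [this]
  exact homogeneousComponent_isHomogeneous _ _

/-- A factor of a nonzero form is a form. -/
lemma isHomogeneous_of_mul {n : ℕ} {f g : MvPolynomial σ ℂ} (h : (f * g).IsHomogeneous n)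
    (hfg : f * g ≠ 0) : ∃ k l, k + l = n ∧ f.IsHomogeneous k ∧ g.IsHomogeneous l := by
  have hf0 := left_ne_zero_of_mul hfg
  have hg0 := right_ne_zero_of_mul hfg
  obtain ⟨k, hk, hk0⟩ := exists_lowVan hf0
  obtain ⟨l, hl, hl0⟩ := exists_lowVan hg0
  have hkd : k ≤ f.totalDegree := by
    by_contra! hc
    exact hk0 (homogeneousComponent_eq_zero _ _ hc)
  have hld : l ≤ g.totalDegree := by
    by_contra! hc
    exact hl0 (homogeneousComponent_eq_zero _ _ hc)
  -- Lowest degrees add and total degrees add; both sums equal `n`, so each factor has lowest degree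
  -- equal to total degree.
  have hc := hk.homogeneousComponent_mul hl
  have hkl : k + l = n := by
    by_contra hne
    rw [homogeneousComponent_of_mem h, if_neg hne] at hc
    exact mul_ne_zero hk0 hl0 hc.symm
  have ht := totalDegree_mul_of_isDomain hf0 hg0
  rw [h.totalDegree hfg] at ht
  exact ⟨k, l, hkl, isHomogeneous_of_lowVan hk (by lia), isHomogeneous_of_lowVan hl (by lia)⟩

lemma isHomogeneous_of_mul_right {n d : ℕ} {f g : MvPolynomial σ ℂ}
    (h : (f * g).IsHomogeneous (d + n)) (hf : f.IsHomogeneous d) (hf0 : f ≠ 0) :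
    g.IsHomogeneous n := by
  by_cases hg : g = 0
  · rw [hg]; exact isHomogeneous_zero _ _ _
  obtain ⟨k, l, hkl, hk, hl⟩ := isHomogeneous_of_mul h (mul_ne_zero hf0 hg)
  have := hk.inj_right hf hf0
  have : l = n := by lia
  exact this ▸ hl

end LowestTerms

/-! ### Taylor expansions and multiplicities -/

/-- The Taylor expansion at `v`, as an algebra homomorphism. -/
def taylorHom (v : Fin 3 → ℂ) : PolyRing →ₐ[ℂ] PolyRing :=
  MvPolynomial.aeval (fun i => MvPolynomial.X i + MvPolynomial.C (v i))

lemma taylorAt_eq (v : Fin 3 → ℂ) (F : PolyRing) : taylorAt v F = taylorHom v F := rfl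

lemma taylorHom_neg_comp (v : Fin 3 → ℂ) (F : PolyRing) :
    taylorHom (-v) (taylorHom v F) = F := by
  have : (taylorHom (-v)).comp (taylorHom v) = AlgHom.id ℂ _ := by
    ext i
    simp [taylorHom]
  exact DFunLike.congr_fun this F

lemma taylorHom_injective (v : Fin 3 → ℂ) : Function.Injective (taylorHom v) :=
  Function.LeftInverse.injective (taylorHom_neg_comp v)

lemma taylorHom_ne_zero {v : Fin 3 → ℂ} {F : PolyRing} (hF : F ≠ 0) : taylorHom v F ≠ 0 :=
  (map_ne_zero_iff _ (taylorHom_injective v)).2 hF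

lemma taylorHom_totalDegree_le {v : Fin 3 → ℂ} {F : PolyRing} {d : ℕ} (hF : F.IsHomogeneous d) :
    (taylorHom v F).totalDegree ≤ d := by
  rw [taylorHom, aeval_def, eval₂_eq]
  refine totalDegree_finsetSum_le fun s hs => ?_
  refine (totalDegree_mul _ _).trans ?_
  rw [algebraMap_eq, totalDegree_C, zero_add]
  refine (totalDegree_finsetProd _ _).trans ?_
  rw [hF.degree_eq_sum_deg_support hs]
  refine Finset.sum_le_sum fun i _ => ?_
  refine (totalDegree_pow _ _).trans ?_
  have h1 : (X i + C (v i) : PolyRing).totalDegree ≤ 1 := by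
    refine (totalDegree_add _ _).trans ?_
    simp
  nlinarith

lemma vanishesToOrder_iff {p : Plane} {k : ℕ} {F : PolyRing} :
    VanishesToOrder p k F ↔ LowVan k (taylorHom p.rep F) := Iff.rfl

lemma exists_multAt (p : Plane) {F : PolyRing} (hF : F ≠ 0) :
    LowVan (multAt p F) (taylorHom p.rep F) ∧
      homogeneousComponent (multAt p F) (taylorHom p.rep F) ≠ 0 := by
  obtain ⟨k, hk, hk0⟩ := exists_lowVan (taylorHom_ne_zero (v := p.rep) hF)
  have : multAt p F = k := by
    apply le_antisymm
    · exact Nat.sInf_le hk0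
    · have hmem : multAt p F ∈ {n | homogeneousComponent n (taylorAt p.rep F) ≠ 0} :=
        Nat.sInf_mem ⟨k, hk0⟩
      by_contra! hlt
      exact hmem (hk _ hlt)
  rw [this]
  exact ⟨hk, hk0⟩

lemma vanishesToOrder_iff_le_multAt {p : Plane} {k : ℕ} {F : PolyRing} (hF : F ≠ 0) :
    VanishesToOrder p k F ↔ k ≤ multAt p F := by
  obtain ⟨h1, h2⟩ := exists_multAt p hF
  constructor
  · intro h
    by_contra! hlt
    exact h2 (h _ hlt)
  · exact fun h => h1.mono h

lemma multAt_eq {p : Plane} {k : ℕ} {F : PolyRing} (h : VanishesToOrder p k F)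
    (h0 : homogeneousComponent k (taylorHom p.rep F) ≠ 0) : multAt p F = k := by
  have hF : F ≠ 0 := by rintro rfl; simp at h0
  apply le_antisymm
  · by_contra! hlt
    exact h0 ((exists_multAt p hF).1 k hlt)
  · exact (vanishesToOrder_iff_le_multAt hF).1 h

lemma multAt_mul (p : Plane) {F G : PolyRing} (hF : F ≠ 0) (hG : G ≠ 0) :
    multAt p (F * G) = multAt p F + multAt p G := by
  obtain ⟨h1, h2⟩ := exists_multAt p hF
  obtain ⟨h3, h4⟩ := exists_multAt p hG
  apply multAt_eq
  · rw [vanishesToOrder_iff, map_mul]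
    exact h1.mul h3
  · rw [map_mul, h1.homogeneousComponent_mul h3]
    exact mul_ne_zero h2 h4

lemma multAt_le_degree (p : Plane) {F : PolyRing} {d : ℕ} (hF : F ≠ 0) (hd : F.IsHomogeneous d) :
    multAt p F ≤ d := by
  by_contra! hlt
  refine (exists_multAt p hF).2 (homogeneousComponent_eq_zero _ _ ?_)
  exact (taylorHom_totalDegree_le hd).trans_lt hlt

lemma multAt_of_isUnit (p : Plane) {F : PolyRing} (hF : IsUnit F) : multAt p F = 0 := by
  have h0 : F.IsHomogeneous 0 := by
    rw [MvPolynomial.isUnit_iff_eq_C_of_isReduced] at hF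
    obtain ⟨r, _, rfl⟩ := hF
    exact isHomogeneous_C _ _
  have := multAt_le_degree p hF.ne_zero h0
  lia

lemma VanishesToOrder.mul {p : Plane} {k l : ℕ} {F G : PolyRing} (hF : VanishesToOrder p k F)
    (hG : VanishesToOrder p l G) : VanishesToOrder p (k + l) (F * G) := by
  rw [vanishesToOrder_iff, map_mul]
  exact LowVan.mul hF hG

lemma VanishesToOrder.pow {p : Plane} {k : ℕ} {F : PolyRing} (hF : VanishesToOrder p k F) (n : ℕ) :
    VanishesToOrder p (n * k) (F ^ n) := by
  rw [vanishesToOrder_iff, map_pow]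
  exact LowVan.pow hF n

lemma VanishesToOrder.add {p : Plane} {k : ℕ} {F G : PolyRing} (hF : VanishesToOrder p k F)
    (hG : VanishesToOrder p k G) : VanishesToOrder p k (F + G) := by
  rw [vanishesToOrder_iff, map_add]
  exact LowVan.add hF hG

lemma VanishesToOrder.smul {p : Plane} {k : ℕ} {F : PolyRing} (hF : VanishesToOrder p k F)
    (c : ℂ) : VanishesToOrder p k (c • F) := by
  rw [vanishesToOrder_iff, map_smul]
  exact LowVan.smul hF c

lemma VanishesToOrder.mono {p : Plane} {k l : ℕ} {F : PolyRing} (hF : VanishesToOrder p k F)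
    (h : l ≤ k) : VanishesToOrder p l F := LowVan.mono hF h

lemma vanishesToOrder_order_zero (p : Plane) (F : PolyRing) : VanishesToOrder p 0 F := lowVan_zero _

lemma vanishesToOrder_zero (p : Plane) (k : ℕ) : VanishesToOrder p k 0 := by
  intro n _
  simp [taylorAt]

lemma vanishesToOrder_one_iff {p : Plane} {F : PolyRing} :
    VanishesToOrder p 1 F ↔ eval p.rep F = 0 := by
  have : homogeneousComponent 0 (taylorHom p.rep F) = C (eval p.rep F) := by
    rw [homogeneousComponent_zero]
    congr 1
    change constantCoeff (taylorHom p.rep F) = _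
    have : (constantCoeff : PolyRing →+* ℂ).comp (taylorHom p.rep).toRingHom = eval p.rep := by
      ext i <;> simp [taylorHom]
    exact DFunLike.congr_fun this F
  constructor
  · intro h
    have := this.symm.trans (h 0 one_pos)
    simpa using this
  · intro h n hn
    obtain rfl : n = 0 := by lia
    exact this.trans (by rw [h, C_0])

end BlowUpPlane
end

noncomputable section

namespace BlowUpPlane

open MvPolynomial

/-! ### Dimensions of linear systems with assigned multiplicities -/

lemma LowVan.prod {σ ι : Type*} (s : Finset ι) {k : ι → ℕ} {f : ι → MvPolynomial σ ℂ}
    (h : ∀ i ∈ s, LowVan (k i) (f i)) : LowVan (∑ i ∈ s, k i) (∏ i ∈ s, f i) := by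
  classical
  induction s using Finset.induction_on with
  | empty => simpa using lowVan_zero _
  | insert a s ha ih =>
    rw [Finset.sum_insert ha, Finset.prod_insert ha]
    exact (h a (Finset.mem_insert_self _ _)).mul
      (ih fun i hi => h i (Finset.mem_insert_of_mem hi))

lemma LowVan.sum {σ ι : Type*} (s : Finset ι) {k : ℕ} {f : ι → MvPolynomial σ ℂ}
    (h : ∀ i ∈ s, LowVan k (f i)) : LowVan k (∑ i ∈ s, f i) := by
  intro n hn
  rw [map_sum]
  exact Finset.sum_eq_zero fun i hi => h i hi n hn

/-- A form of degree `D` is determined by its coefficients. -/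
def homogeneousEquiv (D : ℕ) : homogeneousSubmodule (Fin 3) ℂ D ≃ₗ[ℂ]
    ((Finset.univ : Finset (Fin 3)).finsuppAntidiag D → ℂ) where
  toFun F s := coeff s.1 F.1
  map_add' F G := by ext s; simp
  map_smul' c F := by ext s; simp
  invFun c := ⟨∑ s, monomial s.1 (c s), by
    refine Submodule.sum_mem _ fun s _ => isHomogeneous_monomial _ ?_
    have := (Finset.mem_finsuppAntidiag.1 s.2).1
    rw [Finsupp.degree_eq_sum]
    exact this⟩
  left_inv F := by
    classical
    ext a
    simp only [coeff_sum, coeff_monomial]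
    by_cases ha : a.degree = D
    · have hmem : a ∈ (Finset.univ : Finset (Fin 3)).finsuppAntidiag D := by
        rw [Finset.mem_finsuppAntidiag, ← Finsupp.degree_eq_sum]
        exact ⟨ha, Finset.subset_univ _⟩
      rw [Finset.sum_eq_single ⟨a, hmem⟩]
      · simp
      · intro b _ hb
        rw [if_neg]
        intro h
        exact hb (Subtype.ext h)
      · simp
    · have hF : F.1.IsHomogeneous D := F.2
      rw [hF.coeff_eq_zero ha]
      refine Finset.sum_eq_zero fun s _ => if_neg ?_
      rintro rfl
      apply ha
      have := (Finset.mem_finsuppAntidiag.1 s.2).1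
      rw [Finsupp.degree_eq_sum]
      exact this
  right_inv c := by
    classical
    ext s
    simp only [coeff_sum, coeff_monomial]
    rw [Finset.sum_eq_single s]
    · simp
    · intro b _ hb
      rw [if_neg]
      intro h
      exact hb (Subtype.ext h)
    · simp

instance (D : ℕ) : FiniteDimensional ℂ (homogeneousSubmodule (Fin 3) ℂ D) :=
  (homogeneousEquiv D).symm.finiteDimensional

lemma finrank_homogeneousSubmodule (D : ℕ) :
    Module.finrank ℂ (homogeneousSubmodule (Fin 3) ℂ D) = (D + 2).choose 2 := by
  rw [(homogeneousEquiv D).finrank_eq, Module.finrank_fintype_fun_eq_card, Fintype.card_coe,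
    Finset.card_finsuppAntidiag_nat_eq_choose, Finset.card_univ, Fintype.card_fin,
    show 3 + D - 1 = D + 2 by lia, ← Nat.choose_symm_add]

/-- The forms of degree `D` that vanish to order at least `k i` at the point `x i`. -/
def formsVanishing {ι : Type*} (x : ι → Plane) (D : ℕ) (k : ι → ℕ) : Submodule ℂ PolyRing where
  carrier := {F | F.IsHomogeneous D ∧ ∀ i, VanishesToOrder (x i) (k i) F}
  add_mem' hF hG := ⟨hF.1.add hG.1, fun i => (hF.2 i).add (hG.2 i)⟩
  zero_mem' := ⟨isHomogeneous_zero _ _ _, fun _ => vanishesToOrder_zero _ _⟩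
  smul_mem' c _ hF := ⟨(homogeneousSubmodule (Fin 3) ℂ D).smul_mem c hF.1,
    fun i => (hF.2 i).smul c⟩

lemma formsVanishing_le {ι : Type*} (x : ι → Plane) (D : ℕ) (k : ι → ℕ) :
    formsVanishing x D k ≤ homogeneousSubmodule (Fin 3) ℂ D := fun _ hF => hF.1

instance {ι : Type*} (x : ι → Plane) (D : ℕ) (k : ι → ℕ) :
    FiniteDimensional ℂ (formsVanishing x D k) :=
  Submodule.finiteDimensional_of_le (formsVanishing_le x D k)

/-- The linear substitution that moves the `i`-th coordinate point to `v`. -/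
def coordSubst (i : Fin 3) (v : Fin 3 → ℂ) : PolyRing →ₐ[ℂ] PolyRing :=
  aeval fun j => if j = i then C (v i) * X i else X j + C (v j) * X i

/-- The linear substitution that moves `v` to the `i`-th coordinate point. -/
def coordSubstInv (i : Fin 3) (v : Fin 3 → ℂ) : PolyRing →ₐ[ℂ] PolyRing :=
  aeval fun j => if j = i then C (v i)⁻¹ * X i else X j - C (v j / v i) * X i

lemma coordSubstInv_coordSubst {i : Fin 3} {v : Fin 3 → ℂ} (hv : v i ≠ 0) (F : PolyRing) :
    coordSubstInv i v (coordSubst i v F) = F := by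
  have : (coordSubstInv i v).comp (coordSubst i v) = AlgHom.id ℂ _ := by
    apply MvPolynomial.algHom_ext
    intro j
    by_cases hj : j = i
    · subst hj
      have : C (v j) * (C (v j)⁻¹ * X j) = (X j : PolyRing) := by
        rw [← mul_assoc, ← C_mul, mul_inv_cancel₀ hv, C_1, one_mul]
      simpa [coordSubst, coordSubstInv] using this
    · simp [coordSubst, coordSubstInv, hj, ← mul_assoc, div_eq_mul_inv]
  exact DFunLike.congr_fun this F

lemma coordSubst_isHomogeneous {i : Fin 3} {v : Fin 3 → ℂ} {F : PolyRing} {D : ℕ}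
    (hF : F.IsHomogeneous D) : (coordSubst i v F).IsHomogeneous D := by
  have := hF.aeval (fun j => if j = i then C (v i) * X i else X j + C (v j) * X i) (n := 1)
    (fun j => by
      split_ifs
      · exact isHomogeneous_C_mul_X _ _
      · exact (isHomogeneous_X _ _).add (isHomogeneous_C_mul_X _ _))
  simpa [coordSubst] using this

/-- Once `v` is the `i`-th coordinate point, the other two coordinates vanish there, so a monomial
has order at least its degree in them. This direction alone suffices for bounding the number of
conditions. -/
lemma lowVan_of_coeff_coordSubst {i : Fin 3} {v : Fin 3 → ℂ} (hv : v i ≠ 0) {k : ℕ}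
    {F : PolyRing} (h : ∀ a : Fin 3 →₀ ℕ, ∑ j ∈ {i}ᶜ, a j < k → coeff a (coordSubst i v F) = 0) :
    LowVan k (taylorHom v F) := by
  rw [← coordSubstInv_coordSubst hv F, (coordSubst i v F).as_sum, map_sum, map_sum]
  refine LowVan.sum _ fun a ha => ?_
  have hk : k ≤ ∑ j ∈ {i}ᶜ, a j := by
    by_contra! hlt
    exact mem_support_iff.1 ha (h a hlt)
  rw [monomial_eq, Finsupp.prod_fintype _ _ (by simp), ← Finset.prod_compl_mul_prod {i}]
  simp only [map_mul, map_prod, map_pow, algHom_C]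
  have hp : LowVan (∑ j ∈ {i}ᶜ, a j)
      (∏ j ∈ {i}ᶜ, taylorHom v (coordSubstInv i v (X j)) ^ a j) := by
    refine LowVan.prod _ fun j hj => ?_
    have hji : j ≠ i := by simpa using hj
    have : LowVan 1 (taylorHom v (coordSubstInv i v (X j))) := by
      have hh : taylorHom v (coordSubstInv i v (X j)) = X j - C (v j / v i) * X i := by
        simp only [taylorHom, coordSubstInv, aeval_X, if_neg hji, map_sub, map_mul, algHom_C,
          algebraMap_eq]
        rw [mul_add, ← C_mul, div_mul_cancel₀ _ hv]
        ring
      rw [hh]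
      exact lowVan_of_isHomogeneous ((isHomogeneous_X _ _).sub (isHomogeneous_C_mul_X _ _))
    simpa using this.pow (a j)
  have h1 := (lowVan_zero (algebraMap ℂ PolyRing (coeff a (coordSubst i v F)))).mul
    (hp.mul (lowVan_zero (∏ j ∈ {i}, taylorHom v (coordSubstInv i v (X j)) ^ a j)))
  have e : taylorHom v (algebraMap ℂ PolyRing (coeff a (coordSubst i v F))) =
    algebraMap ℂ PolyRing (coeff a (coordSubst i v F)) := AlgHom.commutes _ _
  rw [e]
  exact h1.mono (by lia)

/-- The index set of the conditions for a form to vanish to order `k` at a point. -/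
abbrev JetIndex (i : Fin 3) (k : ℕ) : Type :=
  Σ n : Fin k, ({i}ᶜ : Finset (Fin 3)).finsuppAntidiag n.1

lemma card_jetIndex (i : Fin 3) (k : ℕ) : Fintype.card (JetIndex i k) = (k + 1).choose 2 := by
  rw [Fintype.card_sigma]
  simp only [Fintype.card_coe, Finset.card_finsuppAntidiag_nat_eq_choose, Finset.card_compl,
    Finset.card_singleton, Fintype.card_fin]
  rw [Fin.sum_univ_eq_sum_range (fun n => (3 - 1 + n - 1).choose n)]
  induction k with
  | zero => rfl
  | succ k ih =>
    rw [Finset.sum_range_succ, ih, show 3 - 1 + k - 1 = k + 1 by lia, Nat.choose_succ_succ' (k + 1),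
      Nat.choose_one_right, Nat.choose_succ_self_right]
    ring

lemma exists_rep_ne_zero (p : Plane) : ∃ i, p.rep i ≠ 0 := Function.ne_iff.1 p.rep_nonzero

/-- Vanishing to order `k i` at `x i` amounts to at most `∑ i, (k i + 1).choose 2` conditions. -/
lemma le_finrank_formsVanishing {ι : Type*} [Fintype ι] (x : ι → Plane) (D : ℕ) (k : ι → ℕ) :
    (D + 2).choose 2 ≤ Module.finrank ℂ (formsVanishing x D k) + ∑ i, (k i + 1).choose 2 := by
  choose c hc using fun i => exists_rep_ne_zero (x i)
  -- In degree `D` the exponent of the remaining variable is forced to be `D - n`. When `n > D`,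
  -- truncated subtraction only adds conditions that hold automatically.
  let Φ : homogeneousSubmodule (Fin 3) ℂ D →ₗ[ℂ] ((Σ i, JetIndex (c i) (k i)) → ℂ) :=
    { toFun := fun F j => coeff (j.2.2.1 + Finsupp.single (c j.1) (D - j.2.1.1))
        (coordSubst (c j.1) (x j.1).rep F.1)
      map_add' := fun F G => by ext j; simp
      map_smul' := fun a F => by ext j; simp }
  have hker : (LinearMap.ker Φ).map (Submodule.subtype _) ≤ formsVanishing x D k := by
    rintro _ ⟨F, hF, rfl⟩
    refine ⟨F.2, fun i => ?_⟩
    refine lowVan_of_coeff_coordSubst (hc i) fun a ha => ?_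
    by_cases had : a.degree = D
    · have hsum : ∑ j ∈ {c i}ᶜ, a j + a (c i) = D := by
        rw [← had, Finsupp.degree_eq_sum, ← Finset.sum_compl_add_sum {c i}, Finset.sum_singleton]
      let n : Fin (k i) := ⟨∑ j ∈ {c i}ᶜ, a j, ha⟩
      have hmem : a.erase (c i) ∈ ({c i}ᶜ : Finset (Fin 3)).finsuppAntidiag n.1 := by
        rw [Finset.mem_finsuppAntidiag]
        refine ⟨Finset.sum_congr rfl fun j hj => Finsupp.erase_ne (by simpa using hj), ?_⟩
        intro j hj
        rw [Finsupp.support_erase, Finset.mem_erase] at hj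
        simpa using hj.1
      have hz := congrFun (LinearMap.mem_ker.1 hF) ⟨i, n, ⟨a.erase (c i), hmem⟩⟩
      have hDn : D - n.1 = a (c i) := by simp only [n]; lia
      simp only [Φ, LinearMap.coe_mk, AddHom.coe_mk, hDn, Pi.zero_apply,
        Finsupp.erase_add_single] at hz
      exact hz
    · exact (coordSubst_isHomogeneous F.2).coeff_eq_zero had
  have h1 := LinearMap.finrank_range_add_finrank_ker Φ
  have h2 : Module.finrank ℂ (LinearMap.range Φ) ≤ ∑ i, (k i + 1).choose 2 := by
    refine (Submodule.finrank_le _).trans ?_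
    rw [Module.finrank_fintype_fun_eq_card, Fintype.card_sigma]
    simp only [card_jetIndex, le_refl]
  have h3 : Module.finrank ℂ (LinearMap.ker Φ) ≤ Module.finrank ℂ (formsVanishing x D k) := by
    rw [← Submodule.finrank_map_subtype_eq]
    exact Submodule.finrank_mono hker
  rw [finrank_homogeneousSubmodule] at h1
  lia

/-! ### Linear forms -/

/-- The linear form with coefficients `c`. -/
def linForm (c : Fin 3 → ℂ) : PolyRing := ∑ i, C (c i) * X i

lemma linForm_isHomogeneous (c : Fin 3 → ℂ) : (linForm c).IsHomogeneous 1 :=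
  IsHomogeneous.sum _ _ _ fun _ _ => isHomogeneous_C_mul_X _ _

lemma eval_linForm (c w : Fin 3 → ℂ) : eval w (linForm c) = c ⬝ᵥ w := by
  simp [linForm, dotProduct]

lemma aeval_linForm {A : Type*} [CommRing A] [Algebra ℂ A] (c : Fin 3 → ℂ) (w : Fin 3 → A) :
    aeval w (linForm c) = ∑ i, c i • w i := by
  simp [linForm, Algebra.smul_def]

lemma taylorHom_linForm {c v : Fin 3 → ℂ} (h : c ⬝ᵥ v = 0) :
    taylorHom v (linForm c) = linForm c := by
  have : taylorHom v (linForm c) = linForm c + C (c ⬝ᵥ v) := by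
    simp only [linForm, taylorHom, map_sum, map_mul, algHom_C, aeval_X, algebraMap_eq, dotProduct,
      mul_add, Finset.sum_add_distrib]
  rw [this, h, C_0, add_zero]

lemma exists_dotProduct_separating {v w : Fin 3 → ℂ} (h : LinearIndependent ℂ ![v, w]) :
    ∃ c : Fin 3 → ℂ, c ⬝ᵥ v = 0 ∧ c ⬝ᵥ w ≠ 0 := by
  have hw : w ∉ Submodule.span ℂ {v} := by
    intro hmem
    obtain ⟨a, rfl⟩ := Submodule.mem_span_singleton.1 hmem
    have := LinearIndependent.pair_iff.1 h a (-1) (by simp)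
    simp at this
  obtain ⟨f, hf, hfv⟩ := Submodule.exists_le_ker_of_notMem hw
  refine ⟨fun i => f fun j => if i = j then 1 else 0, ?_, ?_⟩
  · have := hfv (Submodule.mem_span_singleton_self v)
    rw [LinearMap.mem_ker, LinearMap.pi_apply_eq_sum_univ f v] at this
    simpa [dotProduct, mul_comm] using this
  · rw [LinearMap.pi_apply_eq_sum_univ f w] at hf
    simpa [dotProduct, mul_comm] using hf

lemma linearIndependent_rep {p q : Plane} (h : p ≠ q) : LinearIndependent ℂ ![p.rep, q.rep] := by
  rw [LinearIndependent.pair_iff' p.rep_nonzero]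
  rintro a ha
  apply h
  rw [← p.mk_rep, ← q.mk_rep, eq_comm, Projectivization.mk_eq_mk_iff']
  exact ⟨a, ha⟩

end BlowUpPlane
end

/-! ### Independence of the multiplicity conditions in large degree -/

noncomputable section

namespace BlowUpPlane

open MvPolynomial

/-- Two linear forms through a point whose products are linearly independent. -/
lemma exists_linForm_pair (p : Plane) : ∃ c₁ c₂ w₁ w₂ : Fin 3 → ℂ, c₁ ⬝ᵥ p.rep = 0 ∧
    c₂ ⬝ᵥ p.rep = 0 ∧ c₁ ⬝ᵥ w₁ = 1 ∧ c₁ ⬝ᵥ w₂ = 0 ∧ c₂ ⬝ᵥ w₁ = 0 ∧ c₂ ⬝ᵥ w₂ = 1 := by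
  obtain ⟨i, hi⟩ := exists_rep_ne_zero p
  have h1 : i + 1 ≠ i := by fin_cases i <;> decide
  have h2 : i + 2 ≠ i := by fin_cases i <;> decide
  have h12 : i + 1 ≠ i + 2 := by fin_cases i <;> decide
  refine ⟨Pi.single (i + 1) 1 - Pi.single i (p.rep (i + 1) / p.rep i),
    Pi.single (i + 2) 1 - Pi.single i (p.rep (i + 2) / p.rep i),
    Pi.single (i + 1) 1, Pi.single (i + 2) 1, ?_, ?_, ?_, ?_, ?_, ?_⟩
  all_goals simp [sub_dotProduct, hi, h1, h2, h12, h12.symm]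

lemma exists_linForm_ne_zero (p : Plane) : ∃ c : Fin 3 → ℂ, c ⬝ᵥ p.rep ≠ 0 := by
  obtain ⟨i, hi⟩ := exists_rep_ne_zero p
  exact ⟨Pi.single i 1, by simpa using hi⟩

lemma vanishesToOrder_one_linForm {p : Plane} {c : Fin 3 → ℂ} (h : c ⬝ᵥ p.rep = 0) :
    VanishesToOrder p 1 (linForm c) := by
  rw [vanishesToOrder_one_iff, eval_linForm, h]

/-- A form of large degree with assigned multiplicities at finitely many points that does not
vanish at another point. -/
lemma exists_form_ne_zero_at {ι : Type*} (s : Finset ι) (x : ι → Plane) (k : ι → ℕ)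
    (p : Plane) (hp : ∀ i ∈ s, x i ≠ p) {D : ℕ} (hD : ∑ i ∈ s, k i ≤ D) :
    ∃ P : PolyRing, P.IsHomogeneous D ∧ (∀ i ∈ s, VanishesToOrder (x i) (k i) P) ∧
      eval p.rep P ≠ 0 := by
  classical
  have hex : ∀ i, ∃ c : Fin 3 → ℂ, i ∈ s → c ⬝ᵥ (x i).rep = 0 ∧ c ⬝ᵥ p.rep ≠ 0 := fun i => by
    by_cases hi : i ∈ s
    · obtain ⟨c, hc⟩ := exists_dotProduct_separating (linearIndependent_rep (hp i hi))
      exact ⟨c, fun _ => hc⟩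
    · exact ⟨0, fun h => absurd h hi⟩
  choose c hc using hex
  obtain ⟨u, hu⟩ := exists_linForm_ne_zero p
  refine ⟨(∏ i ∈ s, linForm (c i) ^ k i) * linForm u ^ (D - ∑ i ∈ s, k i), ?_, ?_, ?_⟩
  · have h1 : (∏ i ∈ s, linForm (c i) ^ k i).IsHomogeneous (∑ i ∈ s, k i) :=
      IsHomogeneous.prod _ _ _ fun i _ => by
        simpa using (linForm_isHomogeneous (c i)).pow (k i)
    have h2 := h1.mul ((linForm_isHomogeneous u).pow (D - ∑ i ∈ s, k i))
    rwa [one_mul, Nat.add_sub_cancel' hD] at h2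
  · intro i hi
    rw [← Finset.mul_prod_erase s _ hi, mul_assoc]
    have h1 : VanishesToOrder (x i) (k i) (linForm (c i) ^ k i) := by
      simpa using (vanishesToOrder_one_linForm (hc i hi).1).pow (k i)
    exact h1.mul (vanishesToOrder_order_zero _ _)
  · rw [map_mul, map_prod, map_pow]
    refine mul_ne_zero (Finset.prod_ne_zero_iff.2 fun i hi => ?_) (pow_ne_zero _ ?_)
    · rw [map_pow, eval_linForm]
      exact pow_ne_zero _ (hc i hi).2
    · rwa [eval_linForm]

lemma eq_zero_of_vanishesToOrder_binary {p : Plane} {c₁ c₂ w₁ w₂ : Fin 3 → ℂ}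
    (h₁ : c₁ ⬝ᵥ p.rep = 0) (h₂ : c₂ ⬝ᵥ p.rep = 0) (h₁₁ : c₁ ⬝ᵥ w₁ = 1) (h₁₂ : c₁ ⬝ᵥ w₂ = 0)
    (h₂₁ : c₂ ⬝ᵥ w₁ = 0) (h₂₂ : c₂ ⬝ᵥ w₂ = 1) {n : ℕ} {a : Fin (n + 1) → ℂ}
    (h : VanishesToOrder p (n + 1)
      (∑ b, a b • (linForm c₁ ^ b.1 * linForm c₂ ^ (n - b.1)))) : a = 0 := by
  set B : PolyRing := ∑ b, a b • (linForm c₁ ^ b.1 * linForm c₂ ^ (n - b.1)) with hB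
  have hhom : B.IsHomogeneous n := by
    refine IsHomogeneous.sum _ _ _ fun b _ => (homogeneousSubmodule (Fin 3) ℂ n).smul_mem _ ?_
    have := ((linForm_isHomogeneous c₁).pow b.1).mul ((linForm_isHomogeneous c₂).pow (n - b.1))
    rwa [one_mul, one_mul, Nat.add_sub_cancel' (Nat.lt_succ_iff.1 b.2)] at this
  -- Both linear forms vanish at `p`, so translating to `p` changes nothing. A form of degree `n`
  -- with no terms below degree `n + 1` is zero; restricting it to `t • w₁ + w₂` recovers the
  -- coefficients.
  have htay : taylorHom p.rep B = B := by
    simp only [hB, map_sum, map_smul, map_mul, map_pow, taylorHom_linForm h₁, taylorHom_linForm h₂]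
  have hB0 : B = 0 := by
    have h' : homogeneousComponent n (taylorHom p.rep B) = 0 := h n (Nat.lt_succ_self n)
    rwa [htay, homogeneousComponent_eq_self hhom] at h'
  have hpoly : ∑ b : Fin (n + 1), Polynomial.monomial b.1 (a b) = 0 := by
    apply Polynomial.funext
    intro t
    have := congrArg (eval (t • w₁ + w₂)) hB0
    simpa [hB, map_sum, smul_eval, eval_linForm, dotProduct_add, h₁₁, h₁₂, h₂₁, h₂₂,
      Polynomial.eval_finsetSum] using this
  funext b
  have := congrArg (fun q => Polynomial.coeff q b.1) hpoly
  simpa [Polynomial.finsetSum_coeff, Polynomial.coeff_monomial, Fin.val_inj] using this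

/-- Raising one multiplicity from `c` to `c + 1` imposes `c + 1` independent conditions. -/
lemma finrank_formsVanishing_update {ι : Type*} [Fintype ι] [DecidableEq ι] {x : ι → Plane}
    (hx : Function.Injective x) {D : ℕ} {k : ι → ℕ} (hD : ∑ i, k i ≤ D) (i : ι) :
    Module.finrank ℂ (formsVanishing x D (Function.update k i (k i + 1))) + (k i + 1) ≤
      Module.finrank ℂ (formsVanishing x D k) := by
  obtain ⟨c₁, c₂, w₁, w₂, h₁, h₂, h₁₁, h₁₂, h₂₁, h₂₂⟩ := exists_linForm_pair (x i)
  have hsum : ∑ j ∈ Finset.univ.erase i, k j ≤ D - k i := by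
    have := Finset.add_sum_erase Finset.univ k (Finset.mem_univ i)
    lia
  obtain ⟨P, hPh, hPv, hP0⟩ := exists_form_ne_zero_at (Finset.univ.erase i) x k (x i)
    (fun j hj => hx.ne (Finset.ne_of_mem_erase hj)) hsum
  have hki : k i ≤ D := (Finset.single_le_sum (fun _ _ => Nat.zero_le _) (Finset.mem_univ i)).trans hD
  let B : (Fin (k i + 1) → ℂ) →ₗ[ℂ] PolyRing :=
    Fintype.linearCombination ℂ fun b => linForm c₁ ^ b.1 * linForm c₂ ^ (k i - b.1)
  have hB : ∀ a, B a = ∑ b, a b • (linForm c₁ ^ b.1 * linForm c₂ ^ (k i - b.1)) := fun a =>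
    Fintype.linearCombination_apply _ _ _
  have hBh : ∀ a, (B a).IsHomogeneous (k i) := fun a => by
    rw [hB]
    refine IsHomogeneous.sum _ _ _ fun b _ => (homogeneousSubmodule (Fin 3) ℂ _).smul_mem _ ?_
    have := ((linForm_isHomogeneous c₁).pow b.1).mul ((linForm_isHomogeneous c₂).pow (k i - b.1))
    rwa [one_mul, one_mul, Nat.add_sub_cancel' (Nat.lt_succ_iff.1 b.2)] at this
  have hBv : ∀ a, VanishesToOrder (x i) (k i) (B a) := fun a => by
    rw [hB, vanishesToOrder_iff, map_sum]
    refine LowVan.sum _ fun b _ => ?_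
    rw [map_smul]
    refine LowVan.smul ?_ _
    have := ((vanishesToOrder_one_linForm h₁).pow b.1).mul
      ((vanishesToOrder_one_linForm h₂).pow (k i - b.1))
    rwa [mul_one, mul_one, Nat.add_sub_cancel' (Nat.lt_succ_iff.1 b.2)] at this
  -- The new `k i + 1` dimensions are realized by `B a * P`: `B a` is a binary form of degree `k i`
  -- in lines through `x i`, and `P` carries the other multiplicities without vanishing at `x i`.
  let Ψ : formsVanishing x D (Function.update k i (k i + 1)) × (Fin (k i + 1) → ℂ) →ₗ[ℂ]
      formsVanishing x D k := LinearMap.codRestrict _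
    ((Submodule.subtype _).coprod ((LinearMap.mulRight ℂ P).comp B)) (by
      rintro ⟨f, a⟩
      refine Submodule.add_mem _ ⟨f.2.1, fun j => (f.2.2 j).mono ?_⟩ ⟨?_, fun j => ?_⟩
      · by_cases hj : j = i
        · subst hj; simp
        · simp [hj]
      · have := (hBh a).mul hPh
        rwa [Nat.add_sub_cancel' hki] at this
      · change VanishesToOrder (x j) (k j) (B a * P)
        by_cases hj : j = i
        · subst hj
          exact (hBv a).mul (vanishesToOrder_order_zero _ _)
        · simpa using (vanishesToOrder_order_zero (x j) (B a)).mul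
            (hPv j (Finset.mem_erase.2 ⟨hj, Finset.mem_univ j⟩)))
  have hinj : Function.Injective Ψ := by
    rw [← LinearMap.ker_eq_bot, LinearMap.ker_eq_bot']
    rintro ⟨f, a⟩ hfa
    have h0 : f.1 + B a * P = 0 := congrArg Subtype.val hfa
    have hv : VanishesToOrder (x i) (k i + 1) (B a * P) := by
      have := f.2.2 i
      rw [Function.update_self] at this
      rw [eq_neg_of_add_eq_zero_right h0, ← neg_one_smul ℂ]
      exact this.smul _
    have hv' : VanishesToOrder (x i) (k i + 1) (B a) := by
      have hP : homogeneousComponent 0 (taylorHom (x i).rep P) ≠ 0 := by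
        intro hc
        apply hP0
        rw [← vanishesToOrder_one_iff]
        intro n hn
        obtain rfl : n = 0 := by lia
        exact hc
      refine LowVan.of_mul (lowVan_zero _) hP ?_
      rw [zero_add, taylorAt_eq, ← map_mul, mul_comm]
      exact hv
    rw [hB] at hv'
    have ha := eq_zero_of_vanishesToOrder_binary h₁ h₂ h₁₁ h₁₂ h₂₁ h₂₂ hv'
    subst ha
    rw [map_zero, zero_mul, add_zero] at h0
    exact Prod.ext (Subtype.ext h0) rfl
  have := LinearMap.finrank_le_finrank_of_injective hinj
  rwa [Module.finrank_prod, Module.finrank_fin_fun] at this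

/-- In large degree the conditions are independent. -/
lemma finrank_formsVanishing_le {ι : Type*} [Fintype ι] {x : ι → Plane}
    (hx : Function.Injective x) {D : ℕ} {k : ι → ℕ} (hD : ∑ i, k i ≤ D) :
    Module.finrank ℂ (formsVanishing x D k) + ∑ i, (k i + 1).choose 2 ≤ (D + 2).choose 2 := by
  classical
  induction hn : ∑ i, k i generalizing k with
  | zero =>
    have hk : ∀ i, k i = 0 := by simpa using hn
    simp only [hk, zero_add, show Nat.choose 1 2 = 0 from rfl,
      Finset.sum_const_zero, add_zero]
    rw [← finrank_homogeneousSubmodule]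
    exact Submodule.finrank_mono (formsVanishing_le _ _ _)
  | succ n ih =>
    obtain ⟨i, hi⟩ : ∃ i, k i ≠ 0 := by
      by_contra! hk
      simp [hk] at hn
    obtain ⟨c, hc⟩ := Nat.exists_eq_succ_of_ne_zero hi
    set k' := Function.update k i c with hk'
    have hkk : k = Function.update k' i (k' i + 1) := by
      simp [hk', ← Nat.succ_eq_add_one, ← hc]
    have hsum : ∀ f : ℕ → ℕ, ∑ j, f (k j) + f c = ∑ j, f (k' j) + f (c + 1) := fun f => by
      rw [← Finset.add_sum_erase Finset.univ (fun j => f (k j)) (Finset.mem_univ i),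
        ← Finset.add_sum_erase Finset.univ (fun j => f (k' j)) (Finset.mem_univ i)]
      have : ∑ j ∈ Finset.univ.erase i, f (k j) = ∑ j ∈ Finset.univ.erase i, f (k' j) :=
        Finset.sum_congr rfl fun j hj => by simp [hk', Finset.ne_of_mem_erase hj]
      simp only [this, hc, hk', Function.update_self, Nat.succ_eq_add_one]
      ring
    have h1 := hsum id
    have h2 := hsum fun n => (n + 1).choose 2
    simp only [id] at h1 h2
    have h3 := ih (k := k') (by lia) (by lia)
    have h4 := finrank_formsVanishing_update hx (D := D) (k := k') (by lia) i
    rw [← hkk] at h4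
    have h5 : k' i = c := by simp [hk']
    have h6 : (c + 1 + 1).choose 2 = (c + 1) + (c + 1).choose 2 := by
      rw [Nat.choose_succ_succ' (c + 1), Nat.choose_one_right]
    lia

lemma finrank_formsVanishing {ι : Type*} [Fintype ι] {x : ι → Plane}
    (hx : Function.Injective x) {D : ℕ} {k : ι → ℕ} (hD : ∑ i, k i ≤ D) :
    Module.finrank ℂ (formsVanishing x D k) + ∑ i, (k i + 1).choose 2 = (D + 2).choose 2 :=
  le_antisymm (finrank_formsVanishing_le hx hD) (le_finrank_formsVanishing x D k)

end BlowUpPlane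
end

noncomputable section

namespace BlowUpPlane

open MvPolynomial

/-! ### Points on plane curves -/

lemma eval_smul_of_isHomogeneous {F : PolyRing} {d : ℕ} (hF : F.IsHomogeneous d) (a : ℂ)
    (w : Fin 3 → ℂ) : eval (a • w) F = a ^ d * eval w F := by
  rw [eval_eq, eval_eq, Finset.mul_sum]
  refine Finset.sum_congr rfl fun s hs => ?_
  have hd : d = ∑ i ∈ s.support, s i := hF.degree_eq_sum_deg_support hs
  simp only [Pi.smul_apply, smul_eq_mul, mul_pow, Finset.prod_mul_distrib, Finset.prod_pow_eq_pow_sum]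
  rw [← hd]
  ring

lemma eval_rep_mk_eq_zero_iff {F : PolyRing} {d : ℕ} (hF : F.IsHomogeneous d) {w : Fin 3 → ℂ}
    (hw : w ≠ 0) : eval (Projectivization.mk ℂ w hw).rep F = 0 ↔ eval w F = 0 := by
  obtain ⟨a, ha⟩ := Projectivization.exists_smul_eq_mk_rep ℂ w hw
  rw [← ha, Units.smul_def, eval_smul_of_isHomogeneous hF]
  simp

/-- A non-unit dividing a nonzero linear form is a scalar multiple of it, and there are two
non-proportional linear forms through `p`. -/
lemma exists_linForm_not_dvd {f : PolyRing} (hf : ¬ IsUnit f) (p : Plane) :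
    ∃ c : Fin 3 → ℂ, c ⬝ᵥ p.rep = 0 ∧ ¬ f ∣ linForm c := by
  obtain ⟨c₁, c₂, w₁, w₂, h₁, h₂, h₁₁, h₁₂, h₂₁, h₂₂⟩ := exists_linForm_pair p
  by_contra! h
  obtain ⟨u₁, hu₁⟩ := h c₁ h₁
  obtain ⟨u₂, hu₂⟩ := h c₂ h₂
  have hc₁ : linForm c₁ ≠ 0 := fun hz => by
    have := congrArg (eval w₁) hz
    simp [eval_linForm, h₁₁] at this
  have hc₂ : linForm c₂ ≠ 0 := fun hz => by
    have := congrArg (eval w₂) hz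
    simp [eval_linForm, h₂₂] at this
  obtain ⟨k, l, hkl, hk, hl⟩ := isHomogeneous_of_mul (hu₂ ▸ linForm_isHomogeneous c₂)
    (hu₂ ▸ hc₂)
  have hk0 : k ≠ 0 := by
    rintro rfl
    apply hf
    rw [← totalDegree_zero_iff_isHomogeneous, totalDegree_eq_zero_iff_eq_C] at hk
    rw [hk]
    refine (isUnit_iff_ne_zero.2 fun h0 => ?_).map C
    rw [h0, C_0] at hk
    exact hc₂ (by rw [hu₂, hk, zero_mul])
  obtain rfl : l = 0 := by lia
  rw [← totalDegree_zero_iff_isHomogeneous, totalDegree_eq_zero_iff_eq_C] at hl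
  have e1 := congrArg (eval w₁) hu₁
  have e2 := congrArg (eval w₁) hu₂
  have e3 := congrArg (eval w₂) hu₂
  rw [hl] at e2 e3
  rw [eval_linForm, map_mul] at e1 e2 e3
  rw [h₁₁] at e1
  rw [h₂₁, eval_C] at e2
  rw [h₂₂, eval_C] at e3
  rcases mul_eq_zero.1 e2.symm with h0 | h0
  · rw [h0, zero_mul] at e1
    exact one_ne_zero e1
  · rw [h0, mul_zero] at e3
    exact one_ne_zero e3

/-- An irreducible plane curve has points outside any finite set and any other curve. -/
lemma exists_point {f H : PolyRing} {d e : ℕ} (hf : Irreducible f) (hfd : f.IsHomogeneous d)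
    (hH : H.IsHomogeneous e) (hfH : ¬ f ∣ H) (S : Finset Plane) :
    ∃ p : Plane, p ∉ S ∧ eval p.rep f = 0 ∧ eval p.rep H ≠ 0 := by
  classical
  by_contra! hcon
  choose c hc hcf using exists_linForm_not_dvd hf.not_isUnit
  have p₀ : Plane := Projectivization.mk ℂ (Pi.single 0 1) (by simp)
  have hprime : Prime f := hf.prime
  -- Nullstellensatz: this product vanishes on the whole affine cone of `f`. The factors over `S`
  -- handle the excluded points, and `linForm (c p₀)` handles the origin, which is no point of the
  -- plane.
  have hv : H * ((∏ s ∈ S, linForm (c s)) * linForm (c p₀)) ∈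
      vanishingIdeal ℂ (zeroLocus ℂ (Ideal.span {f})) := by
    rw [mem_vanishingIdeal_iff]
    intro w hw
    have hfw : eval w f = 0 := by
      simpa using (mem_zeroLocus_iff.1 hw) f (Ideal.mem_span_singleton_self f)
    rw [aeval_eq_eval]
    change eval w _ = 0
    rw [map_mul, map_mul, map_prod]
    by_cases hw0 : w = 0
    · rw [hw0, eval_linForm (c p₀), dotProduct_zero, mul_zero, mul_zero]
    · by_cases hS : Projectivization.mk ℂ w hw0 ∈ S
      · have : eval w (linForm (c (Projectivization.mk ℂ w hw0))) = 0 := by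
          rw [← eval_rep_mk_eq_zero_iff (linForm_isHomogeneous _) hw0, eval_linForm, hc]
        rw [Finset.prod_eq_zero hS this]
        simp
      · have := hcon _ hS ((eval_rep_mk_eq_zero_iff hfd hw0).2 hfw)
        rw [eval_rep_mk_eq_zero_iff hH hw0] at this
        simp [this]
  have : (Ideal.span {f}).IsPrime := (Ideal.span_singleton_prime hf.ne_zero).2 hprime
  rw [IsPrime.vanishingIdeal_zeroLocus, Ideal.mem_span_singleton] at hv
  rcases hprime.dvd_or_dvd hv with h | h
  · exact hfH h
  rcases hprime.dvd_or_dvd h with h | h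
  · obtain ⟨s, _, hs⟩ := (hprime.dvd_finsetProd_iff _).1 h
    exact hcf s hs
  · exact hcf _ h

lemma exists_points {f : PolyRing} {d : ℕ} (hf : Irreducible f) (hfd : f.IsHomogeneous d)
    (S : Finset Plane) (n : ℕ) :
    ∃ T : Finset Plane, T.card = n ∧ Disjoint T S ∧ ∀ p ∈ T, eval p.rep f = 0 := by
  classical
  induction n with
  | zero => exact ⟨∅, by simp⟩
  | succ n ih =>
    obtain ⟨T, hT, hTS, hTf⟩ := ih
    obtain ⟨p, hp, hpf, -⟩ := exists_point hf hfd (isHomogeneous_one (Fin 3) ℂ)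
      (fun h => hf.not_isUnit (isUnit_of_dvd_one h)) (T ∪ S)
    rw [Finset.mem_union, not_or] at hp
    refine ⟨insert p T, by rw [Finset.card_insert_of_notMem hp.1, hT], ?_, ?_⟩
    · rw [Finset.disjoint_insert_left]
      exact ⟨hp.2, hTS⟩
    · intro q hq
      rcases Finset.mem_insert.1 hq with rfl | hq
      · exact hpf
      · exact hTf q hq

/-! ### Intersection numbers and the genus -/

lemma two_mul_choose_two (n : ℕ) : 2 * ((n + 1).choose 2 : ℤ) = (n + 1) * n := by
  induction n with
  | zero => rfl
  | succ n ih =>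
    rw [Nat.choose_succ_succ' (n + 1), Nat.choose_one_right]
    push_cast at ih ⊢
    linarith

/-- Bézout's inequality for plane curves with assigned multiplicities. -/
lemma sum_mul_le_mul_of_not_dvd {ι : Type*} [Fintype ι] {x : ι → Plane} (hx : Function.Injective x)
    {F G : PolyRing} {d e : ℕ} (hF : Irreducible F) (hFd : F.IsHomogeneous d)
    (hGe : G.IsHomogeneous e) (hFG : ¬ F ∣ G) {m k : ι → ℕ}
    (hm : ∀ i, VanishesToOrder (x i) (m i) F) (hk : ∀ i, VanishesToOrder (x i) (k i) G) :
    ∑ i, m i * k i ≤ d * e := by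
  -- Raising all degrees by `s` makes the conditions for the multiplicities `m i + k i` independent,
  -- which gives the upper bound for the target of `Φ`.
  set s := ∑ i, m i + ∑ i, k i with hs
  let V₁ := formsVanishing x (e + s) k
  let V₂ := formsVanishing x (d + s) m
  let Φ : V₁ × V₂ →ₗ[ℂ] PolyRing :=
    ((LinearMap.mulRight ℂ F).comp V₁.subtype).coprod ((LinearMap.mulRight ℂ G).comp V₂.subtype)
  have hΦ : ∀ A B, Φ (A, B) = A.1 * F + B.1 * G := fun A B => rfl
  have hrange : LinearMap.range Φ ≤ formsVanishing x (d + e + s) (fun i => m i + k i) := by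
    rintro _ ⟨⟨A, B⟩, rfl⟩
    rw [hΦ]
    refine Submodule.add_mem _ ⟨?_, fun i => ?_⟩ ⟨?_, fun i => ?_⟩
    · have := A.2.1.mul hFd
      rwa [show e + s + d = d + e + s by ring] at this
    · have := (A.2.2 i).mul (hm i)
      rwa [add_comm] at this
    · have := B.2.1.mul hGe
      rwa [show d + s + e = d + e + s by ring] at this
    · exact (B.2.2 i).mul (hk i)
  -- Koszul relations: `A F + B G = 0` with `F` prime and not dividing `G` forces `B = F Z`, and `Z`
  -- of degree `s` determines the pair.
  have hker : Module.finrank ℂ (LinearMap.ker Φ) ≤ (s + 2).choose 2 := by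
    let W := (homogeneousSubmodule (Fin 3) ℂ s).map (LinearMap.mulLeft ℂ F)
    have hW : ∀ z : LinearMap.ker Φ, z.1.2.1 ∈ W := by
      rintro ⟨⟨A, B⟩, hAB⟩
      have h0 : A.1 * F + B.1 * G = 0 := hAB
      have hdvd : F ∣ B.1 * G := ⟨-A.1, by linear_combination h0⟩
      obtain ⟨Z, hZ⟩ := (hF.prime.dvd_or_dvd hdvd).resolve_right hFG
      refine ⟨Z, ?_, hZ.symm⟩
      exact isHomogeneous_of_mul_right (hZ ▸ B.2.1) hFd hF.ne_zero
    let Θ : LinearMap.ker Φ →ₗ[ℂ] W := LinearMap.codRestrict W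
      (V₂.subtype.comp ((LinearMap.snd ℂ V₁ V₂).comp (LinearMap.ker Φ).subtype)) hW
    have hΘ : Function.Injective Θ := by
      rintro ⟨⟨A, B⟩, hAB⟩ ⟨⟨A', B'⟩, hAB'⟩ h
      have hB : B.1 = B'.1 := congrArg (fun z : W => z.1) h
      have h0 : A.1 * F + B.1 * G = 0 := hAB
      have h0' : A'.1 * F + B'.1 * G = 0 := hAB'
      have hA : A.1 = A'.1 :=
        mul_right_cancel₀ hF.ne_zero (by linear_combination h0 - h0' - G * hB)
      exact Subtype.ext (Prod.ext (Subtype.ext hA) (Subtype.ext hB))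
    rw [← finrank_homogeneousSubmodule]
    exact (LinearMap.finrank_le_finrank_of_injective hΘ).trans (Submodule.finrank_map_le _ _)
  have h1 := LinearMap.finrank_range_add_finrank_ker Φ
  rw [Module.finrank_prod] at h1
  have h2 := Submodule.finrank_mono hrange
  have h3 : _ ≤ Module.finrank ℂ V₁ + _ := le_finrank_formsVanishing x (e + s) k
  have h4 : _ ≤ Module.finrank ℂ V₂ + _ := le_finrank_formsVanishing x (d + s) m
  have h5 := finrank_formsVanishing_le hx (D := d + e + s) (k := fun i => m i + k i)
    (by rw [Finset.sum_add_distrib]; lia)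
  have key : (e + s + 2).choose 2 + (d + s + 2).choose 2 + ∑ i, (m i + k i + 1).choose 2 ≤
      (d + e + s + 2).choose 2 + (s + 2).choose 2 + ∑ i, (k i + 1).choose 2 +
        ∑ i, (m i + 1).choose 2 := by linarith
  have e1 := two_mul_choose_two (e + s + 1)
  have e2 := two_mul_choose_two (d + s + 1)
  have e3 := two_mul_choose_two (d + e + s + 1)
  have e4 := two_mul_choose_two (s + 1)
  have e5 : 2 * ∑ i, ((m i + k i + 1).choose 2 : ℤ) = 2 * ∑ i, ((k i + 1).choose 2 : ℤ) +
      2 * ∑ i, ((m i + 1).choose 2 : ℤ) + 2 * ∑ i, (m i * k i : ℤ) := by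
    simp only [Finset.mul_sum, ← Finset.sum_add_distrib, two_mul_choose_two]
    refine Finset.sum_congr rfl fun i _ => ?_
    push_cast
    ring
  zify at key ⊢
  push_cast at e1 e2 e3 e4
  linarith

/-- The arithmetic genus of the proper transform of an irreducible plane curve is nonnegative. -/
lemma sum_mult_le_genus {ι : Type*} [Fintype ι] {x : ι → Plane} (hx : Function.Injective x)
    {F : PolyRing} {d : ℕ} (hF : Irreducible F) (hFd : F.IsHomogeneous d) :
    ∑ i, (multAt (x i) F : ℤ) * (multAt (x i) F - 1) ≤ (d - 1) * (d - 2) := by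
  classical
  set m : ι → ℕ := fun i => multAt (x i) F with hm
  -- Adjoint multiplicities. Truncation at `m i = 0` is harmless, since such a point contributes
  -- zero to every sum below.
  set k : ι → ℕ := fun i => m i - 1 with hk
  set τ := ∑ i, (k i + 1).choose 2 with hτ
  have hd : 1 ≤ d := by
    by_contra! h
    obtain rfl : d = 0 := by lia
    rw [← totalDegree_zero_iff_isHomogeneous, totalDegree_eq_zero_iff_eq_C] at hFd
    apply hF.not_isUnit
    rw [hFd]
    refine (isUnit_iff_ne_zero.2 fun h0 => hF.ne_zero ?_).map C
    rw [hFd, h0, C_0]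
  have hmk : ∀ i, (m i : ℤ) * (m i - 1) = (m i * k i : ℕ) := fun i => by
    simp only [hk]
    rcases Nat.eq_zero_or_pos (m i) with h | h
    · simp [h]
    · push_cast [Nat.cast_sub (show 1 ≤ m i from h)]
      ring
  have hτ2 : ∑ i, m i * k i = 2 * τ := by
    zify
    rw [hτ]
    push_cast
    rw [Finset.mul_sum]
    refine Finset.sum_congr rfl fun i _ => ?_
    rw [two_mul_choose_two]
    simp only [hk]
    rcases Nat.eq_zero_or_pos (m i) with h | h
    · simp [h]
    · push_cast [Nat.cast_sub (show 1 ≤ m i from h)]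
      ring
  have e1 := two_mul_choose_two (d + τ + 1)
  have e2 := two_mul_choose_two (τ + 1)
  push_cast at e1 e2
  have hd' : (1 : ℤ) ≤ d := by exact_mod_cast hd
  have hτ0 : (0 : ℤ) ≤ τ := Nat.cast_nonneg _
  -- `n` is the number of further points of the curve that can be imposed while the count still
  -- leaves one dimension more than the multiples of `F` have. The excess degree `τ` ensures `n ≥
  -- 0`.
  obtain ⟨n, hn⟩ : ∃ n, (d + τ + 2).choose 2 = (τ + 2).choose 2 + τ + n + 1 := by
    have : (τ + 2).choose 2 + τ + 1 ≤ (d + τ + 2).choose 2 := by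
      zify
      nlinarith
    obtain ⟨n, hn⟩ := Nat.exists_eq_add_of_le this
    exact ⟨n, by lia⟩
  obtain ⟨T, hT, hTx, hTF⟩ := exists_points hF hFd (Finset.univ.image x) n
  let y : ι ⊕ T → Plane := Sum.elim x Subtype.val
  have hy : Function.Injective y := by
    refine Function.Injective.sumElim hx Subtype.val_injective fun i t h => ?_
    exact Finset.disjoint_left.1 hTx t.2 (h ▸ Finset.mem_image_of_mem x (Finset.mem_univ i))
  let k' : ι ⊕ T → ℕ := Sum.elim k fun _ => 1
  have hdim := le_finrank_formsVanishing y (d + τ) k'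
  have hk' : ∑ i, (k' i + 1).choose 2 = τ + n := by
    rw [Fintype.sum_sum_type]
    simp [k', hT, hτ]
  let W := (homogeneousSubmodule (Fin 3) ℂ τ).map (LinearMap.mulLeft ℂ F)
  have hW : Module.finrank ℂ W ≤ (τ + 2).choose 2 := by
    rw [← finrank_homogeneousSubmodule]
    exact Submodule.finrank_map_le _ _
  obtain ⟨G, hG, hGW⟩ : ∃ G ∈ formsVanishing y (d + τ) k', G ∉ W := by
    by_contra! h
    have : Module.finrank ℂ (formsVanishing y (d + τ) k') ≤ Module.finrank ℂ W :=
      Submodule.finrank_mono h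
    lia
  have hFG : ¬ F ∣ G := by
    rintro ⟨Z, hZ⟩
    exact hGW ⟨Z, isHomogeneous_of_mul_right (hZ ▸ hG.1) hFd hF.ne_zero, hZ.symm⟩
  let m' : ι ⊕ T → ℕ := Sum.elim m fun _ => 1
  have hbez := sum_mul_le_mul_of_not_dvd hy hF hFd hG.1 hFG (m := m') (k := k') (by
    rintro (i | t)
    · exact (vanishesToOrder_iff_le_multAt hF.ne_zero).2 le_rfl
    · exact vanishesToOrder_one_iff.2 (hTF t.1 t.2)) hG.2
  rw [Fintype.sum_sum_type] at hbez
  simp only [m', k', Sum.elim_inl, Sum.elim_inr, mul_one, Finset.sum_const, Finset.card_univ,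
    Fintype.card_coe, hT, smul_eq_mul, hτ2] at hbez
  rw [Finset.sum_congr rfl fun i _ => hmk i, ← Nat.cast_sum, hτ2]
  zify at hbez hn
  push_cast
  linarith

end BlowUpPlane
end

noncomputable section

namespace BlowUpPlane

open MvPolynomial

/-! ### Pulling back forms to the affine line -/

lemma aeval_mul_of_isHomogeneous {A : Type*} [CommRing A] [Algebra ℂ A] {P : PolyRing} {D : ℕ}
    (hP : P.IsHomogeneous D) (a : A) (y : Fin 3 → A) :
    aeval (fun i => a * y i) P = a ^ D * aeval y P := by
  rw [aeval_def, aeval_def, eval₂_eq, eval₂_eq, Finset.mul_sum]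
  refine Finset.sum_congr rfl fun s hs => ?_
  have hd : D = ∑ i ∈ s.support, s i := hP.degree_eq_sum_deg_support hs
  simp only [mul_pow, Finset.prod_mul_distrib, Finset.prod_pow_eq_pow_sum]
  rw [← hd]
  ring

lemma aeval_taylorHom {A : Type*} [CommRing A] [Algebra ℂ A] (v : Fin 3 → ℂ) (y : Fin 3 → A)
    (P : PolyRing) : aeval y (taylorHom v P) = aeval (fun i => y i + algebraMap ℂ A (v i)) P := by
  have : (aeval y).comp (taylorHom v) = aeval (fun i => y i + algebraMap ℂ A (v i)) := by
    ext i
    simp [taylorHom]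
  exact DFunLike.congr_fun this P

lemma sum_homogeneousComponent_taylorHom {P : PolyRing} {D : ℕ} (hP : P.IsHomogeneous D)
    (v : Fin 3 → ℂ) :
    ∑ k ∈ Finset.range (D + 1), homogeneousComponent k (taylorHom v P) = taylorHom v P := by
  conv_rhs => rw [← sum_homogeneousComponent (taylorHom v P)]
  symm
  refine Finset.sum_subset (Finset.range_mono (Nat.succ_le_succ (taylorHom_totalDegree_le hP))) ?_
  intro k _ hk
  exact homogeneousComponent_eq_zero _ _ (by simpa using hk)

/-- The Taylor expansion of a form along a multiple of the base point. -/
lemma aeval_smul_add {A : Type*} [CommRing A] [IsDomain A] [Algebra ℂ A] {P : PolyRing} {D : ℕ}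
    (hP : P.IsHomogeneous D) (v : Fin 3 → ℂ) {α : A} (hα : α ≠ 0) (δ : Fin 3 → A) :
    aeval (fun i => α * algebraMap ℂ A (v i) + δ i) P =
      ∑ k ∈ Finset.range (D + 1), α ^ (D - k) *
        aeval δ (homogeneousComponent k (taylorHom v P)) := by
  -- In the fraction field `α v + δ = α (v + δ / α)`, so homogeneity reduces the claim to the Taylor
  -- expansion at `v`.
  let K := FractionRing A
  apply IsFractionRing.injective A K
  have hα' : algebraMap A K α ≠ 0 := by
    rwa [Ne, map_eq_zero_iff _ (IsFractionRing.injective A K)]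
  have key : ∀ (y : Fin 3 → A) (R : PolyRing), algebraMap A K (aeval y R) =
      aeval (fun i => algebraMap A K (y i)) R := fun y R =>
    (MvPolynomial.aeval_algebraMap_apply K y R).symm
  rw [key, map_sum]
  have e1 : (fun i => algebraMap A K (α * algebraMap ℂ A (v i) + δ i)) =
      fun i => algebraMap A K α *
        (algebraMap A K (δ i) / algebraMap A K α + algebraMap ℂ K (v i)) := by
    funext i
    rw [map_add, map_mul, ← IsScalarTower.algebraMap_apply ℂ A K]
    rw [mul_add, mul_comm _ (_ / _), div_mul_cancel₀ _ hα', add_comm]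
  rw [e1, aeval_mul_of_isHomogeneous hP, ← aeval_taylorHom,
    ← sum_homogeneousComponent_taylorHom hP v, map_sum, Finset.mul_sum]
  refine Finset.sum_congr rfl fun k hk => ?_
  have hk' : k ≤ D := by simpa [Nat.lt_succ_iff] using hk
  have e2 : (fun i => algebraMap A K (δ i) / algebraMap A K α) =
      fun i => (algebraMap A K α)⁻¹ * algebraMap A K (δ i) := by
    funext i
    rw [div_eq_inv_mul]
  rw [e2, aeval_mul_of_isHomogeneous (homogeneousComponent_isHomogeneous k _), map_mul, map_pow, key,
    sum_homogeneousComponent_taylorHom hP v, ← mul_assoc, inv_pow, ← div_eq_mul_inv]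
  congr 1
  rw [div_eq_iff (pow_ne_zero _ hα'), ← pow_add, Nat.sub_add_cancel hk']

lemma eval_aeval (τ : ℂ) (y : Fin 3 → Polynomial ℂ) (P : PolyRing) :
    (aeval y P).eval τ = MvPolynomial.eval (fun i => (y i).eval τ) P := by
  have : (Polynomial.aeval τ).comp (aeval y) =
      (aeval (fun i => (y i).eval τ) : PolyRing →ₐ[ℂ] ℂ) := by
    ext i
    simp
  have := DFunLike.congr_fun this P
  simpa [aeval_eq_eval] using this

/-- The order of the pull-back of a form along a germ of a curve through `v`. -/
lemma exists_aeval_eq_pow_mul {P : PolyRing} {D k o : ℕ} (hP : P.IsHomogeneous D) {v : Fin 3 → ℂ}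
    (hk : LowVan k (taylorHom v P)) (ho : o ≠ 0) {α : Polynomial ℂ} {τ : ℂ} (hα : α.eval τ ≠ 0)
    (η : Fin 3 → Polynomial ℂ) :
    ∃ R : Polynomial ℂ,
      aeval (fun i => α * Polynomial.C (v i) + (Polynomial.X - Polynomial.C τ) ^ o * η i) P =
        (Polynomial.X - Polynomial.C τ) ^ (o * k) * R ∧
      R.eval τ = α.eval τ ^ (D - k) *
        MvPolynomial.eval (fun i => (η i).eval τ) (homogeneousComponent k (taylorHom v P)) := by
  have hα0 : α ≠ 0 := by rintro rfl; simp at hα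
  set ξ : Polynomial ℂ := Polynomial.X - Polynomial.C τ with hξ
  have hξτ : ξ.eval τ = 0 := by simp [hξ]
  -- The component of degree `j` carries the factor `ξ ^ (o * j)`. Components with `j < k` vanish,
  -- so the truncated `j - k` is never used for them; those with `j > k` die at `τ`.
  refine ⟨∑ j ∈ Finset.range (D + 1), α ^ (D - j) * (ξ ^ (o * (j - k)) *
    aeval η (homogeneousComponent j (taylorHom v P))), ?_, ?_⟩
  · have := aeval_smul_add hP v hα0 (fun i => ξ ^ o * η i)
    rw [show (algebraMap ℂ (Polynomial ℂ)) = Polynomial.C from rfl] at this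
    rw [this, Finset.mul_sum]
    refine Finset.sum_congr rfl fun j _ => ?_
    rcases lt_or_ge j k with hj | hj
    · rw [hk j hj]
      simp
    · rw [aeval_mul_of_isHomogeneous (homogeneousComponent_isHomogeneous j _), ← pow_mul]
      obtain ⟨t, rfl⟩ := Nat.exists_eq_add_of_le hj
      rw [Nat.add_sub_cancel_left, mul_add, pow_add]
      ring
  · rw [Polynomial.eval_finsetSum]
    by_cases hkD : k ≤ D
    · rw [Finset.sum_eq_single k]
      · simp [eval_aeval]
      · intro j _ hj
        rcases lt_or_ge j k with hjk | hjk
        · rw [hk j hjk]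
          simp
        · have : o * (j - k) ≠ 0 := mul_ne_zero ho (by lia)
          simp [hξτ, this]
      · intro h
        simp at h
        lia
    · rw [homogeneousComponent_eq_zero k _ ((taylorHom_totalDegree_le hP).trans_lt (by lia)),
        map_zero, mul_zero]
      refine Finset.sum_eq_zero fun j hj => ?_
      rw [hk j (by simp at hj; lia)]
      simp

/-- The coefficient at `D * n` is the value of the form at the point `t = ∞` of the parametrized
curve. -/
lemma natDegree_aeval_le {P : PolyRing} {D n : ℕ} (hP : P.IsHomogeneous D)
    {y : Fin 3 → Polynomial ℂ} (hy : ∀ i, (y i).natDegree ≤ n) :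
    (aeval y P).natDegree ≤ D * n ∧
      (aeval y P).coeff (D * n) = MvPolynomial.eval (fun i => (y i).coeff n) P := by
  rw [aeval_def, eval₂_eq, MvPolynomial.eval_eq]
  have hterm : ∀ s ∈ P.support,
      (algebraMap ℂ (Polynomial ℂ) (coeff s P) * ∏ i ∈ s.support, y i ^ s i).natDegree ≤ D * n ∧
      (algebraMap ℂ (Polynomial ℂ) (coeff s P) * ∏ i ∈ s.support, y i ^ s i).coeff (D * n) =
        coeff s P * ∏ i ∈ s.support, (y i).coeff n ^ s i := by
    intro s hs
    have hd : D = ∑ i ∈ s.support, s i := hP.degree_eq_sum_deg_support hs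
    have hprod : ∀ t : Finset (Fin 3), (∏ i ∈ t, y i ^ s i).natDegree ≤ (∑ i ∈ t, s i) * n ∧
        (∏ i ∈ t, y i ^ s i).coeff ((∑ i ∈ t, s i) * n) = ∏ i ∈ t, (y i).coeff n ^ s i := by
      intro t
      induction t using Finset.induction_on with
      | empty => simp
      | insert a t ha ih =>
        rw [Finset.prod_insert ha, Finset.prod_insert ha, Finset.sum_insert ha, add_mul]
        have h1 : (y a ^ s a).natDegree ≤ s a * n :=
          Polynomial.natDegree_pow_le_of_le _ (hy a)
        refine ⟨Polynomial.natDegree_mul_le_of_le h1 ih.1, ?_⟩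
        rw [Polynomial.coeff_mul_add_eq_of_natDegree_le h1 ih.1, ih.2,
          Polynomial.coeff_pow_of_natDegree_le (hy a)]
    obtain ⟨h1, h2⟩ := hprod s.support
    rw [← hd] at h1 h2
    rw [show (algebraMap ℂ (Polynomial ℂ)) = Polynomial.C from rfl]
    exact ⟨(Polynomial.natDegree_C_mul_le _ _).trans h1, by rw [Polynomial.coeff_C_mul, h2]⟩
  refine ⟨Polynomial.natDegree_sum_le_of_forall_le _ _ fun s hs => (hterm s hs).1, ?_⟩
  rw [Polynomial.finsetSum_coeff]
  exact Finset.sum_congr rfl fun s hs => (hterm s hs).2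

/-- Dividing a vector of polynomials by its greatest common divisor. -/
lemma exists_primitive (g : Fin 3 → Polynomial ℂ) (hg : g ≠ 0) :
    ∃ (c : Polynomial ℂ) (γ w : Fin 3 → Polynomial ℂ), c ≠ 0 ∧ (∀ j, g j = c * γ j) ∧
      ∑ j, w j * γ j = 1 := by
  obtain ⟨c, hc⟩ := (IsPrincipalIdealRing.principal (Ideal.span (Set.range g))).principal
  have hdvd : ∀ j, ∃ γ, g j = c * γ := fun j => by
    have : g j ∈ Ideal.span (Set.range g) := Ideal.subset_span ⟨j, rfl⟩
    rw [hc] at this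
    exact Ideal.mem_span_singleton.1 this
  choose γ hγ using hdvd
  have hc0 : c ≠ 0 := by
    rintro rfl
    exact hg (funext fun j => by simp [hγ j])
  have hmem : c ∈ Ideal.span (Set.range g) := by
    rw [hc]
    exact Submodule.mem_span_singleton_self c
  obtain ⟨w, hw⟩ := (Ideal.mem_span_range_iff_exists_fun).1 hmem
  refine ⟨c, γ, w, hc0, hγ, ?_⟩
  apply mul_left_cancel₀ hc0
  rw [mul_one, Finset.mul_sum, ← hw]
  refine Finset.sum_congr rfl fun j _ => ?_
  rw [hw, hγ j]
  ring

lemma pow_dvd_of_forall_pow_dvd {h q : Polynomial ℂ} (hh : h ≠ 0) (n : ℕ)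
    (H : ∀ τ : ℂ, (Polynomial.X - Polynomial.C τ) ^ (n * h.rootMultiplicity τ) ∣ q) :
    h ^ n ∣ q := by
  classical
  by_cases hq : q = 0
  · simp [hq]
  rw [IsAlgClosed.dvd_iff_roots_le_roots (pow_ne_zero n hh) hq, Multiset.le_iff_count]
  intro τ
  rw [Polynomial.roots_pow, Multiset.count_nsmul, Polynomial.count_roots, Polynomial.count_roots]
  exact (Polynomial.le_rootMultiplicity_iff hq).2 (H τ)

end BlowUpPlane
end

/-! ### Germs of parametrized curves and sections of the line class -/

noncomputable section

namespace BlowUpPlane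

open MvPolynomial

/-- A curve through `v` that is not constant leaves `v` in a definite direction. -/
lemma exists_germ {γ : Fin 3 → Polynomial ℂ} {τ s : ℂ} {v u : Fin 3 → ℂ} (huv : u ⬝ᵥ v = 1)
    (hs : ∀ j, s * (γ j).eval τ = v j)
    (hne : ¬ ∃ α : Polynomial ℂ, γ = fun j => α * Polynomial.C (v j)) :
    ∃ (α : Polynomial ℂ) (o : ℕ) (η : Fin 3 → Polynomial ℂ), o ≠ 0 ∧ α.eval τ ≠ 0 ∧
      LinearIndependent ℂ ![v, fun j => (η j).eval τ] ∧
      γ = fun j => α * Polynomial.C (v j) + (Polynomial.X - Polynomial.C τ) ^ o * η j := by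
  -- Splitting off the component along `v` by the functional `u` leaves a remainder `δ` annihilated
  -- by `u`, which is what makes its direction independent of `v`.
  obtain ⟨α, hα⟩ : ∃ α : Polynomial ℂ, α = ∑ j, Polynomial.C (u j) * γ j := ⟨_, rfl⟩
  have huy : s * α.eval τ = 1 := by
    rw [← huv, hα, Polynomial.eval_finsetSum, dotProduct, Finset.mul_sum]
    refine Finset.sum_congr rfl fun j _ => ?_
    rw [Polynomial.eval_mul, Polynomial.eval_C, ← hs]
    ring
  have hατ0 : α.eval τ ≠ 0 := right_ne_zero_of_mul (huy.symm ▸ one_ne_zero)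
  obtain ⟨δ, hδ⟩ : ∃ δ : Fin 3 → Polynomial ℂ, ∀ j, γ j = α * Polynomial.C (v j) + δ j :=
    ⟨fun j => γ j - α * Polynomial.C (v j), fun j => by ring⟩
  have huδ : ∑ j, Polynomial.C (u j) * δ j = 0 := by
    have e1 : α = α * Polynomial.C (u ⬝ᵥ v) + ∑ j, Polynomial.C (u j) * δ j := by
      conv_lhs => rw [hα]
      rw [dotProduct, map_sum, Finset.mul_sum, ← Finset.sum_add_distrib]
      refine Finset.sum_congr rfl fun j _ => ?_
      rw [hδ, map_mul]
      ring
    rw [huv, Polynomial.C_1, mul_one] at e1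
    simpa using e1
  have hδ0 : δ ≠ 0 := by
    rintro rfl
    exact hne ⟨α, funext fun j => by simpa using hδ j⟩
  -- The order of contact `o` is the order at `τ` of the common divisor of `δ`; the rest of that
  -- divisor is a unit at `τ` and is absorbed into `η`.
  obtain ⟨g, η', w', hg0, hgη, hw'⟩ := exists_primitive δ hδ0
  obtain ⟨g', hg', hgτ⟩ := Polynomial.exists_eq_pow_rootMultiplicity_mul_and_not_dvd g hg0 τ
  rw [Polynomial.dvd_iff_isRoot, Polynomial.IsRoot.def] at hgτ
  generalize g.rootMultiplicity τ = o at hg'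
  obtain ⟨η, hη⟩ : ∃ η : Fin 3 → Polynomial ℂ, ∀ j, η j = g' * η' j := ⟨_, fun j => rfl⟩
  obtain ⟨ω, hω⟩ : ∃ ω : Fin 3 → ℂ, ω = fun j => (η j).eval τ := ⟨_, rfl⟩
  have hω0 : ω ≠ 0 := by
    intro h0
    have h1 := congrArg (Polynomial.eval τ) hw'
    have h2 : ∀ j, (η' j).eval τ = 0 := fun j => by
      have := congrFun h0 j
      rw [hω] at this
      simpa [hη, hgτ] using this
    simp [Polynomial.eval_finsetSum, h2] at h1
  have hδη : ∀ j, δ j = (Polynomial.X - Polynomial.C τ) ^ o * η j := fun j => by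
    rw [hgη j, hη, hg']
    ring
  have ho0 : o ≠ 0 := by
    intro h0
    apply hω0
    funext j
    have h1 : (δ j).eval τ = ω j := by rw [hδη, h0, pow_zero, one_mul, hω]
    have h2 := congrArg (Polynomial.eval τ) (hδ j)
    simp only [Polynomial.eval_add, Polynomial.eval_mul, Polynomial.eval_C, ← hs j] at h2
    rw [← h1, Pi.zero_apply]
    linear_combination -h2 - ((γ j).eval τ) * huy
  have huω : u ⬝ᵥ ω = 0 := by
    have h1 : (Polynomial.X - Polynomial.C τ) ^ o * ∑ j, Polynomial.C (u j) * η j = 0 := by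
      rw [Finset.mul_sum, ← huδ]
      refine Finset.sum_congr rfl fun j _ => ?_
      rw [hδη]
      ring
    have h2 := (mul_eq_zero.1 h1).resolve_left (pow_ne_zero _ (Polynomial.X_sub_C_ne_zero τ))
    have h3 := congrArg (Polynomial.eval τ) h2
    simpa [Polynomial.eval_finsetSum, dotProduct, hω] using h3
  refine ⟨α, o, η, ho0, hατ0, ?_, funext fun j => by rw [hδ, hδη]⟩
  rw [← hω, LinearIndependent.pair_iff]
  intro p q hpq
  have h1 := congrArg (fun z => u ⬝ᵥ z) hpq
  simp only [dotProduct_add, dotProduct_smul, huv, huω, dotProduct_zero, smul_eq_mul, mul_one,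
    mul_zero, add_zero] at h1
  rw [h1, zero_smul, zero_add, smul_eq_zero] at hpq
  exact ⟨h1, hpq.resolve_right hω0⟩

lemma finrank_map_mulLeft {A : Type*} [CommRing A] [IsDomain A] [Algebra ℂ A] {a : A} (ha : a ≠ 0)
    (V : Submodule ℂ A) :
    Module.finrank ℂ (V.map (LinearMap.mulLeft ℂ a)) = Module.finrank ℂ V :=
  (Submodule.equivMapOfInjective _ (fun _ _ h => mul_left_cancel₀ ha h) V).finrank_eq.symm

namespace IsReduction

variable {r : ℕ} {x : Fin r → Plane} {d : ℕ} {m : Fin r → ℕ} {F : Fin 3 → PolyRing}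

lemma aeval_linForm_isHomogeneous (hF : IsReduction x d m F) (c : Fin 3 → ℂ) :
    (aeval F (linForm c)).IsHomogeneous d := by
  simpa using (linForm_isHomogeneous c).aeval F (fun j => hF.homogeneous j)

lemma aeval_linForm_vanishesToOrder (hF : IsReduction x d m F) (c : Fin 3 → ℂ) (i : Fin r) :
    VanishesToOrder (x i) (m i) (aeval F (linForm c)) := by
  rw [aeval_linForm, vanishesToOrder_iff, map_sum]
  refine LowVan.sum _ fun j _ => ?_
  rw [map_smul]
  exact LowVan.smul (hF.vanishing i j) _

end IsReduction

/-! ### The pull-back of a general line under a reduction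

The pull-back of a general line under a birational morphism `X → ℙ²` is parametrized by the
inverse map. Restricting linear systems to it computes the self-intersection and the genus of
the line class. -/

/-- A parametrization `γ` of the pull-back of the line `c = 0`, itself parametrized by `a + t b`. -/
structure LineParametrization {r : ℕ} (x : Fin r → Plane) (d : ℕ) (m : Fin r → ℕ)
    (F : Fin 3 → PolyRing) where
  c : Fin 3 → ℂ
  a : Fin 3 → ℂ
  b : Fin 3 → ℂ
  u : Fin 3 → ℂ
  v : Fin 3 → ℂ
  γ : Fin 3 → Polynomial ℂ
  w : Fin 3 → Polynomial ℂ
  h : Polynomial ℂ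
  e : ℕ
  j₀ : Fin 3
  c_a : c ⬝ᵥ a = 0
  c_b : c ⬝ᵥ b = 0
  u_a : u ⬝ᵥ a = 1
  u_b : u ⬝ᵥ b = 0
  v_a : v ⬝ᵥ a = 0
  v_b : v ⬝ᵥ b = 1
  primitive : ∑ j, w j * γ j = 1
  natDegree_le : ∀ j, (γ j).natDegree ≤ e
  natDegree_eq : (γ j₀).natDegree = e
  aeval_form : ∀ j, aeval γ (F j) =
    h * (Polynomial.C (a j) + Polynomial.C (b j) * Polynomial.X)
  h_ne_zero : h ≠ 0
  natDegree_h : h.natDegree + 1 = d * e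
  form_ne_zero : aeval F (linForm c) ≠ 0
  order_eq : ∀ i, homogeneousComponent (m i)
    (taylorHom (x i).rep (aeval F (linForm c))) ≠ 0
  dvd_of_aeval_eq_zero : ∀ D (B : PolyRing), B.IsHomogeneous D → aeval γ B = 0 →
    aeval F (linForm c) ∣ B

namespace LineParametrization

variable {r : ℕ} {x : Fin r → Plane} {d : ℕ} {m : Fin r → ℕ} {F : Fin 3 → PolyRing}

lemma aeval_linForm_form (P : LineParametrization x d m F) (c : Fin 3 → ℂ) :
    aeval P.γ (aeval F (linForm c)) =
      P.h * (Polynomial.C (c ⬝ᵥ P.a) + Polynomial.C (c ⬝ᵥ P.b) * Polynomial.X) := by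
  rw [BlowUpPlane.aeval_linForm, map_sum]
  simp only [map_smul, P.aeval_form, Polynomial.smul_eq_C_mul, dotProduct, map_sum, map_mul,
    Finset.sum_mul, ← Finset.sum_add_distrib, Finset.mul_sum]
  refine Finset.sum_congr rfl fun j _ => ?_
  ring

lemma eval_ne_zero (P : LineParametrization x d m F) (τ : ℂ) :
    (fun j => (P.γ j).eval τ) ≠ 0 := by
  intro h0
  have h1 := congrArg (Polynomial.eval τ) P.primitive
  have h2 : ∀ j, (P.γ j).eval τ = 0 := fun j => congrFun h0 j
  simp [Polynomial.eval_finsetSum, h2] at h1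

/-- If `γ` stayed at one point of the plane, so would its image under `F`. But the functionals `u`
and `v` take the values `h` and `h * X` on that image, whose ratio is not constant. -/
lemma not_constant (P : LineParametrization x d m F) (hF : IsReduction x d m F) (v : Fin 3 → ℂ) :
    ¬ ∃ α : Polynomial ℂ, P.γ = fun j => α * Polynomial.C (v j) := by
  rintro ⟨α, hγ⟩
  have hC : ∀ c : Fin 3 → ℂ, aeval P.γ (aeval F (linForm c)) =
      α ^ d * Polynomial.C (MvPolynomial.eval v (aeval F (linForm c))) := by
    intro c
    rw [hγ, aeval_mul_of_isHomogeneous (hF.aeval_linForm_isHomogeneous c)]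
    congr 1
    have := MvPolynomial.aeval_algebraMap_apply (Polynomial ℂ) v (aeval F (linForm c))
    rw [aeval_eq_eval] at this
    exact this
  have hz₁ := hC P.u
  have hz₂ := hC P.v
  rw [aeval_linForm_form, P.u_a, P.u_b] at hz₁
  rw [aeval_linForm_form, P.v_a, P.v_b] at hz₂
  simp only [Polynomial.C_1, Polynomial.C_0, zero_mul, add_zero, zero_add, one_mul, mul_one]
    at hz₁ hz₂
  have hα0 : α ^ d ≠ 0 := by
    intro h
    rw [h, zero_mul] at hz₁
    exact P.h_ne_zero hz₁
  rw [hz₁, mul_assoc] at hz₂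
  have h3 := congrArg (Polynomial.coeff · 1) (mul_left_cancel₀ hα0 hz₂)
  simp only [Polynomial.coeff_C_mul, Polynomial.coeff_X_one, mul_one,
    Polynomial.coeff_C_of_ne_zero one_ne_zero] at h3
  apply P.h_ne_zero
  rw [hz₁, h3, Polynomial.C_0, mul_zero]

/-- The forms in the `n`-th power of the line bundle vanish along `h ^ n` on the line. -/
lemma pow_dvd_aeval (P : LineParametrization x d m F) (hF : IsReduction x d m F) {D n : ℕ}
    {B : PolyRing} (hB : B.IsHomogeneous D) (hv : ∀ i, VanishesToOrder (x i) (n * m i) B) :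
    P.h ^ n ∣ aeval P.γ B := by
  refine pow_dvd_of_forall_pow_dvd P.h_ne_zero n fun τ => ?_
  by_cases hτ : P.h.eval τ = 0
  swap
  · rw [Polynomial.rootMultiplicity_eq_zero hτ, mul_zero, pow_zero]
    exact one_dvd _
  have hy0 := P.eval_ne_zero τ
  have hFy : ∀ j, MvPolynomial.eval (fun j => (P.γ j).eval τ) (F j) = 0 := fun j => by
    rw [← eval_aeval, P.aeval_form, Polynomial.eval_mul, hτ, zero_mul]
  -- At a root of `h` all `F j` vanish on `γ τ`, so this point is one of the blown-up points.
  obtain ⟨i, hi⟩ : ∃ i, Projectivization.mk ℂ _ hy0 = x i := by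
    by_contra! hne
    obtain ⟨j, hj⟩ := hF.noBasePoint _ hne
    exact hj ((eval_rep_mk_eq_zero_iff (hF.homogeneous j) hy0).2 (hFy j))
  obtain ⟨s, hs⟩ := Projectivization.exists_smul_eq_mk_rep ℂ _ hy0
  rw [hi, Units.smul_def] at hs
  obtain ⟨u, hu⟩ := exists_linForm_ne_zero (x i)
  have huv : ((u ⬝ᵥ (x i).rep)⁻¹ • u) ⬝ᵥ (x i).rep = 1 := by
    rw [smul_dotProduct, smul_eq_mul, inv_mul_cancel₀ hu]
  obtain ⟨α, o, η, ho0, hατ0, hli, hγη⟩ :=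
    exists_germ huv (fun j => congrFun hs j) (P.not_constant hF _)
  obtain ⟨j, hj⟩ := hF.noBaseDirection i _ hli
  obtain ⟨R, hR, hRτ⟩ := exists_aeval_eq_pow_mul (hF.homogeneous j) (hF.vanishing i j) ho0 hατ0 η
  obtain ⟨R', hR', -⟩ := exists_aeval_eq_pow_mul hB (hv i) ho0 hατ0 η
  rw [← hγη] at hR hR'
  have hRτ0 : R.eval τ ≠ 0 := by
    rw [hRτ]
    exact mul_ne_zero (pow_ne_zero _ hατ0) hj
  -- Absence of base directions gives an `F j` whose pull-back has order exactly `o * m i` at `τ`.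
  -- Since `h` divides that pull-back, its order is no larger.
  have hle : P.h.rootMultiplicity τ ≤ o * m i := by
    by_contra! hlt
    have h1 : (Polynomial.X - Polynomial.C τ) ^ (o * m i + 1) ∣
        (Polynomial.X - Polynomial.C τ) ^ (o * m i) * R := by
      rw [← hR, P.aeval_form]
      exact ((pow_dvd_pow _ hlt).trans (Polynomial.pow_rootMultiplicity_dvd _ _)).mul_right _
    rw [pow_succ, mul_dvd_mul_iff_left (pow_ne_zero _ (Polynomial.X_sub_C_ne_zero τ)),
      Polynomial.dvd_iff_isRoot] at h1
    exact hRτ0 h1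
  rw [hR']
  refine Dvd.dvd.mul_right (pow_dvd_pow _ ?_) _
  calc n * P.h.rootMultiplicity τ ≤ n * (o * m i) := Nat.mul_le_mul_left _ hle
    _ = o * (n * m i) := by ring

/-- Every polynomial of degree at most `N e + n` is the restriction of a form. -/
lemma exists_aeval_eq (P : LineParametrization x d m F) (hF : IsReduction x d m F) {n : ℕ}
    (hn : P.e ≤ n + 1) (N : ℕ) (R : Polynomial ℂ) (hR : R.natDegree ≤ N * P.e + n) :
    ∃ B ∈ formsVanishing x (N + n * d) (fun i => n * m i), aeval P.γ B = P.h ^ n * R := by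
  have hlin := hF.aeval_linForm_isHomogeneous
  have hlinv := hF.aeval_linForm_vanishesToOrder
  induction N generalizing R with
  | zero =>
    rw [zero_mul, zero_add] at hR
    -- The linear functionals `u` and `v` pull back to `h` and `h * X`, so their degree `n`
    -- monomials yield `h ^ n * X ^ k` for `k ≤ n`.
    refine ⟨∑ k ∈ Finset.range (n + 1), R.coeff k •
      (aeval F (linForm P.u) ^ (n - k) * aeval F (linForm P.v) ^ k), ?_, ?_⟩
    · refine Submodule.sum_mem _ fun k hk => Submodule.smul_mem _ _ ⟨?_, fun i => ?_⟩
      · have := ((hlin P.u).pow (n - k)).mul ((hlin P.v).pow k)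
        have hk' : k ≤ n := by simpa [Nat.lt_succ_iff] using hk
        rwa [← mul_add, Nat.sub_add_cancel hk', mul_comm d n, ← zero_add (n * d)] at this
      · have := ((hlinv P.u i).pow (n - k)).mul ((hlinv P.v i).pow k)
        have hk' : k ≤ n := by simpa [Nat.lt_succ_iff] using hk
        rwa [← add_mul, Nat.sub_add_cancel hk'] at this
    · rw [map_sum]
      conv_rhs => rw [R.as_sum_range_C_mul_X_pow' (Nat.lt_succ_of_le hR), Finset.mul_sum]
      refine Finset.sum_congr rfl fun k hk => ?_
      have hk' : k ≤ n := by simpa [Nat.lt_succ_iff] using hk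
      rw [map_smul, map_mul, map_pow, map_pow, P.aeval_linForm_form, P.aeval_linForm_form, P.u_a,
        P.u_b, P.v_a, P.v_b, Polynomial.smul_eq_C_mul]
      simp only [Polynomial.C_1, Polynomial.C_0, zero_mul, add_zero, zero_add, one_mul, mul_one]
      rw [mul_pow, ← mul_assoc (P.h ^ (n - k)), ← pow_add, Nat.sub_add_cancel hk']
      ring
  | succ N ih =>
    set p := P.γ P.j₀ with hp
    have hp0 : p ≠ 0 := by
      intro h0
      have he : P.e = 0 := by rw [← P.natDegree_eq, ← hp, h0, Polynomial.natDegree_zero]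
      have := P.natDegree_h
      rw [he, mul_zero] at this
      lia
    -- From `∑ w j * γ j = 1` one gets `R = ∑ R * w j * γ j`. Reducing the coefficients modulo `p`
    -- writes `R` as `∑ ω j * γ j + p * U` with `ω j` and `U` in the range of the induction
    -- hypothesis.
    set ω : Fin 3 → Polynomial ℂ := fun j => (R * P.w j) % p with hω
    have hωdeg : ∀ j, (ω j).natDegree ≤ P.e - 1 := fun j => by
      by_cases he : P.e = 0
      · have := P.natDegree_h
        rw [he, mul_zero] at this
        lia
      · have h1 : p.natDegree ≠ 0 := by rw [hp, P.natDegree_eq]; exact he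
        have := Polynomial.natDegree_mod_lt (R * P.w j) h1
        rw [hp, P.natDegree_eq] at this
        exact Nat.le_sub_one_of_lt this
    obtain ⟨U, hU⟩ : p ∣ R - ∑ j, ω j * P.γ j := by
      have : R - ∑ j, ω j * P.γ j = ∑ j, (R * P.w j - ω j) * P.γ j := by
        simp only [sub_mul, Finset.sum_sub_distrib, mul_assoc, ← Finset.mul_sum, P.primitive,
          mul_one]
      rw [this]
      refine Finset.dvd_sum fun j _ => Dvd.dvd.mul_right ⟨R * P.w j / p, ?_⟩ _
      simp only [hω]
      linear_combination -(EuclideanDomain.div_add_mod (R * P.w j) p)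
    have hUdeg : U.natDegree ≤ N * P.e + n := by
      by_cases hU0 : U = 0
      · simp [hU0]
      have h1 : (R - ∑ j, ω j * P.γ j).natDegree ≤ (N + 1) * P.e + n := by
        refine (Polynomial.natDegree_sub_le_of_le hR
          (Polynomial.natDegree_sum_le_of_forall_le _ _ fun j _ => ?_)).trans (max_self _).le
        refine (Polynomial.natDegree_mul_le_of_le (hωdeg j) (P.natDegree_le j)).trans ?_
        rw [add_mul, one_mul]
        have : P.e - 1 ≤ n := by lia
        nlinarith [Nat.zero_le (N * P.e)]
      rw [hU, Polynomial.natDegree_mul hp0 hU0, hp, P.natDegree_eq, add_mul, one_mul] at h1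
      lia
    obtain ⟨BU, hBU, hBU'⟩ := ih U hUdeg
    have hex : ∀ j, ∃ B ∈ formsVanishing x (N + n * d) (fun i => n * m i),
        aeval P.γ B = P.h ^ n * ω j := fun j => ih (ω j) ((hωdeg j).trans (by lia))
    choose B hB hB' using hex
    have hX : ∀ (j : Fin 3) {A : PolyRing}, A ∈ formsVanishing x (N + n * d) (fun i => n * m i) →
        X j * A ∈ formsVanishing x (N + 1 + n * d) (fun i => n * m i) := fun j A hA => by
      refine ⟨?_, fun i => ?_⟩
      · have := (isHomogeneous_X ℂ j).mul hA.1
        rwa [show 1 + (N + n * d) = N + 1 + n * d by ring] at this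
      · simpa using (vanishesToOrder_order_zero (x i) (X j)).mul (hA.2 i)
    refine ⟨X P.j₀ * BU + ∑ j, X j * B j,
      Submodule.add_mem _ (hX _ hBU) (Submodule.sum_mem _ fun j _ => hX j (hB j)), ?_⟩
    rw [map_add, map_mul, map_sum, aeval_X, hBU', ← hp]
    have : ∑ j, aeval P.γ (X j * B j) = P.h ^ n * ∑ j, ω j * P.γ j := by
      rw [Finset.mul_sum]
      refine Finset.sum_congr rfl fun j _ => ?_
      rw [map_mul, aeval_X, hB']
      ring
    rw [this]
    linear_combination (-(P.h ^ n)) * hU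

/-- The dimension of a linear system restricted to the pull-back of a line. -/
lemma finrank_formsVanishing_succ (P : LineParametrization x d m F) (hF : IsReduction x d m F)
    {n : ℕ} (hn : P.e ≤ n + 2) (N : ℕ) :
    Module.finrank ℂ (formsVanishing x (N + (n + 1) * d) (fun i => (n + 1) * m i)) =
      Module.finrank ℂ (formsVanishing x (N + n * d) (fun i => n * m i)) +
        (N * P.e + n + 2) := by
  have hAh := hF.aeval_linForm_isHomogeneous P.c
  have hAv := hF.aeval_linForm_vanishesToOrder P.c
  have hA0 := P.form_ne_zero
  let Θ : formsVanishing x (N + (n + 1) * d) (fun i => (n + 1) * m i) →ₗ[ℂ] Polynomial ℂ :=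
    (aeval P.γ).toLinearMap.comp (Submodule.subtype _)
  have hΘ : ∀ B, Θ B = aeval P.γ B.1 := fun B => rfl
  -- Exactness on the left: forms vanishing on the parametrized curve are multiples of its equation,
  -- which has multiplicity exactly `m i` at `x i`.
  have hker : (LinearMap.ker Θ).map (Submodule.subtype _) =
      (formsVanishing x (N + n * d) (fun i => n * m i)).map
        (LinearMap.mulLeft ℂ (aeval F (linForm P.c))) := by
    ext B
    constructor
    · rintro ⟨B, hB, rfl⟩
      obtain ⟨Z, hZ⟩ := P.dvd_of_aeval_eq_zero _ B.1 B.2.1 hB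
      refine ⟨Z, ⟨?_, fun i => ?_⟩, hZ.symm⟩
      · refine isHomogeneous_of_mul_right (d := d) ?_ hAh hA0
        rw [← hZ, show d + (N + n * d) = N + (n + 1) * d by ring]
        exact B.2.1
      · refine LowVan.of_mul (hAv i) (P.order_eq i) ?_
        have := B.2.2 i
        rw [hZ, vanishesToOrder_iff, map_mul] at this
        exact this.mono (by simp only []; lia)
    · rintro ⟨Z, hZ, rfl⟩
      refine ⟨⟨aeval F (linForm P.c) * Z, ?_, fun i => ?_⟩, ?_, rfl⟩
      · have := hAh.mul hZ.1
        rwa [show d + (N + n * d) = N + (n + 1) * d by ring] at this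
      · have := (hAv i).mul (hZ.2 i)
        rwa [show m i + n * m i = (n + 1) * m i by ring] at this
      · change Θ _ = 0
        rw [hΘ, map_mul, P.aeval_linForm_form, P.c_a, P.c_b]
        simp
  -- Restrictions are `h ^ (n + 1)` times arbitrary polynomials of degree at most `N e + n + 1`; the
  -- bound comes from `deg h + 1 = d e`.
  have hrange : LinearMap.range Θ = (Polynomial.degreeLT ℂ (N * P.e + n + 2)).map
      (LinearMap.mulLeft ℂ (P.h ^ (n + 1))) := by
    ext q
    constructor
    · rintro ⟨B, rfl⟩
      obtain ⟨R, hR⟩ := P.pow_dvd_aeval hF B.2.1 B.2.2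
      refine ⟨R, ?_, hR.symm⟩
      rw [SetLike.mem_coe, Polynomial.mem_degreeLT]
      by_cases hR0 : R = 0
      · rw [hR0, Polynomial.degree_zero]
        exact WithBot.bot_lt_coe _
      rw [← Polynomial.natDegree_lt_iff_degree_lt hR0]
      have h1 := (natDegree_aeval_le B.2.1 P.natDegree_le).1
      rw [hR, Polynomial.natDegree_mul (pow_ne_zero _ P.h_ne_zero) hR0,
        Polynomial.natDegree_pow] at h1
      have h2 : (N + (n + 1) * d) * P.e = N * P.e + (n + 1) * (P.h.natDegree + 1) := by
        rw [P.natDegree_h]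
        ring
      rw [h2, mul_add] at h1
      lia
    · rintro ⟨R, hR, rfl⟩
      rw [SetLike.mem_coe, Polynomial.mem_degreeLT] at hR
      have hR' : R.natDegree ≤ N * P.e + (n + 1) := by
        by_cases hR0 : R = 0
        · simp [hR0]
        rw [← Polynomial.natDegree_lt_iff_degree_lt hR0] at hR
        lia
      obtain ⟨B, hB, hB'⟩ := P.exists_aeval_eq hF hn N R hR'
      exact ⟨⟨B, hB⟩, hB'⟩
  have h1 := LinearMap.finrank_range_add_finrank_ker Θ
  have h2 := Submodule.finrank_map_subtype_eq _ (LinearMap.ker Θ)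
  rw [hker, finrank_map_mulLeft hA0] at h2
  rw [hrange, finrank_map_mulLeft (pow_ne_zero _ P.h_ne_zero),
    (Polynomial.degreeLTEquiv ℂ _).finrank_eq, Module.finrank_fin_fun] at h1
  lia

/-- The line class of a reduction has self-intersection `1` and degree `-3` on the canonical
class. -/
lemma numerics (P : LineParametrization x d m F) (hF : IsReduction x d m F)
    (hx : Function.Injective x) :
    (d : ℤ) ^ 2 - ∑ i, (m i : ℤ) ^ 2 = 1 ∧ 3 * (d : ℤ) - ∑ i, (m i : ℤ) = 3 := by
  -- For large `N` both linear systems have their expected dimension, so the restriction sequence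
  -- becomes a polynomial identity in `n` and `N`.
  have key : ∀ n N : ℕ, P.e ≤ n → (n + 1) * ∑ i, m i ≤ N →
      2 * (N : ℤ) * d + (2 * n + 1) * (d ^ 2 - ∑ i, (m i : ℤ) ^ 2) + 3 * d - ∑ i, (m i : ℤ) =
        2 * N * P.e + 2 * n + 4 := by
    intro n N hn hN
    have h0 := P.finrank_formsVanishing_succ hF (n := n) (by lia) N
    have h1 := finrank_formsVanishing hx (D := N + (n + 1) * d) (k := fun i => (n + 1) * m i)
      (by rw [← Finset.mul_sum]; lia)
    have h2 := finrank_formsVanishing hx (D := N + n * d) (k := fun i => n * m i)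
      (by rw [← Finset.mul_sum]; nlinarith [Nat.zero_le (∑ i, m i), Nat.zero_le (n * d)])
    have e1 := two_mul_choose_two (N + (n + 1) * d + 1)
    have e2 := two_mul_choose_two (N + n * d + 1)
    have e3 : 2 * ∑ i, (((n + 1) * m i + 1).choose 2 : ℤ) =
        2 * ∑ i, ((n * m i + 1).choose 2 : ℤ) + (2 * n + 1) * ∑ i, (m i : ℤ) ^ 2 +
          ∑ i, (m i : ℤ) := by
      simp only [Finset.mul_sum, ← Finset.sum_add_distrib, two_mul_choose_two]
      refine Finset.sum_congr rfl fun i _ => ?_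
      push_cast
      ring
    zify at h0 h1 h2
    push_cast at e1 e2
    linarith
  -- The difference in `N` gives `d = e`, the difference in `n` gives self-intersection `1`, and
  -- what remains is the canonical degree.
  have k1 := key P.e ((P.e + 2) * ∑ i, m i) le_rfl (by nlinarith [Nat.zero_le (∑ i, m i)])
  have k2 := key P.e ((P.e + 2) * ∑ i, m i + 1) le_rfl (by nlinarith [Nat.zero_le (∑ i, m i)])
  have k3 := key (P.e + 1) ((P.e + 2) * ∑ i, m i) (by lia) (by nlinarith [Nat.zero_le (∑ i, m i)])
  push_cast at k1 k2 k3
  have hde : (d : ℤ) = P.e := by linarith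
  rw [← hde] at k1 k3
  have hL : (d : ℤ) ^ 2 - ∑ i, (m i : ℤ) ^ 2 = 1 := by linarith
  rw [hL] at k1
  exact ⟨hL, by linarith⟩

end LineParametrization

end BlowUpPlane
end

/-! ### Parametrizing the pull-back of a general line -/

noncomputable section

namespace BlowUpPlane

open MvPolynomial

/-- General position: a vector space over an infinite field is not a finite union of proper
subspaces. -/
lemma exists_forall_notMem {E ι : Type*} [AddCommGroup E] [Module ℂ E] [Finite ι]
    (p : ι → Submodule ℂ E) (hp : ∀ i, p i ≠ ⊤) : ∃ c, ∀ i, c ∉ p i := by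
  by_contra! h
  obtain ⟨i, hi⟩ := Subspace.exists_eq_top_of_iUnion_eq_univ (p := p)
    (Set.eq_univ_of_forall fun c => Set.mem_iUnion.2 (h c))
  exact hp i hi

lemma linForm_ne_zero {c : Fin 3 → ℂ} (hc : c ≠ 0) : linForm c ≠ 0 := by
  obtain ⟨i, hi⟩ := Function.ne_iff.1 hc
  intro h
  have := congrArg (eval (Pi.single i 1)) h
  rw [eval_linForm] at this
  simp at this
  exact hi this

lemma irreducible_linForm {c : Fin 3 → ℂ} (hc : c ≠ 0) : Irreducible (linForm c) := by
  have h0 := linForm_ne_zero hc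
  refine irreducible_of_totalDegree_eq_one ((linForm_isHomogeneous c).totalDegree h0) ?_
  intro z hz
  rw [isUnit_iff_ne_zero]
  rintro rfl
  apply h0
  ext s
  simpa using hz s

lemma linForm_add (c c' : Fin 3 → ℂ) : linForm (c + c') = linForm c + linForm c' := by
  simp [linForm, add_mul, Finset.sum_add_distrib]

lemma linForm_smul (z : ℂ) (c : Fin 3 → ℂ) : linForm (z • c) = z • linForm c := by
  simp [linForm, Finset.smul_sum, smul_eq_C_mul, mul_assoc]

lemma linForm_single (j : Fin 3) : linForm (Pi.single j 1) = X j := by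
  rw [linForm, Finset.sum_eq_single j]
  · simp
  · intro i _ hi
    simp [hi]
  · simp

/-- A plane through the origin with a basis that starts with a given vector, and dual forms. -/
lemma exists_plane_basis {c b : Fin 3 → ℂ} (hc : c ≠ 0) (hb : b ≠ 0) (hcb : c ⬝ᵥ b = 0) :
    ∃ a u v : Fin 3 → ℂ, c ⬝ᵥ a = 0 ∧ u ⬝ᵥ a = 1 ∧ u ⬝ᵥ b = 0 ∧ v ⬝ᵥ a = 0 ∧ v ⬝ᵥ b = 1 ∧
      ∀ y, c ⬝ᵥ y = 0 → ∃ s t : ℂ, y = s • a + t • b := by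
  let φ : (Fin 3 → ℂ) →ₗ[ℂ] ℂ :=
    { toFun := fun y => c ⬝ᵥ y
      map_add' := fun y z => dotProduct_add _ _ _
      map_smul' := fun z y => by simp [dotProduct_smul] }
  have hφ : ∀ y, φ y = c ⬝ᵥ y := fun y => rfl
  have hφ0 : LinearMap.range φ = ⊤ := by
    rw [LinearMap.range_eq_top]
    obtain ⟨i, hi⟩ := Function.ne_iff.1 hc
    intro z
    refine ⟨Pi.single i (z / c i), ?_⟩
    rw [hφ, dotProduct_single]
    exact mul_div_cancel₀ z hi
  have hfr := LinearMap.finrank_range_add_finrank_ker φ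
  rw [hφ0, finrank_top, Module.finrank_self, Module.finrank_fin_fun] at hfr
  have hb' : (⟨b, hcb⟩ : LinearMap.ker φ) ≠ 0 := fun h => hb (congrArg Subtype.val h)
  obtain ⟨a, ha⟩ : ∃ a : LinearMap.ker φ, a ∉ Submodule.span ℂ {(⟨b, hcb⟩ : LinearMap.ker φ)} := by
    by_contra! h
    have h1 : Submodule.span ℂ {(⟨b, hcb⟩ : LinearMap.ker φ)} = ⊤ := eq_top_iff.2 fun y _ => h y
    have h2 := finrank_span_singleton (K := ℂ) hb'
    rw [h1, finrank_top] at h2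
    lia
  have hli : LinearIndependent ℂ ![b, a.1] := by
    rw [LinearIndependent.pair_iff' hb]
    intro z hz
    exact ha (Submodule.mem_span_singleton.2 ⟨z, Subtype.ext hz⟩)
  obtain ⟨u, hub, hua⟩ := exists_dotProduct_separating hli
  obtain ⟨v, hva, hvb⟩ := exists_dotProduct_separating (LinearIndependent.pair_symm_iff.1 hli)
  refine ⟨a.1, (u ⬝ᵥ a.1)⁻¹ • u, (v ⬝ᵥ b)⁻¹ • v, a.2, ?_, ?_, ?_, ?_, ?_⟩
  · rw [smul_dotProduct, smul_eq_mul, inv_mul_cancel₀ hua]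
  · rw [smul_dotProduct, hub, smul_zero]
  · rw [smul_dotProduct, hva, smul_zero]
  · rw [smul_dotProduct, smul_eq_mul, inv_mul_cancel₀ hvb]
  · intro y hy
    have hli' : LinearIndependent ℂ ![(⟨b, hcb⟩ : LinearMap.ker φ), a] := by
      rw [LinearIndependent.pair_iff' hb']
      intro z hz
      exact ha (Submodule.mem_span_singleton.2 ⟨z, hz⟩)
    have htop := hli'.span_eq_top_of_card_eq_finrank' (by simp; lia)
    have hmem : (⟨y, hy⟩ : LinearMap.ker φ) ∈ Submodule.span ℂ
        (Set.range ![(⟨b, hcb⟩ : LinearMap.ker φ), a]) := htop ▸ Submodule.mem_top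
    rw [Matrix.range_cons_cons_empty, Submodule.mem_span_pair] at hmem
    obtain ⟨t, s, hts⟩ := hmem
    refine ⟨s, t, ?_⟩
    have := congrArg Subtype.val hts
    rw [add_comm]
    exact this.symm

/-- A form that vanishes along a line is divisible by the equation of the line. -/
lemma linForm_dvd_of_aeval_eq_zero {c a b u : Fin 3 → ℂ} (hc : c ≠ 0) (hca : c ⬝ᵥ a = 0)
    (hua : u ⬝ᵥ a = 1) (hub : u ⬝ᵥ b = 0)
    (hspan : ∀ y, c ⬝ᵥ y = 0 → ∃ s t : ℂ, y = s • a + t • b) {E : PolyRing} {D : ℕ}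
    (hE : E.IsHomogeneous D)
    (h0 : aeval (fun j => Polynomial.C (a j) + Polynomial.C (b j) * Polynomial.X) E = 0) :
    linForm c ∣ E := by
  have hprime := (irreducible_linForm hc).prime
  -- The affine parametrization misses only the multiples of `b` in the plane `c = 0`; the factor
  -- `linForm u` vanishes on these.
  have hv : E * linForm u ∈ vanishingIdeal ℂ (zeroLocus ℂ (Ideal.span {linForm c})) := by
    rw [mem_vanishingIdeal_iff]
    intro y hy
    have hcy : c ⬝ᵥ y = 0 := by
      rw [← eval_linForm]
      simpa using (mem_zeroLocus_iff.1 hy) _ (Ideal.mem_span_singleton_self (linForm c))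
    obtain ⟨s, t, hst⟩ := hspan y hcy
    rw [aeval_eq_eval]
    change eval y _ = 0
    rw [map_mul, eval_linForm]
    have huy : u ⬝ᵥ y = s := by
      rw [hst, dotProduct_add, dotProduct_smul, dotProduct_smul, hua, hub]
      simp
    rw [huy]
    by_cases hs : s = 0
    · rw [hs, mul_zero]
    · have h1 := congrArg (Polynomial.eval (t / s)) h0
      rw [eval_aeval, Polynomial.eval_zero] at h1
      have h2 : y = s • fun j => (Polynomial.C (a j) + Polynomial.C (b j) * Polynomial.X).eval
          (t / s) := by
        rw [hst]
        funext j
        simp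
        field_simp
      rw [h2, eval_smul_of_isHomogeneous hE, h1]
      simp
  have : (Ideal.span {linForm c}).IsPrime :=
    (Ideal.span_singleton_prime (linForm_ne_zero hc)).2 hprime
  rw [IsPrime.vanishingIdeal_zeroLocus, Ideal.mem_span_singleton] at hv
  refine (hprime.dvd_or_dvd hv).resolve_right ?_
  rintro ⟨Z, hZ⟩
  have := congrArg (eval a) hZ
  rw [map_mul, eval_linForm, eval_linForm, hua, hca, zero_mul] at this
  exact one_ne_zero this

lemma aeval_aeval_form {A : Type*} [CommRing A] [Algebra ℂ A] (y : Fin 3 → A)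
    (G : Fin 3 → PolyRing) (P : PolyRing) :
    aeval y (aeval G P) = aeval (fun j => aeval y (G j)) P := by
  have : (aeval y).comp (aeval G) = aeval (fun j => aeval y (G j)) := by
    ext j
    simp
  exact DFunLike.congr_fun this P

lemma eval_aeval_form (y : Fin 3 → ℂ) (G : Fin 3 → PolyRing) (P : PolyRing) :
    eval y (aeval G P) = eval (fun j => eval y (G j)) P := by
  simpa [aeval_eq_eval] using aeval_aeval_form y G P

lemma dvd_of_dvd_pow_mul {A H B : PolyRing} (h : IsRelPrime A H) {D : ℕ} (hd : A ∣ H ^ D * B) :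
    A ∣ B := by
  induction D with
  | zero => simpa using hd
  | succ D ih =>
    rw [pow_succ', mul_assoc] at hd
    exact ih (h.dvd_of_dvd_mul_left hd)

namespace IsReduction

variable {r : ℕ} {x : Fin r → Plane} {d : ℕ} {m : Fin r → ℕ} {F : Fin 3 → PolyRing}

/-- A curve is not contained in all members of the linear system of lines. -/
lemma exists_not_dvd (hF : IsReduction x d m F) {z : PolyRing} {k : ℕ} (hz : Irreducible z)
    (hzk : z.IsHomogeneous k) : ∃ j, ¬ z ∣ F j := by
  classical
  by_contra! h
  obtain ⟨p, hp, hpz, -⟩ := exists_point hz hzk (isHomogeneous_one (Fin 3) ℂ)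
    (fun h => hz.not_isUnit (isUnit_of_dvd_one h)) (Finset.univ.image x)
  obtain ⟨j, hj⟩ := hF.noBasePoint p fun i hi =>
    hp (hi ▸ Finset.mem_image_of_mem x (Finset.mem_univ i))
  obtain ⟨q, hq⟩ := h j
  exact hj (by rw [hq, map_mul, hpz, zero_mul])

/-- A general member of the linear system of lines. -/
lemma exists_general_line (hF : IsReduction x d m F) {H : PolyRing} {k : ℕ} (hH : H ≠ 0)
    (hHk : H.IsHomogeneous k) : ∃ c : Fin 3 → ℂ, IsRelPrime (aeval F (linForm c)) H ∧
      ∀ i, homogeneousComponent (m i) (taylorHom (x i).rep (aeval F (linForm c))) ≠ 0 := by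
  classical
  let S := (UniqueFactorizationMonoid.factors H).toFinset
  -- The lines to avoid: those whose pull-back contains a given factor of `H`, and those whose
  -- pull-back has excess multiplicity at a given `x i`.
  let p : S ⊕ Fin r → Submodule ℂ (Fin 3 → ℂ) := Sum.elim
    (fun z =>
      { carrier := {c | z.1 ∣ aeval F (linForm c)}
        add_mem' := fun ha hb => by
          simp only [Set.mem_ofPred_eq, linForm_add, map_add] at *
          exact dvd_add ha hb
        zero_mem' := by simp [linForm]
        smul_mem' := fun z c hc => by
          simp only [Set.mem_ofPred_eq, linForm_smul, map_smul] at *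
          rw [smul_eq_C_mul]
          exact hc.mul_left _ })
    (fun i =>
      { carrier := {c | homogeneousComponent (m i) (taylorHom (x i).rep (aeval F (linForm c))) = 0}
        add_mem' := fun ha hb => by
          simp only [Set.mem_ofPred_eq, linForm_add, map_add] at *
          rw [ha, hb, add_zero]
        zero_mem' := by simp [linForm]
        smul_mem' := fun z c hc => by
          simp only [Set.mem_ofPred_eq, linForm_smul, map_smul] at *
          rw [hc, smul_zero] })
  obtain ⟨c, hc⟩ := exists_forall_notMem p (by
    rintro (z | i) htop
    · have hz : z.1 ∈ UniqueFactorizationMonoid.factors H := Multiset.mem_toFinset.1 z.2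
      have hzi := UniqueFactorizationMonoid.irreducible_of_factor _ hz
      obtain ⟨q, hq⟩ := UniqueFactorizationMonoid.dvd_of_mem_factors hz
      obtain ⟨k', l, -, hk', -⟩ := isHomogeneous_of_mul (hq ▸ hHk) (hq ▸ hH)
      obtain ⟨j, hj⟩ := hF.exists_not_dvd hzi hk'
      have hmem : Pi.single j 1 ∈ p (Sum.inl z) := htop ▸ Submodule.mem_top
      have hmem' : z.1 ∣ aeval F (linForm (Pi.single j 1)) := hmem
      rw [linForm_single, aeval_X] at hmem'
      exact hj hmem'
    · obtain ⟨c₁, c₂, w₁, w₂, h₁, h₂, h₁₁, -⟩ := exists_linForm_pair (x i)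
      have hli : LinearIndependent ℂ ![(x i).rep, w₁] := by
        rw [LinearIndependent.pair_iff' (x i).rep_nonzero]
        rintro z rfl
        rw [dotProduct_smul, h₁, smul_zero] at h₁₁
        exact zero_ne_one h₁₁
      obtain ⟨j, hj⟩ := hF.noBaseDirection i w₁ hli
      have hmem : Pi.single j 1 ∈ p (Sum.inr i) := htop ▸ Submodule.mem_top
      have hmem' : homogeneousComponent (m i)
        (taylorHom (x i).rep (aeval F (linForm (Pi.single j 1)))) = 0 := hmem
      rw [linForm_single, aeval_X] at hmem'
      exact hj (by rw [taylorAt_eq, hmem', map_zero]))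
  refine ⟨c, ?_, fun i => hc (Sum.inr i)⟩
  refine WfDvdMonoid.isRelPrime_of_no_irreducible_factors (fun h => hH h.2) fun z hz hzA hzH => ?_
  obtain ⟨q, hq, hzq⟩ := UniqueFactorizationMonoid.exists_mem_factors_of_dvd hH hz hzH
  exact hc (Sum.inl ⟨q, by simpa [S] using hq⟩) (hzq.dvd_iff_dvd_left.1 hzA)

/-- Constant `F` would make `G ∘ F` constant, whereas it equals `H * X j`. -/
lemma degree_ne_zero (hF : IsReduction x d m F) : d ≠ 0 := by
  rintro rfl
  obtain ⟨e, G, H, H', hG, hH, -, hGF, -⟩ := hF.birational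
  have h1 : (aeval F (G 0)).IsHomogeneous (0 * e) := (hG 0).aeval F hF.homogeneous
  rw [hGF 0, zero_mul, ← totalDegree_zero_iff_isHomogeneous,
    totalDegree_mul_of_isDomain hH (X_ne_zero 0), totalDegree_X] at h1
  lia

/-- The proper transform of a curve meets the line class nonnegatively. -/
lemma sum_mul_multAt_le (hF : IsReduction x d m F) (hx : Function.Injective x) (D : PlaneCurve) :
    ∑ i, multAt (x i) D.form * m i ≤ D.degree * d := by
  obtain ⟨j, hj⟩ := hF.exists_not_dvd D.irreducible D.isHomogeneous
  exact sum_mul_le_mul_of_not_dvd hx D.irreducible D.isHomogeneous (hF.homogeneous j) hj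
    (fun i => (vanishesToOrder_iff_le_multAt D.irreducible.ne_zero).2 le_rfl)
    (fun i => hF.vanishing i j)

/-- The inverse map `G` is applied to a general line and common factors are divided out. The line is
parametrized so that a well-chosen point `p` of its pull-back sits at `t = ∞`, which controls all
degrees. -/
lemma nonempty_lineParametrization (hF : IsReduction x d m F) :
    Nonempty (LineParametrization x d m F) := by
  classical
  obtain ⟨e, G, H, H', hG, hH, -, hGF, hFG⟩ := hF.birational
  obtain ⟨k, hHk⟩ : ∃ k, H.IsHomogeneous k := by
    have h1 : (aeval F (G 0)).IsHomogeneous (d * e) := (hG 0).aeval F hF.homogeneous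
    rw [hGF 0] at h1
    obtain ⟨k, l, -, hk, -⟩ := isHomogeneous_of_mul h1 (mul_ne_zero hH (X_ne_zero 0))
    exact ⟨k, hk⟩
  -- The extra factor `X 0` is a non-unit, so being coprime to the product forces the pull-back to
  -- be nonzero even if `H` is constant.
  obtain ⟨c, hrel', hord⟩ := hF.exists_general_line (mul_ne_zero hH (X_ne_zero 0))
    (hHk.mul (isHomogeneous_X ℂ 0))
  have hrel : IsRelPrime (aeval F (linForm c)) H := hrel'.of_mul_right_left
  have hAh := hF.aeval_linForm_isHomogeneous c
  have hA0 : aeval F (linForm c) ≠ 0 := by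
    intro h0
    rw [h0] at hrel'
    exact (X_prime (R := ℂ) (i := (0 : Fin 3))).not_isUnit
      (hrel'.of_mul_right_right (dvd_zero _) dvd_rfl)
  have hc0 : c ≠ 0 := by
    rintro rfl
    exact hA0 (by simp [linForm])
  have hAu : ¬ IsUnit (aeval F (linForm c)) := by
    intro hu
    have h1 := (isUnit_iff_totalDegree_of_isReduced.1 hu).2
    rw [hAh.totalDegree hA0] at h1
    exact hF.degree_ne_zero h1
  obtain ⟨z, hz, hzA⟩ := WfDvdMonoid.exists_irreducible_factor hAu hA0
  obtain ⟨l, hzl⟩ : ∃ l, z.IsHomogeneous l := by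
    obtain ⟨q, hq⟩ := hzA
    obtain ⟨l, _, -, hl, -⟩ := isHomogeneous_of_mul (hq ▸ hAh) (hq ▸ hA0)
    exact ⟨l, hl⟩
  -- Away from the `x i` and from `H = 0`, the map `F` is defined at `p` and `G` carries its image
  -- `b` back to `p`.
  obtain ⟨p, hpx, hpz, hpH⟩ := exists_point hz hzl hHk (fun h => hz.not_isUnit (hrel hzA h))
    (Finset.univ.image x)
  obtain ⟨b, hb⟩ : ∃ b : Fin 3 → ℂ, b = fun j => eval p.rep (F j) := ⟨_, rfl⟩
  have hevF : ∀ P : PolyRing, eval p.rep (aeval F P) = eval b P := fun P => by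
    rw [hb]
    exact eval_aeval_form _ _ _
  have hcb : c ⬝ᵥ b = 0 := by
    obtain ⟨q, hq⟩ := hzA
    rw [← eval_linForm, ← hevF, hq, map_mul, hpz, zero_mul]
  have hb0 : b ≠ 0 := by
    obtain ⟨j, hj⟩ := hF.noBasePoint p fun i hi =>
      hpx (hi ▸ Finset.mem_image_of_mem x (Finset.mem_univ i))
    intro h0
    apply hj
    have := congrFun h0 j
    rwa [hb] at this
  obtain ⟨a, u, v, hca, hua, hub, hva, hvb, hspan⟩ := exists_plane_basis hc0 hb0 hcb
  obtain ⟨ℓ, hℓ⟩ : ∃ ℓ : Fin 3 → Polynomial ℂ,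
    ℓ = fun j => Polynomial.C (a j) + Polynomial.C (b j) * Polynomial.X := ⟨_, rfl⟩
  have hℓ1 : ∀ j, (ℓ j).natDegree ≤ 1 := fun j => by
    simp only [hℓ]
    rw [add_comm]
    exact Polynomial.natDegree_linear_le
  have hℓc : (fun j => (ℓ j).coeff 1) = b := by
    funext j
    simp [hℓ, Polynomial.coeff_C]
  have hℓlin : ∀ y : Fin 3 → ℂ, ∑ j, y j • ℓ j =
      Polynomial.C (y ⬝ᵥ a) + Polynomial.C (y ⬝ᵥ b) * Polynomial.X := fun y => by
    simp only [hℓ, Polynomial.smul_eq_C_mul, dotProduct, map_sum, map_mul, Finset.sum_mul,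
      ← Finset.sum_add_distrib]
    exact Finset.sum_congr rfl fun j _ => by ring
  obtain ⟨g, hg⟩ : ∃ g : Fin 3 → Polynomial ℂ, g = fun j => aeval ℓ (G j) := ⟨_, rfl⟩
  have hgP : ∀ P : PolyRing, aeval g P = aeval ℓ (aeval G P) := fun P => by
    rw [hg]
    exact (aeval_aeval_form _ _ _).symm
  have hgdeg : ∀ j, (g j).natDegree ≤ e := fun j => by
    rw [hg]
    simpa using (natDegree_aeval_le (hG j) hℓ1).1
  -- The value at infinity is `G b = G (F p) = H p • p`, so no degree is lost in the coordinate
  -- `j₀`.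
  have hgc : ∀ j, (g j).coeff e = eval p.rep H * p.rep j := fun j => by
    have h1 := (natDegree_aeval_le (hG j) hℓ1).2
    rw [mul_one, hℓc, ← hevF, hGF, map_mul, eval_X] at h1
    rw [hg]
    exact h1
  obtain ⟨j₀, hj₀⟩ := exists_rep_ne_zero p
  have hgj₀ : (g j₀).coeff e ≠ 0 := by
    rw [hgc]
    exact mul_ne_zero hpH hj₀
  obtain ⟨q, γ, w, hq0, hqγ, hprim⟩ := exists_primitive g (by
    rintro h0
    exact hgj₀ (by rw [h0]; simp))
  have hgγ : g = fun j => q * γ j := funext hqγ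
  have hγj₀ : γ j₀ ≠ 0 := by
    intro h0
    exact hgj₀ (by rw [hqγ, h0]; simp)
  have hdeg : q.natDegree + (γ j₀).natDegree = e := by
    rw [← Polynomial.natDegree_mul hq0 hγj₀, ← hqγ]
    exact le_antisymm (hgdeg j₀) (Polynomial.le_natDegree_of_ne_zero hgj₀)
  have hγdeg : ∀ j, (γ j).natDegree ≤ (γ j₀).natDegree := fun j => by
    by_cases h0 : γ j = 0
    · simp [h0]
    · have := hgdeg j
      rw [hqγ, Polynomial.natDegree_mul hq0 h0] at this
      lia
  obtain ⟨ρ, hρ0, hρ⟩ : ∃ ρ : ℂ, ρ ≠ 0 ∧ ∀ j, (γ j).coeff (γ j₀).natDegree = ρ * p.rep j := by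
    have hlc : q.coeff q.natDegree ≠ 0 := by simpa using hq0
    refine ⟨eval p.rep H / q.coeff q.natDegree, div_ne_zero hpH hlc, fun j => ?_⟩
    have h1 := hgc j
    rw [← hdeg, hqγ, Polynomial.coeff_mul_add_eq_of_natDegree_le le_rfl (hγdeg j)] at h1
    rw [div_mul_eq_mul_div, eq_div_iff hlc, ← h1, mul_comm]
  have hgF : ∀ j, q ^ d * aeval γ (F j) = aeval ℓ H' * ℓ j := fun j => by
    rw [← aeval_mul_of_isHomogeneous (hF.homogeneous j), ← hgγ, hgP, hFG, map_mul, aeval_X]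
  have hgFlin : ∀ y : Fin 3 → ℂ, q ^ d * aeval γ (aeval F (linForm y)) =
      aeval ℓ H' * (Polynomial.C (y ⬝ᵥ a) + Polynomial.C (y ⬝ᵥ b) * Polynomial.X) := fun y => by
    rw [aeval_linForm, map_sum, ← hℓlin, Finset.mul_sum, Finset.mul_sum]
    refine Finset.sum_congr rfl fun j _ => ?_
    rw [map_smul, mul_smul_comm, hgF, mul_smul_comm]
  obtain ⟨h, hh⟩ : ∃ h, h = aeval γ (aeval F (linForm u)) := ⟨_, rfl⟩
  have hqh : q ^ d * h = aeval ℓ H' := by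
    rw [hh, hgFlin, hua, hub]
    simp
  have hqd : q ^ d ≠ 0 := pow_ne_zero _ hq0
  have hFh : ∀ j, aeval γ (F j) = h * ℓ j := fun j => by
    apply mul_left_cancel₀ hqd
    rw [hgF, ← hqh, mul_assoc]
  have hhX : aeval γ (aeval F (linForm v)) = h * Polynomial.X := by
    apply mul_left_cancel₀ hqd
    rw [hgFlin, hva, hvb, ← hqh]
    simp [mul_assoc]
  -- At infinity `γ` is a multiple of `p`, where the functional `v` pulled back by `F` takes the
  -- value `v ⬝ᵥ b = 1`. So `h * X` has the full degree.
  obtain ⟨hd1, hd2⟩ := natDegree_aeval_le (hF.aeval_linForm_isHomogeneous v) hγdeg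
  have hd3 : (aeval γ (aeval F (linForm v))).coeff (d * (γ j₀).natDegree) ≠ 0 := by
    rw [hd2, show (fun i => (γ i).coeff (γ j₀).natDegree) = ρ • p.rep from funext hρ,
      eval_smul_of_isHomogeneous (hF.aeval_linForm_isHomogeneous v), hevF, eval_linForm, hvb,
      mul_one]
    exact pow_ne_zero _ hρ0
  have hh0 : h ≠ 0 := by
    rintro h0
    rw [hhX, h0, zero_mul] at hd3
    simp at hd3
  have hhdeg : h.natDegree + 1 = d * (γ j₀).natDegree := by
    rw [← Polynomial.natDegree_mul_X hh0, ← hhX]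
    exact le_antisymm hd1 (Polynomial.le_natDegree_of_ne_zero hd3)
  exact ⟨{
    c := c
    a := a
    b := b
    u := u
    v := v
    γ := γ
    w := w
    h := h
    e := (γ j₀).natDegree
    j₀ := j₀
    c_a := hca
    c_b := hcb
    u_a := hua
    u_b := hub
    v_a := hva
    v_b := hvb
    primitive := hprim
    natDegree_le := hγdeg
    natDegree_eq := rfl
    aeval_form := fun j => by rw [hFh, hℓ]
    h_ne_zero := hh0
    natDegree_h := hhdeg
    form_ne_zero := hA0
    order_eq := hord
    dvd_of_aeval_eq_zero := fun D B hB h0 => by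
      -- `B` composed with `G` vanishes on the line, so `linForm c` divides it. Composing with `F`
      -- gives that the pull-back divides `H ^ D * B`, and it is coprime to `H`.
      have h1 : aeval ℓ (aeval G B) = 0 := by
        rw [← hgP, hgγ, aeval_mul_of_isHomogeneous hB, h0, mul_zero]
      rw [hℓ] at h1
      obtain ⟨Z, hZ⟩ := linForm_dvd_of_aeval_eq_zero hc0 hca hua hub hspan (hB.aeval G hG) h1
      have h2 : aeval F (aeval G B) = H ^ D * B := by
        rw [aeval_aeval_form, show (fun j => aeval F (G j)) = fun j => H * X j from funext hGF,
          aeval_mul_of_isHomogeneous hB, aeval_X_left_apply]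
      refine dvd_of_dvd_pow_mul hrel (D := D) ?_
      rw [← h2, hZ, map_mul]
      exact dvd_mul_right _ _ }⟩

/-- The numerical class of the pull-back of a line. -/
lemma numerics (hF : IsReduction x d m F) (hx : Function.Injective x) :
    (d : ℤ) ^ 2 - ∑ i, (m i : ℤ) ^ 2 = 1 ∧ 3 * (d : ℤ) - ∑ i, (m i : ℤ) = 3 := by
  obtain ⟨P⟩ := hF.nonempty_lineParametrization
  exact P.numerics hF hx

end IsReduction

end BlowUpPlane
end

noncomputable section

namespace BlowUpPlane

open MvPolynomial

/-! ### The intersection form -/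

section Inter

variable {r : ℕ}

lemma inter_comm (α β : NS r) : inter α β = inter β α := by
  simp [inter, mul_comm]

lemma inter_add_left (α β γ : NS r) : inter (α + β) γ = inter α γ + inter β γ := by
  simp only [inter, Prod.fst_add, Prod.snd_add, Pi.add_apply, add_mul, Finset.sum_add_distrib]
  ring

lemma inter_smul_left (t : ℝ) (α β : NS r) : inter (t • α) β = t * inter α β := by
  simp only [inter, Prod.smul_fst, Prod.smul_snd, Pi.smul_apply, smul_eq_mul, mul_sub,
    Finset.mul_sum, mul_assoc]

lemma inter_add_right (α β γ : NS r) : inter α (β + γ) = inter α β + inter α γ := by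
  rw [inter_comm, inter_add_left, inter_comm β, inter_comm γ]

lemma inter_smul_right (t : ℝ) (α β : NS r) : inter α (t • β) = t * inter α β := by
  rw [inter_comm, inter_smul_left, inter_comm]

lemma inter_neg_left (α β : NS r) : inter (-α) β = -inter α β := by
  rw [← neg_one_smul ℝ α, inter_smul_left, neg_one_mul]

lemma inter_neg_right (α β : NS r) : inter α (-β) = -inter α β := by
  rw [inter_comm, inter_neg_left, inter_comm]

lemma inter_sub_left (α β γ : NS r) : inter (α - β) γ = inter α γ - inter β γ := by
  rw [sub_eq_add_neg, inter_add_left, inter_neg_left, sub_eq_add_neg]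

lemma inter_sub_right (α β γ : NS r) : inter α (β - γ) = inter α β - inter α γ := by
  rw [inter_comm, inter_sub_left, inter_comm β, inter_comm γ]

lemma inter_zero_right (α : NS r) : inter α 0 = 0 := by simp [inter]

lemma continuous_inter (α : NS r) : Continuous (inter α) := by
  unfold inter
  fun_prop

/-- The half of the light cone on which the degree is nonnegative. -/
def lightCone (r : ℕ) : Set (NS r) := {α | 0 ≤ inter α α ∧ 0 ≤ α.1}

lemma mem_lightCone_iff {α : NS r} :
    α ∈ lightCone r ↔ ∑ i, α.2 i ^ 2 ≤ α.1 ^ 2 ∧ 0 ≤ α.1 := by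
  simp only [lightCone, inter, Set.mem_ofPred_eq, sub_nonneg, ← sq]

lemma sum_mul_le_of_mem_lightCone {α β : NS r} (hα : α ∈ lightCone r) (hβ : β ∈ lightCone r) :
    ∑ i, α.2 i * β.2 i ≤ α.1 * β.1 := by
  rw [mem_lightCone_iff] at hα hβ
  have h1 := Finset.sum_mul_sq_le_sq_mul_sq Finset.univ α.2 β.2
  apply le_of_abs_le
  apply abs_le_of_sq_le_sq _ (mul_nonneg hα.2 hβ.2)
  rw [mul_pow]
  exact h1.trans (mul_le_mul hα.1 hβ.1 (Finset.sum_nonneg fun i _ => sq_nonneg _) (sq_nonneg _))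

lemma inter_nonneg_of_mem_lightCone {α β : NS r} (hα : α ∈ lightCone r) (hβ : β ∈ lightCone r) :
    0 ≤ inter α β := sub_nonneg.2 (sum_mul_le_of_mem_lightCone hα hβ)

lemma add_mem_lightCone {α β : NS r} (hα : α ∈ lightCone r) (hβ : β ∈ lightCone r) :
    α + β ∈ lightCone r := by
  refine ⟨?_, add_nonneg hα.2 hβ.2⟩
  have h := inter_nonneg_of_mem_lightCone hα hβ
  rw [inter_add_left, inter_add_right, inter_add_right, inter_comm β α]
  linarith [hα.1, hβ.1]

lemma smul_mem_lightCone {α : NS r} (hα : α ∈ lightCone r) {t : ℝ} (ht : 0 ≤ t) :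
    t • α ∈ lightCone r := by
  refine ⟨?_, mul_nonneg ht hα.2⟩
  rw [inter_smul_left, inter_smul_right]
  exact mul_nonneg ht (mul_nonneg ht hα.1)

lemma zero_mem_lightCone : (0 : NS r) ∈ lightCone r := ⟨by simp [inter], le_rfl⟩

lemma eq_zero_of_mem_lightCone {α : NS r} (hα : α ∈ lightCone r) (h0 : α.1 = 0) : α = 0 := by
  rw [mem_lightCone_iff, h0] at hα
  have h1 : ∑ i, α.2 i ^ 2 = 0 :=
    le_antisymm (by simpa using hα.1) (Finset.sum_nonneg fun i _ => sq_nonneg _)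
  refine Prod.ext h0 (funext fun i => ?_)
  have := (Finset.sum_eq_zero_iff_of_nonneg fun i _ => sq_nonneg _).1 h1 i (Finset.mem_univ i)
  simpa using this

end Inter

/-! ### Curves and effective classes -/

section Mori

variable {r : ℕ} {x : Fin r → Plane}

lemma PlaneCurve.one_le_degree (D : PlaneCurve) : 1 ≤ D.degree := by
  by_contra! h
  have h0 : D.form.IsHomogeneous 0 := by
    have := D.isHomogeneous
    rwa [show D.degree = 0 by lia] at this
  apply D.irreducible.not_isUnit
  rw [isUnit_iff_totalDegree_of_isReduced]
  have h1 := h0.totalDegree D.irreducible.ne_zero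
  refine ⟨?_, h1⟩
  rw [totalDegree_eq_zero_iff_eq_C] at h1
  rw [isUnit_iff_ne_zero]
  intro h2
  rw [h2, C_0] at h1
  exact D.irreducible.ne_zero h1

lemma multAt_eq_of_associated {F G : PolyRing} (h : Associated F G) (hF : F ≠ 0) (p : Plane) :
    multAt p F = multAt p G := by
  obtain ⟨u, rfl⟩ := h
  rw [multAt_mul p hF u.ne_zero, multAt_of_isUnit p u.isUnit, add_zero]

/-- Distinct integral curves meet nonnegatively. -/
lemma cls_eq_or_inter_nonneg (hx : Function.Injective x) (C C' : IntegralCurve r) :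
    C.cls x = C'.cls x ∨ 0 ≤ inter (C.cls x) (C'.cls x) := by
  rcases C with i | D <;> rcases C' with j | D'
  · by_cases hij : i = j
    · left; rw [hij]
    · right
      simp [IntegralCurve.cls, inter, Pi.single_apply, Ne.symm hij]
  · right
    simp [IntegralCurve.cls, inter, Pi.single_apply]
  · right
    simp [IntegralCurve.cls, inter, Pi.single_apply]
  · by_cases h : D.form ∣ D'.form
    · left
      have has := (D.irreducible.dvd_irreducible_iff_associated D'.irreducible).1 h
      have hdeg : D.degree = D'.degree := by
        obtain ⟨u, hu⟩ := has
        have h1 : (D.form * u).IsHomogeneous (D.degree + 0) := by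
          refine D.isHomogeneous.mul ?_
          obtain ⟨c, _, hc⟩ := (MvPolynomial.isUnit_iff_eq_C_of_isReduced).1 u.isUnit
          rw [hc]
          exact isHomogeneous_C _ _
        rw [hu, add_zero] at h1
        exact h1.inj_right D'.isHomogeneous D'.irreducible.ne_zero
      simp only [IntegralCurve.cls, hdeg,
        multAt_eq_of_associated has D.irreducible.ne_zero]
    · right
      have := sum_mul_le_mul_of_not_dvd hx D.irreducible D.isHomogeneous D'.isHomogeneous h
        (fun i => (vanishesToOrder_iff_le_multAt D.irreducible.ne_zero).2 le_rfl)
        (fun i => (vanishesToOrder_iff_le_multAt D'.irreducible.ne_zero).2 le_rfl)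
      simp only [IntegralCurve.cls, inter, neg_mul_neg, sub_nonneg]
      exact_mod_cast this

/-- An integral curve with `C² < 0` and `K · C < 0` is a `(-1)`-curve. -/
lemma inter_eq_neg_one (hx : Function.Injective x) (C : IntegralCurve r)
    (h1 : inter (C.cls x) (C.cls x) < 0) (h2 : inter (canonicalClass r) (C.cls x) < 0) :
    inter (C.cls x) (C.cls x) = -1 ∧ inter (canonicalClass r) (C.cls x) = -1 := by
  rcases C with i | D
  · simp [IntegralCurve.cls, inter, canonicalClass, Pi.single_apply]
  · have hg := sum_mult_le_genus hx D.irreducible D.isHomogeneous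
    have e1 : inter ((IntegralCurve.properTransform D).cls x)
        ((IntegralCurve.properTransform D).cls x) =
        (((D.degree : ℤ) ^ 2 - ∑ i, (multAt (x i) D.form : ℤ) ^ 2 : ℤ) : ℝ) := by
      simp [IntegralCurve.cls, inter, sq]
    have e2 : inter (canonicalClass r) ((IntegralCurve.properTransform D).cls x) =
        ((∑ i, (multAt (x i) D.form : ℤ) - 3 * (D.degree : ℤ) : ℤ) : ℝ) := by
      simp [IntegralCurve.cls, inter, canonicalClass]
      ring
    rw [e1] at h1 ⊢
    rw [e2] at h2 ⊢
    have h1' : (D.degree : ℤ) ^ 2 - ∑ i, (multAt (x i) D.form : ℤ) ^ 2 < 0 := by exact_mod_cast h1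
    have h2' : ∑ i, (multAt (x i) D.form : ℤ) - 3 * (D.degree : ℤ) < 0 := by exact_mod_cast h2
    have e3 : ∑ i, (multAt (x i) D.form : ℤ) * (multAt (x i) D.form - 1) =
        ∑ i, (multAt (x i) D.form : ℤ) ^ 2 - ∑ i, (multAt (x i) D.form : ℤ) := by
      rw [← Finset.sum_sub_distrib]
      exact Finset.sum_congr rfl fun i _ => by ring
    rw [e3] at hg
    -- The genus bound reads `C² + K · C ≥ -2`, and both summands are negative integers.
    have h3 : (D.degree : ℤ) ^ 2 - ∑ i, (multAt (x i) D.form : ℤ) ^ 2 = -1 := by nlinarith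
    have h4 : ∑ i, (multAt (x i) D.form : ℤ) - 3 * (D.degree : ℤ) = -1 := by nlinarith
    rw [h3, h4]
    norm_num

/-- The cone of effective classes. -/
def effCone (x : Fin r → Plane) : Submodule ℝ≥0 (NS r) :=
  Submodule.span ℝ≥0 (Set.range (IntegralCurve.cls x))

lemma cls_mem_effCone (C : IntegralCurve r) : C.cls x ∈ effCone x :=
  Submodule.subset_span ⟨C, rfl⟩

lemma effCone_subset : (effCone x : Set (NS r)) ⊆ moriCone x := subset_closure

lemma smul_mem_effCone {α : NS r} (hα : α ∈ effCone x) {t : ℝ} (ht : 0 ≤ t) :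
    t • α ∈ effCone x := (effCone x).smul_mem ⟨t, ht⟩ hα

lemma isClosed_moriCone : IsClosed (moriCone x) := isClosed_closure

lemma add_mem_moriCone {α β : NS r} (hα : α ∈ moriCone x) (hβ : β ∈ moriCone x) :
    α + β ∈ moriCone x :=
  map_mem_closure₂ continuous_add hα hβ fun _ ha _ hb => (effCone x).add_mem ha hb

lemma smul_mem_moriCone {α : NS r} (hα : α ∈ moriCone x) {t : ℝ} (ht : 0 ≤ t) :
    t • α ∈ moriCone x :=
  map_mem_closure (continuous_const_smul t) hα fun _ ha => smul_mem_effCone ha ht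

lemma zero_mem_moriCone : (0 : NS r) ∈ moriCone x := effCone_subset (effCone x).zero_mem

lemma exceptional_mem_effCone (i : Fin r) : ((0, Pi.single i 1) : NS r) ∈ effCone x :=
  cls_mem_effCone (.exceptional i)

/-- The class of a nonzero form is a nonnegative combination of classes of curves. -/
lemma form_mult_mem_effCone {F : PolyRing} (hF : F ≠ 0) {D : ℕ} (hD : F.IsHomogeneous D) :
    (((D : ℝ), fun i => -(multAt (x i) F : ℝ)) : NS r) ∈ effCone x := by
  induction F using WfDvdMonoid.induction_on_irreducible generalizing D with
  | zero => exact absurd rfl hF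
  | unit u hu =>
    have h0 := (isUnit_iff_totalDegree_of_isReduced.1 hu).2
    rw [hD.totalDegree hF] at h0
    have : (((D : ℝ), fun i => -(multAt (x i) u : ℝ)) : NS r) = 0 := by
      refine Prod.ext (by simp [h0]) (funext fun i => ?_)
      simp [multAt_of_isUnit (x i) hu]
    rw [this]
    exact (effCone x).zero_mem
  | mul a i ha hi ih =>
    obtain ⟨k, l, hkl, hk, hl⟩ := isHomogeneous_of_mul hD hF
    have h1 := cls_mem_effCone (x := x) (.properTransform ⟨i, k, hk, hi⟩)
    have h2 := (effCone x).add_mem h1 (ih ha hl)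
    convert h2 using 1
    refine Prod.ext ?_ (funext fun j => ?_)
    · simp [IntegralCurve.cls, ← hkl]
    · simp [IntegralCurve.cls, multAt_mul _ hi.ne_zero ha]
      ring

lemma exceptional_sum_mem_effCone {t : Fin r → ℝ} (ht : ∀ i, 0 ≤ t i) :
    ((0, t) : NS r) ∈ effCone x := by
  have : ((0, t) : NS r) = ∑ i, t i • ((0, Pi.single i 1) : NS r) := by
    refine Prod.ext ?_ (funext fun j => ?_)
    · simp [Prod.fst_sum]
    · simp [Prod.snd_sum, Finset.sum_apply, Pi.single_apply]
  rw [this]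
  exact Submodule.sum_mem _ fun i _ => smul_mem_effCone (exceptional_mem_effCone i) (ht i)

/-- Multiplicities beyond the assigned ones are compensated by adding exceptional curves. -/
lemma form_mem_effCone {F : PolyRing} (hF : F ≠ 0) {D : ℕ} {k : Fin r → ℕ}
    (h : F ∈ formsVanishing x D k) :
    (((D : ℝ), fun i => -(k i : ℝ)) : NS r) ∈ effCone x := by
  have h1 := form_mult_mem_effCone (x := x) hF h.1
  have h2 : ((0, fun i => (multAt (x i) F : ℝ) - k i) : NS r) ∈ effCone x :=
    exceptional_sum_mem_effCone fun i => sub_nonneg.2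
      (by exact_mod_cast (vanishesToOrder_iff_le_multAt hF).1 (h.2 i))
  convert (effCone x).add_mem h1 h2 using 1
  refine Prod.ext ?_ (funext fun j => ?_)
  · simp
  · simp
    ring

/-- Classes with enough expected sections are effective. -/
lemma mem_effCone_of_count {D : ℕ} {k : Fin r → ℕ}
    (h : ∑ i, (k i : ℝ) * (k i + 1) < (D + 1) * (D + 2)) :
    (((D : ℝ), fun i => -(k i : ℝ)) : NS r) ∈ effCone x := by
  have h1 := le_finrank_formsVanishing x D k
  have h2 : ∑ i, (k i + 1).choose 2 < (D + 2).choose 2 := by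
    have e1 := two_mul_choose_two (D + 1)
    have e2 : 2 * ∑ i, ((k i + 1).choose 2 : ℤ) = ∑ i, (k i : ℤ) * (k i + 1) := by
      rw [Finset.mul_sum]
      exact Finset.sum_congr rfl fun i _ => by rw [two_mul_choose_two]; ring
    have h' : ∑ i, (k i : ℤ) * (k i + 1) < (D + 1) * (D + 2) := by exact_mod_cast h
    zify
    push_cast at e1
    linarith
  have h3 : 0 < Module.finrank ℂ (formsVanishing x D k) := by lia
  obtain ⟨F, hF⟩ := Module.finrank_pos_iff_exists_ne_zero.1 h3
  exact form_mem_effCone (fun h => hF (Subtype.ext h)) F.2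

end Mori

end BlowUpPlane
end

noncomputable section

namespace BlowUpPlane

open Filter Topology

section MoriCone

variable {r : ℕ} {x : Fin r → Plane}

/-! ### The light cone lies in the Mori cone -/

/-- Asymptotic Riemann–Roch: the integer parts of `n • α` satisfy the inequality of
`mem_effCone_of_count` for large `n`, because the quadratic terms dominate. Dividing by `n` and
passing to the limit gives the class. -/
lemma mem_moriCone_of_sum_sq_lt_of_nonneg {a : ℝ} {b : Fin r → ℝ} (ha : 0 ≤ a)
    (hb : ∀ i, 0 ≤ b i) (h : ∑ i, b i ^ 2 < a ^ 2) : ((a, fun i => -b i) : NS r) ∈ moriCone x := by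
  have hD : Tendsto (fun n : ℕ => (⌊a * n⌋₊ : ℝ) / n) atTop (𝓝 a) :=
    (tendsto_nat_floor_mul_div_atTop ha).comp tendsto_natCast_atTop_atTop
  have hk : ∀ i, Tendsto (fun n : ℕ => (⌊b i * n⌋₊ : ℝ) / n) atTop (𝓝 (b i)) := fun i =>
    (tendsto_nat_floor_mul_div_atTop (hb i)).comp tendsto_natCast_atTop_atTop
  have hinv : Tendsto (fun n : ℕ => ((n : ℝ))⁻¹) atTop (𝓝 0) := tendsto_inv_atTop_nhds_zero_nat
  have hsum : Tendsto (fun n : ℕ => ∑ i, ((⌊b i * n⌋₊ : ℝ) / n) * ((⌊b i * n⌋₊ : ℝ) / n + (n : ℝ)⁻¹))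
      atTop (𝓝 (∑ i, b i ^ 2)) := by
    refine tendsto_finsetSum _ fun i _ => ?_
    have := (hk i).mul ((hk i).add hinv)
    simpa [sq] using this
  have hev := hsum.eventually_lt (hD.pow 2) h
  refine mem_closure_of_tendsto
    (f := fun n : ℕ => (((⌊a * n⌋₊ : ℝ) / n, fun i => -((⌊b i * n⌋₊ : ℝ) / n)) : NS r))
    (b := atTop) (hD.prodMk_nhds (tendsto_pi_nhds.2 fun i => (hk i).neg)) ?_
  filter_upwards [hev, eventually_gt_atTop 0] with n hn hn0
  have hn1 : (0 : ℝ) < n := by exact_mod_cast hn0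
  have h1 : ∑ i, (⌊b i * n⌋₊ : ℝ) * (⌊b i * n⌋₊ + 1) < (⌊a * n⌋₊ + 1) * (⌊a * n⌋₊ + 2) := by
    have e1 : ∑ i, (⌊b i * n⌋₊ : ℝ) * (⌊b i * n⌋₊ + 1) = n ^ 2 *
        ∑ i, ((⌊b i * n⌋₊ : ℝ) / n) * ((⌊b i * n⌋₊ : ℝ) / n + (n : ℝ)⁻¹) := by
      rw [Finset.mul_sum]
      refine Finset.sum_congr rfl fun i _ => ?_
      field_simp
    have e2 : (⌊a * n⌋₊ : ℝ) ^ 2 = n ^ 2 * ((⌊a * n⌋₊ : ℝ) / n) ^ 2 := by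
      field_simp
    have h2 := mul_lt_mul_of_pos_left hn (pow_pos hn1 2)
    have h3 : (0 : ℝ) ≤ ⌊a * n⌋₊ := Nat.cast_nonneg _
    rw [← e1, ← e2] at h2
    nlinarith
  have h4 := smul_mem_effCone (mem_effCone_of_count (x := x) h1) (inv_nonneg.2 hn1.le)
  have e : (((⌊a * n⌋₊ : ℝ) / n, fun i => -((⌊b i * n⌋₊ : ℝ) / n)) : NS r) =
      (n : ℝ)⁻¹ • ((⌊a * n⌋₊ : ℝ), fun i => -(⌊b i * n⌋₊ : ℝ)) := by
    ext j <;> simp [div_eq_inv_mul]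
  rw [e]
  exact h4

/-- Positive coefficients of exceptional curves are split off as effective; dropping them only
increases the square. -/
lemma mem_moriCone_of_sum_sq_lt {α : NS r} (hα : 0 ≤ α.1) (h : ∑ i, α.2 i ^ 2 < α.1 ^ 2) :
    α ∈ moriCone x := by
  have h1 : ((α.1, fun i => -(max (-α.2 i) 0)) : NS r) ∈ moriCone x := by
    refine mem_moriCone_of_sum_sq_lt_of_nonneg hα (fun i => le_max_right _ _) (lt_of_le_of_lt ?_ h)
    refine Finset.sum_le_sum fun i _ => ?_
    rcases max_choice (-α.2 i) 0 with h | h <;> rw [h] <;> nlinarith [sq_nonneg (α.2 i)]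
  have h2 : ((0, fun i => α.2 i + max (-α.2 i) 0) : NS r) ∈ effCone x :=
    exceptional_sum_mem_effCone fun i => by linarith [le_max_left (-α.2 i) 0]
  convert add_mem_moriCone h1 (effCone_subset h2) using 1
  refine Prod.ext ?_ (funext fun j => ?_)
  · simp
  · simp

lemma lightCone_subset_moriCone : lightCone r ⊆ moriCone x := by
  intro α hα
  rw [mem_lightCone_iff] at hα
  have hlim : Tendsto (fun n : ℕ => α + (1 / ((n : ℝ) + 1)) • ((1, 0) : NS r)) atTop (𝓝 α) := by
    simpa using tendsto_const_nhds.add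
      ((tendsto_one_div_add_atTop_nhds_zero_nat (𝕜 := ℝ)).smul_const ((1, 0) : NS r))
  refine isClosed_moriCone.mem_of_tendsto hlim (Eventually.of_forall fun n => ?_)
  have hn : (0 : ℝ) < 1 / ((n : ℝ) + 1) := Nat.one_div_pos_of_nat
  apply mem_moriCone_of_sum_sq_lt
  · simp only [Prod.fst_add, Prod.smul_fst, smul_eq_mul, mul_one]
    linarith [hα.2]
  · simp only [Prod.fst_add, Prod.smul_fst, smul_eq_mul, mul_one, Prod.snd_add, Prod.smul_snd,
      smul_zero, add_zero]
    nlinarith [hα.1, hα.2]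

/-! ### An ample class -/

/-- The class `(r + 1) L - ∑ i, E i`. -/
def polarization (r : ℕ) : NS r := ((r : ℝ) + 1, fun _ => -1)

lemma inter_polarization (γ : NS r) :
    inter (polarization r) γ = (r + 1) * γ.1 + ∑ i, γ.2 i := by
  simp [inter, polarization]

/-- Multiplicities are at most the degree, so `(r + 1) d - ∑ m i ≥ d`. This linear bound on the norm
yields both ampleness and compact slices of the Mori cone. -/
lemma norm_cls_le (C : IntegralCurve r) : ‖C.cls x‖ ≤ inter (polarization r) (C.cls x) := by
  rw [inter_polarization]
  rcases C with i | D
  · rw [Prod.norm_def]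
    simp [IntegralCurve.cls, Pi.single_apply, Pi.norm_single]
  · have hm : ∀ i, (multAt (x i) D.form : ℝ) ≤ D.degree := fun i => by
      exact_mod_cast multAt_le_degree (x i) D.irreducible.ne_zero D.isHomogeneous
    have h1 : ∑ i, (multAt (x i) D.form : ℝ) ≤ r * D.degree := by
      simpa using Finset.sum_le_sum fun i (_ : i ∈ Finset.univ) => hm i
    have h2 : (D.degree : ℝ) ≤ (r + 1) * D.degree + ∑ i, -(multAt (x i) D.form : ℝ) := by
      rw [Finset.sum_neg_distrib]
      linarith
    refine le_trans ?_ h2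
    simp only [IntegralCurve.cls, Prod.norm_def]
    refine max_le (by simp) ((pi_norm_le_iff_of_nonneg (Nat.cast_nonneg _)).2 fun i => ?_)
    simpa using hm i

lemma norm_le_inter_polarization {γ : NS r} (hγ : γ ∈ moriCone x) :
    ‖γ‖ ≤ inter (polarization r) γ := by
  have hc : IsClosed {γ : NS r | ‖γ‖ ≤ inter (polarization r) γ} :=
    isClosed_le continuous_norm (continuous_inter _)
  refine closure_minimal (fun z hz => ?_) hc hγ
  induction hz using Submodule.span_induction with
  | mem z hz =>
    obtain ⟨C, rfl⟩ := hz
    exact norm_cls_le C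
  | zero => simp [inter_zero_right]
  | add a b _ _ ha hb =>
    rw [Set.mem_ofPred_eq, inter_add_right]
    exact (norm_add_le a b).trans (add_le_add ha hb)
  | smul t a _ ha =>
    have e : t • a = (t : ℝ) • a := rfl
    rw [Set.mem_ofPred_eq, e, inter_smul_right, norm_smul, Real.norm_of_nonneg t.coe_nonneg]
    exact mul_le_mul_of_nonneg_left ha t.2

lemma inter_polarization_nonneg {γ : NS r} (hγ : γ ∈ moriCone x) :
    0 ≤ inter (polarization r) γ := (norm_nonneg γ).trans (norm_le_inter_polarization hγ)

lemma inter_polarization_pos {γ : NS r} (hγ : γ ∈ moriCone x) (h0 : γ ≠ 0) :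
    0 < inter (polarization r) γ := (norm_pos_iff.2 h0).trans_le (norm_le_inter_polarization hγ)

lemma isAmple_polarization : IsAmple x (polarization r) := fun _ => inter_polarization_pos

/-- The Mori cone contains no line. -/
lemma eq_zero_of_neg_mem_moriCone {γ : NS r} (h1 : γ ∈ moriCone x) (h2 : -γ ∈ moriCone x) :
    γ = 0 := by
  by_contra h
  have h3 := inter_polarization_pos h1 h
  have h4 := inter_polarization_nonneg h2
  rw [inter_neg_right] at h4
  linarith

/-- An ample class is positive on the nonzero part of the light cone, since that lies in the Mori
cone. It therefore selects the same half as the degree. -/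
lemma quadricCone_eq_lightCone : quadricCone x = lightCone r := by
  ext α
  constructor
  · rintro ⟨h1, h, hh, h2⟩
    refine ⟨h1, ?_⟩
    by_contra! h3
    have h4 : -α ∈ lightCone r :=
      ⟨by rwa [inter_neg_left, inter_neg_right, neg_neg], by simpa using h3.le⟩
    have h5 := hh (-α) (lightCone_subset_moriCone h4) (fun h0 => by
      rw [neg_eq_zero] at h0; rw [h0] at h3; exact lt_irrefl _ h3)
    rw [inter_neg_right, inter_comm] at h5
    linarith
  · intro hα
    refine ⟨hα.1, polarization r, isAmple_polarization, ?_⟩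
    rw [inter_comm]
    exact inter_polarization_nonneg (lightCone_subset_moriCone (x := x) hα)

/-- A class that is nonnegative on all integral curves is nonnegative on the Mori cone. -/
lemma inter_nonneg_of_forall_cls {α : NS r} (h : ∀ C : IntegralCurve r, 0 ≤ inter α (C.cls x))
    {γ : NS r} (hγ : γ ∈ moriCone x) : 0 ≤ inter α γ := by
  have hc : IsClosed {γ : NS r | 0 ≤ inter α γ} := isClosed_le continuous_const (continuous_inter _)
  refine closure_minimal (fun z hz => ?_) hc hγ
  induction hz using Submodule.span_induction with
  | mem z hz =>
    obtain ⟨C, rfl⟩ := hz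
    exact h C
  | zero => simp [inter_zero_right]
  | add a b _ _ ha hb =>
    rw [Set.mem_ofPred_eq, inter_add_right]
    exact add_nonneg ha hb
  | smul t a _ ha =>
    have e : t • a = (t : ℝ) • a := rfl
    rw [Set.mem_ofPred_eq, e, inter_smul_right]
    exact mul_nonneg t.2 ha

/-! ### Extremal rays of negative square -/

lemma cls_ne_zero (C : IntegralCurve r) : C.cls x ≠ 0 := by
  rcases C with i | D
  · intro h
    have := congrFun (congrArg Prod.snd h) i
    simp [IntegralCurve.cls] at this
  · intro h
    have := congrArg Prod.fst h
    have h1 := D.one_le_degree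
    simp [IntegralCurve.cls] at this
    lia

/-- The component along `C` is separated; curves of any other class meet `C` nonnegatively. -/
lemma exists_decomposition_of_mem_effCone (hx : Function.Injective x) (C : IntegralCurve r)
    {z : NS r} (hz : z ∈ effCone x) :
    ∃ a : ℝ, 0 ≤ a ∧ ∃ s ∈ effCone x, 0 ≤ inter (C.cls x) s ∧ z = a • C.cls x + s := by
  induction hz using Submodule.span_induction with
  | mem z hz =>
    obtain ⟨C', rfl⟩ := hz
    rcases cls_eq_or_inter_nonneg hx C C' with h | h
    · exact ⟨1, zero_le_one, 0, (effCone x).zero_mem, by simp [inter_zero_right], by simp [h]⟩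
    · exact ⟨0, le_rfl, _, cls_mem_effCone C', h, by simp⟩
  | zero => exact ⟨0, le_rfl, 0, (effCone x).zero_mem, by simp [inter_zero_right], by simp⟩
  | add y z _ _ hy hz =>
    obtain ⟨a, ha, s, hs, hCs, rfl⟩ := hy
    obtain ⟨b, hb, t, ht, hCt, rfl⟩ := hz
    refine ⟨a + b, add_nonneg ha hb, s + t, (effCone x).add_mem hs ht, ?_, ?_⟩
    · rw [inter_add_right]
      exact add_nonneg hCs hCt
    · rw [add_smul]
      abel
  | smul t z _ hz =>
    obtain ⟨a, ha, s, hs, hCs, rfl⟩ := hz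
    refine ⟨t * a, mul_nonneg t.2 ha, (t : ℝ) • s, smul_mem_effCone hs t.2, ?_, ?_⟩
    · rw [inter_smul_right]
      exact mul_nonneg t.2 hCs
    · rw [mul_smul, ← smul_add]
      rfl

/-- The polarization bounds the coefficients of `C` along a convergent sequence of effective
classes, so a subsequence of the decompositions converges. -/
lemma exists_decomposition_of_mem_moriCone (hx : Function.Injective x) (C : IntegralCurve r)
    {z : NS r} (hz : z ∈ moriCone x) :
    ∃ a : ℝ, 0 ≤ a ∧ ∃ s ∈ moriCone x, 0 ≤ inter (C.cls x) s ∧ z = a • C.cls x + s := by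
  obtain ⟨y, hy, hlim⟩ := mem_closure_iff_seq_limit.1 hz
  choose a ha s hs hCs hdec using fun n => exists_decomposition_of_mem_effCone hx C (hy n)
  have hC := inter_polarization_pos (effCone_subset (cls_mem_effCone C)) (cls_ne_zero (x := x) C)
  have hlim' : Tendsto (fun n => inter (polarization r) (y n)) atTop
      (𝓝 (inter (polarization r) z)) := ((continuous_inter _).tendsto _).comp hlim
  obtain ⟨B, hB⟩ := hlim'.bddAbove_range
  have hab : ∀ n, a n ∈ Set.Icc 0 (B / inter (polarization r) (C.cls x)) := by
    intro n
    refine ⟨ha n, ?_⟩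
    rw [le_div_iff₀ hC]
    have h1 : inter (polarization r) (y n) ≤ B := hB ⟨n, rfl⟩
    rw [hdec n, inter_add_right, inter_smul_right] at h1
    linarith [inter_polarization_nonneg (effCone_subset (hs n))]
  obtain ⟨b, hb, φ, hφ, hbl⟩ := isCompact_Icc.tendsto_subseq hab
  have hsl : Tendsto (fun n => s (φ n)) atTop (𝓝 (z - b • C.cls x)) := by
    have e : (fun n => s (φ n)) = fun n => y (φ n) - a (φ n) • C.cls x := by
      funext n
      rw [hdec (φ n), add_sub_cancel_left]
    rw [e]
    exact (hlim.comp hφ.tendsto_atTop).sub (hbl.smul_const _)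
  refine ⟨b, hb.1, z - b • C.cls x, ?_, ?_, by simp⟩
  · exact isClosed_moriCone.mem_of_tendsto hsl (Eventually.of_forall fun n => effCone_subset (hs _))
  · exact ge_of_tendsto' (((continuous_inter _).tendsto _).comp hsl) fun n => hCs _

lemma mem_ray_self (α : NS r) : α ∈ ray α := ⟨1, zero_le_one, by simp⟩

lemma ray_eq_of_mem {α β : NS r} (hβ : β ∈ ray α) (h0 : β ≠ 0) : ray β = ray α := by
  obtain ⟨t, ht, rfl⟩ := hβ
  have ht0 : t ≠ 0 := fun h => h0 (by simp [h])
  ext γ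
  constructor
  · rintro ⟨u, hu, rfl⟩
    exact ⟨u * t, mul_nonneg hu ht, by rw [mul_smul]⟩
  · rintro ⟨u, hu, rfl⟩
    exact ⟨u * t⁻¹, mul_nonneg hu (inv_nonneg.2 ht), by
      rw [smul_smul, mul_assoc, inv_mul_cancel₀ ht0, mul_one]⟩

/-- An extremal ray of negative square is spanned by an integral curve. -/
lemma exists_cls_of_isExtremalRay (hx : Function.Injective x) {α : NS r}
    (h : IsExtremalRay (moriCone x) (ray α)) (hα : inter α α < 0) :
    ∃ C : IntegralCurve r, ray α = ray (C.cls x) ∧ inter (C.cls x) (C.cls x) < 0 := by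
  have hαm : α ∈ moriCone x := h.2.1 (mem_ray_self α)
  -- A class nonnegative on all curves would be nonnegative on `α` itself, contrary to `α² < 0`. The
  -- curve found here then enters `α` with positive coefficient, and extremality puts it on the ray.
  obtain ⟨C, hC⟩ : ∃ C : IntegralCurve r, inter α (C.cls x) < 0 := by
    by_contra! h'
    exact absurd (inter_nonneg_of_forall_cls h' hαm) hα.not_ge
  obtain ⟨a, ha, s, hs, hCs, hdec⟩ := exists_decomposition_of_mem_moriCone hx C hαm
  have h1 : a * inter (C.cls x) (C.cls x) < 0 := by
    rw [inter_comm, hdec, inter_add_right, inter_smul_right] at hC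
    linarith
  have ha' : a ≠ 0 := by
    rintro rfl
    simp at h1
  have hCm : C.cls x ∈ moriCone x := effCone_subset (cls_mem_effCone C)
  have h2 := (h.2.2 _ (smul_mem_moriCone hCm ha) s hs (by rw [← hdec]; exact mem_ray_self α)).1
  refine ⟨C, ?_, neg_of_mul_neg_right h1 ha⟩
  have hne : a • C.cls x ≠ 0 := smul_ne_zero ha' (cls_ne_zero C)
  rw [← ray_eq_of_mem h2 hne, ray_eq_of_mem ⟨a, ha, rfl⟩ hne]

end MoriCone

end BlowUpPlane
end

noncomputable section

namespace BlowUpPlane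

open Filter Topology

/-! ### Isolated extreme points -/

section Convex

variable {E : Type*} [NormedAddCommGroup E] [NormedSpace ℝ E]

lemma isCompact_convexJoin {P Q : Set E} (hP : IsCompact P) (hQ : IsCompact Q) :
    IsCompact (convexJoin ℝ P Q) := by
  have h : convexJoin ℝ P Q =
      (fun z : ℝ × E × E => (1 - z.1) • z.2.1 + z.1 • z.2.2) '' (Set.Icc 0 1 ×ˢ P ×ˢ Q) := by
    ext y
    simp only [mem_convexJoin, segment_eq_image, Set.mem_image, Set.mem_prod, Prod.exists]
    constructor
    · rintro ⟨p, hp, q, hq, t, ht, rfl⟩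
      exact ⟨t, p, q, ⟨ht, hp, hq⟩, rfl⟩
    · rintro ⟨t, p, q, ⟨ht, hp, hq⟩, rfl⟩
      exact ⟨p, hp, q, hq, t, ht, rfl⟩
  rw [h]
  exact (isCompact_Icc.prod (hP.prod hQ)).image (by fun_prop)

/-- A compact set that avoids an extreme point `c` of a compact convex set `S` meets `S` inside
a compact convex subset of `S` that avoids `c`. -/
lemma exists_convex_notMem_of_mem_extremePoints {S K : Set E} {c : E} (hS : IsCompact S)
    (hSc : Convex ℝ S) (hc : c ∈ S.extremePoints ℝ) (hK : IsCompact K) (hcK : c ∉ K) :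
    ∃ P, IsCompact P ∧ Convex ℝ P ∧ P ⊆ S ∧ c ∉ P ∧ K ∩ S ⊆ P := by
  -- Compactness reduces the claim to small pieces of `K`, for which a ball intersected with `S`
  -- serves.
  refine hK.induction_on (p := fun T => ∃ P, IsCompact P ∧ Convex ℝ P ∧ P ⊆ S ∧ c ∉ P ∧ T ∩ S ⊆ P)
    ⟨∅, isCompact_empty, convex_empty, by simp, by simp, by simp⟩ ?_ ?_ ?_
  · rintro T T' hT ⟨P, h1, h2, h3, h4, h5⟩
    exact ⟨P, h1, h2, h3, h4, (Set.inter_subset_inter_left _ hT).trans h5⟩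
  · rintro T T' ⟨P, h1, h2, h3, h4, h5⟩ ⟨P', h1', h2', h3', h4', h5'⟩
    rcases P.eq_empty_or_nonempty with rfl | hP
    · refine ⟨P', h1', h2', h3', h4', ?_⟩
      rw [Set.union_inter_distrib_right]
      exact Set.union_subset (h5.trans (Set.empty_subset _)) h5'
    rcases P'.eq_empty_or_nonempty with rfl | hP'
    · refine ⟨P, h1, h2, h3, h4, ?_⟩
      rw [Set.union_inter_distrib_right]
      exact Set.union_subset h5 (h5'.trans (Set.empty_subset _))
    -- Joining two such sets cannot produce `c`: an extreme point on a segment in `S` is one of its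
    -- ends.
    refine ⟨convexJoin ℝ P P', isCompact_convexJoin h1 h1', h2.convexJoin h2',
      convexJoin_subset h3 h3' hSc, fun hcJ => ?_, ?_⟩
    · obtain ⟨p, hp, q, hq, hpq⟩ := mem_convexJoin.1 hcJ
      rcases (mem_extremePoints_iff_forall_segment.1 hc).2 p (h3 hp) q (h3' hq) hpq with h | h
      · exact h4 (h ▸ hp)
      · exact h4' (h ▸ hq)
    · rw [Set.union_inter_distrib_right]
      exact Set.union_subset (h5.trans (subset_convexJoin_left hP'))
        (h5'.trans (subset_convexJoin_right hP))
  · intro y hy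
    have hd : 0 < dist c y := dist_pos.2 fun h => hcK (h ▸ hy)
    refine ⟨Metric.closedBall y (dist c y / 2),
      mem_nhdsWithin_of_mem_nhds (Metric.closedBall_mem_nhds y (half_pos hd)),
      Metric.closedBall y (dist c y / 2) ∩ S, hS.inter_left Metric.isClosed_closedBall,
      (convex_closedBall _ _).inter hSc, Set.inter_subset_right, fun h => ?_, subset_rfl⟩
    have := Metric.mem_closedBall.1 h.1
    linarith

/-- A compact convex set is a cone over a compact convex set with apex any isolated extreme
point. -/
lemma exists_convex_segment_of_isolated {S U : Set E} {c : E} (hS : IsCompact S)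
    (hSc : Convex ℝ S) (hc : c ∈ S.extremePoints ℝ) (hU : IsOpen U) (hcU : c ∈ U)
    (hiso : ∀ e ∈ S.extremePoints ℝ, e ∈ U → e = c) :
    ∃ P, IsCompact P ∧ Convex ℝ P ∧ P ⊆ S ∧ c ∉ P ∧
      ∀ y ∈ S, y = c ∨ ∃ p ∈ P, y ∈ segment ℝ c p := by
  obtain ⟨P, h1, h2, h3, h4, h5⟩ := exists_convex_notMem_of_mem_extremePoints hS hSc hc
    (hS.diff hU) (fun h => h.2 hcU)
  refine ⟨P, h1, h2, h3, h4, fun y hy => ?_⟩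
  -- By Krein–Milman `S` is then the closed hull of `c` and `P`, which is the union of the segments
  -- from `c` to `P`.
  have hsub : S.extremePoints ℝ ⊆ insert c P := by
    intro e he
    by_cases heU : e ∈ U
    · exact Or.inl (hiso e he heU)
    · exact Or.inr (h5 ⟨⟨he.1, heU⟩, he.1⟩)
  have hy' := hy
  rw [← closure_convexHull_extremePoints hS hSc] at hy'
  have hy2 := closure_mono (convexHull_mono hsub) hy'
  rcases P.eq_empty_or_nonempty with rfl | hP
  · left
    simpa using hy2
  · right
    rw [convexHull_insert hP, h2.convexHull_eq,
      (isCompact_convexJoin isCompact_singleton h1).isClosed.closure_eq] at hy2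
    simpa using hy2

end Convex

section Isolated

variable {r : ℕ} {x : Fin r → Plane}

/-- The classes of polarized degree one in the Mori cone. -/
def moriSlice (x : Fin r → Plane) : Set (NS r) :=
  {γ | γ ∈ moriCone x ∧ inter (polarization r) γ = 1}

lemma isCompact_moriSlice : IsCompact (moriSlice x) := by
  refine Metric.isCompact_of_isClosed_isBounded
    (isClosed_moriCone.inter (isClosed_eq (continuous_inter _) continuous_const)) ?_
  refine (Metric.isBounded_closedBall (x := (0 : NS r)) (r := 1)).subset fun γ hγ => ?_
  rw [mem_closedBall_zero_iff]
  exact (norm_le_inter_polarization hγ.1).trans hγ.2.le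

lemma convex_moriSlice : Convex ℝ (moriSlice x) := by
  intro α hα β hβ a b ha hb hab
  refine ⟨add_mem_moriCone (smul_mem_moriCone hα.1 ha) (smul_mem_moriCone hβ.1 hb), ?_⟩
  rw [inter_add_right, inter_smul_right, inter_smul_right, hα.2, hβ.2, mul_one, mul_one, hab]

lemma smul_mem_moriSlice {γ : NS r} (hγ : γ ∈ moriCone x) (h0 : γ ≠ 0) :
    (inter (polarization r) γ)⁻¹ • γ ∈ moriSlice x := by
  have h := inter_polarization_pos hγ h0
  refine ⟨smul_mem_moriCone hγ (inv_nonneg.2 h.le), ?_⟩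
  rw [inter_smul_right, inv_mul_cancel₀ h.ne']

lemma eq_of_mem_ray {c e : NS r} (hc : inter (polarization r) c = 1)
    (he : inter (polarization r) e = 1) (h : e ∈ ray c) : e = c := by
  obtain ⟨t, ht, rfl⟩ := h
  rw [inter_smul_right, hc, mul_one] at he
  rw [he, one_smul]

lemma ne_zero_of_inter_polarization {e : NS r} (he : inter (polarization r) e = 1) : e ≠ 0 := by
  rintro rfl
  simp [inter_zero_right] at he

lemma isExtremalRay_of_mem_extremePoints {e : NS r} (he : e ∈ (moriSlice x).extremePoints ℝ) :
    IsExtremalRay (moriCone x) (ray e) := by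
  refine ⟨⟨e, ne_zero_of_inter_polarization he.1.2, rfl⟩, ?_, ?_⟩
  · rintro _ ⟨t, ht, rfl⟩
    exact smul_mem_moriCone he.1.1 ht
  · rintro β hβ γ hγ ⟨t, ht, hsum⟩
    by_cases hβ0 : β = 0
    · subst hβ0
      exact ⟨⟨0, le_rfl, by simp⟩, t, ht, by simpa using hsum⟩
    by_cases hγ0 : γ = 0
    · subst hγ0
      exact ⟨⟨t, ht, by simpa using hsum⟩, 0, le_rfl, by simp⟩
    set b := inter (polarization r) β with hb
    set g := inter (polarization r) γ with hg
    have hbpos : 0 < b := inter_polarization_pos hβ hβ0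
    have hgpos : 0 < g := inter_polarization_pos hγ hγ0
    have hbg : b + g = t := by
      rw [hb, hg, ← inter_add_right, hsum, inter_smul_right, he.1.2, mul_one]
    have hmem : e ∈ openSegment ℝ (b⁻¹ • β) (g⁻¹ • γ) := by
      refine ⟨b / t, g / t, by rw [← hbg]; positivity, by rw [← hbg]; positivity, ?_, ?_⟩
      · rw [← add_div, hbg, div_self (by linarith)]
      · have ht0 : t ≠ 0 := by linarith
        rw [smul_smul, smul_smul, div_mul_eq_mul_div, mul_inv_cancel₀ hbpos.ne',
          div_mul_eq_mul_div, mul_inv_cancel₀ hgpos.ne', ← smul_add, hsum, smul_smul,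
          one_div_mul_cancel ht0, one_smul]
    obtain ⟨h1, h2⟩ := (mem_extremePoints.1 he).2 _ (smul_mem_moriSlice hβ hβ0) _
      (smul_mem_moriSlice hγ hγ0) hmem
    exact ⟨⟨b, hbpos.le, by rw [← h1, smul_smul, mul_inv_cancel₀ hbpos.ne', one_smul]⟩,
      g, hgpos.le, by rw [← h2, smul_smul, mul_inv_cancel₀ hgpos.ne', one_smul]⟩

lemma mem_extremePoints_of_isExtremalRay {e : NS r} (h : IsExtremalRay (moriCone x) (ray e))
    (he : inter (polarization r) e = 1) : e ∈ (moriSlice x).extremePoints ℝ := by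
  refine mem_extremePoints_iff_left.2 ⟨⟨h.2.1 (mem_ray_self e), he⟩, ?_⟩
  rintro β hβ γ hγ ⟨a, b, ha, hb, hab, hsum⟩
  have h1 := (h.2.2 _ (smul_mem_moriCone hβ.1 ha.le) _ (smul_mem_moriCone hγ.1 hb.le)
    (by rw [hsum]; exact mem_ray_self e)).1
  obtain ⟨t, ht, h2⟩ := h1
  refine eq_of_mem_ray he hβ.2 ⟨a⁻¹ * t, mul_nonneg (inv_nonneg.2 ha.le) ht, ?_⟩
  rw [mul_smul, ← h2, smul_smul, inv_mul_cancel₀ ha.ne', one_smul]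

/-- Near an isolated extremal ray the Mori cone is a cone over a half-space. -/
lemma exists_linear_of_isIsolatedExtremalRay {c : NS r} (hc : inter (polarization r) c = 1)
    (h : IsIsolatedExtremalRay (moriCone x) (ray c)) :
    ∃ ψ : NS r →ₗ[ℝ] ℝ, ψ c < 0 ∧ ∀ γ ∈ moriCone x,
      ∃ a : ℝ, 0 ≤ a ∧ ∃ t ∈ moriCone x, 0 ≤ ψ t ∧ γ = a • c + t := by
  obtain ⟨hext, _, ⟨τ, hτ, rfl⟩, hτ0, U, hU, hτU, hiso⟩ := h
  have hτ' : τ ≠ 0 := fun h => hτ0 (by simp [h])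
  obtain ⟨P, hP, hPc, hPS, hcP, hseg⟩ := exists_convex_segment_of_isolated isCompact_moriSlice
    convex_moriSlice (mem_extremePoints_of_isExtremalRay hext hc)
    (hU.preimage (continuous_const_smul τ)) hτU (fun e he heU => by
      have h1 := hiso (ray e) (isExtremalRay_of_mem_extremePoints he) ⟨τ • e, ⟨τ, hτ, rfl⟩, heU⟩
      exact eq_of_mem_ray hc he.1.2 (h1 ▸ mem_ray_self e))
  -- Subtracting `u` times the polarization turns the affine separation of `c` from `P` on the slice
  -- into a linear functional on the cone.
  obtain ⟨f, u, hfc, hfP⟩ := geometric_hahn_banach_point_closed hPc hP.isClosed hcP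
  let hl : NS r →ₗ[ℝ] ℝ :=
    { toFun := inter (polarization r)
      map_add' := inter_add_right _
      map_smul' := fun t α => inter_smul_right t _ α }
  refine ⟨f.toLinearMap - u • hl, ?_, fun γ hγ => ?_⟩
  · have : hl c = 1 := hc
    simp [this]
    exact hfc
  by_cases hγ0 : γ = 0
  · exact ⟨0, le_rfl, 0, zero_mem_moriCone, by simp, by simp [hγ0]⟩
  have hg := inter_polarization_pos hγ hγ0
  set g := inter (polarization r) γ
  rcases hseg _ (smul_mem_moriSlice hγ hγ0) with h1 | ⟨p, hp, a, b, ha, hb, hab, h1⟩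
  · refine ⟨g, hg.le, 0, zero_mem_moriCone, by simp, ?_⟩
    rw [← h1, smul_smul, mul_inv_cancel₀ hg.ne', one_smul, add_zero]
  · refine ⟨g * a, mul_nonneg hg.le ha, (g * b) • p,
      smul_mem_moriCone (hPS hp).1 (mul_nonneg hg.le hb), ?_, ?_⟩
    · have h2 : hl p = 1 := (hPS hp).2
      have h3 := hfP p hp
      simp only [map_smul, LinearMap.sub_apply, LinearMap.smul_apply, h2, smul_eq_mul, mul_one]
      exact mul_nonneg (mul_nonneg hg.le hb) (sub_nonneg.2 h3.le)
    · rw [mul_smul, mul_smul, ← smul_add, h1, smul_smul, mul_inv_cancel₀ hg.ne', one_smul]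

/-- A second order perturbation of a class of the light cone stays in the light cone. -/
lemma exists_add_mem_lightCone {c w : NS r} (hc : c ∈ lightCone r) (hc0 : c ≠ 0)
    (hw : inter c w = 0) : ∃ u : NS r, ∀ ε : ℝ, c + ε • w + ε ^ 2 • u ∈ lightCone r := by
  have hc1 : 0 < c.1 := lt_of_le_of_ne hc.2 fun h => hc0 (eq_zero_of_mem_lightCone hc h.symm)
  -- The contribution `2 N c.1` of the correction `(N, 0)` to the `ε ^ 2` term must outweigh a
  -- negative square of `w` and the term `-w.1 ^ 2` left by completing the square.
  obtain ⟨N, hN⟩ : ∃ N : ℝ, N * c.1 = w.1 ^ 2 + |inter w w| :=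
    ⟨(w.1 ^ 2 + |inter w w|) / c.1, div_mul_cancel₀ _ hc1.ne'⟩
  have hab := neg_abs_le (inter w w)
  have hab' := abs_nonneg (inter w w)
  refine ⟨(N, 0), fun ε => ⟨?_, ?_⟩⟩
  · have e1 : ∀ v : NS r, inter v (N, 0) = v.1 * N := fun v => by simp [inter]
    have e1' : ∀ v : NS r, inter (N, 0) v = v.1 * N := fun v => by rw [inter_comm, e1]
    have e2 : inter (c + ε • w + ε ^ 2 • ((N, 0) : NS r)) (c + ε • w + ε ^ 2 • ((N, 0) : NS r)) =
        inter c c + ε ^ 2 * (inter w w + 2 * (N * c.1) - w.1 ^ 2 + (w.1 + ε * N) ^ 2) := by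
      simp only [inter_add_left, inter_add_right, inter_smul_left, inter_smul_right, e1, e1',
        inter_comm w c, hw, Prod.fst_add, Prod.smul_fst, smul_eq_mul]
      ring
    rw [e2, hN]
    refine add_nonneg hc.1 (mul_nonneg (sq_nonneg _) ?_)
    nlinarith [sq_nonneg (w.1 + ε * N), sq_nonneg w.1]
  · have e : (c + ε • w + ε ^ 2 • ((N, 0) : NS r)).1 = c.1 + ε * w.1 + ε ^ 2 * N := by simp
    rw [e]
    have h1 : 0 ≤ c.1 * (c.1 + ε * w.1 + ε ^ 2 * N) := by
      have : c.1 * (c.1 + ε * w.1 + ε ^ 2 * N) =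
        c.1 ^ 2 + ε * w.1 * c.1 + ε ^ 2 * (N * c.1) := by ring
      rw [this, hN]
      nlinarith [sq_nonneg (c.1 + ε * w.1), sq_nonneg (c.1), sq_nonneg (ε * w.1),
        mul_nonneg (sq_nonneg ε) hab']
    exact nonneg_of_mul_nonneg_right h1 hc1

/-- An isolated extremal ray has negative square. -/
lemma inter_self_neg_of_isIsolatedExtremalRay (hr : 2 ≤ r) {α : NS r}
    (h : IsIsolatedExtremalRay (moriCone x) (ray α)) (hα : 0 ≤ α.1) (hα0 : α ≠ 0) :
    inter α α < 0 := by
  by_contra! hsq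
  have hαm : α ∈ moriCone x := h.1.2.1 (mem_ray_self α)
  have hg := inter_polarization_pos hαm hα0
  obtain ⟨c, hcdef⟩ : ∃ c, c = (inter (polarization r) α)⁻¹ • α := ⟨_, rfl⟩
  have hcS : c ∈ moriSlice x := hcdef ▸ smul_mem_moriSlice hαm hα0
  have hc0 : c ≠ 0 := ne_zero_of_inter_polarization hcS.2
  have hcl : c ∈ lightCone r := hcdef ▸ smul_mem_lightCone ⟨hsq, hα⟩ (inv_nonneg.2 hg.le)
  rw [← ray_eq_of_mem ⟨_, inv_nonneg.2 hg.le, hcdef⟩ hc0] at h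
  obtain ⟨ψ, hψ, hdec⟩ := exists_linear_of_isIsolatedExtremalRay hcS.2 h
  let cl : NS r →ₗ[ℝ] ℝ :=
    { toFun := inter c
      map_add' := inter_add_right _
      map_smul' := fun t α => inter_smul_right t _ α }
  -- The space has dimension `r + 1 > 2`, so some nonzero `w` is tangent to the light cone at `c`
  -- and also lies in the kernel of `ψ`.
  have hker : LinearMap.ker (cl.prod ψ) ≠ ⊥ := by
    apply LinearMap.ker_ne_bot_of_finrank_lt
    simp
    lia
  obtain ⟨w, hw, hw0⟩ := (Submodule.ne_bot_iff _).1 hker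
  have hw1 : inter c w = 0 := congrArg Prod.fst (LinearMap.mem_ker.1 hw)
  have hw2 : ψ w = 0 := congrArg Prod.snd (LinearMap.mem_ker.1 hw)
  obtain ⟨u, hu⟩ := exists_add_mem_lightCone hcl hc0 hw1
  obtain ⟨M, hM⟩ : ∃ M : ℝ, M * (-ψ c) = ψ u := ⟨ψ u / (-ψ c), div_mul_cancel₀ _ (by linarith)⟩
  -- Decompose `c + ε w + ε² u` as `a c + t` with `ψ t ≥ 0`. Applying `ψ` shows `1 - a ≤ M ε²`, so
  -- replacing `c` by `M ε² c` stays in the cone.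
  have key : ∀ ε : ℝ, ε • w + ε ^ 2 • (u + M • c) ∈ moriCone x := by
    intro ε
    obtain ⟨a, ha, t, ht, hψt, heq⟩ := hdec _ (lightCone_subset_moriCone (hu ε))
    have hcoef : 0 ≤ M * ε ^ 2 - (1 - a) := by
      have h1 := congrArg ψ heq
      simp only [map_add, map_smul, hw2, smul_eq_mul, mul_zero, add_zero] at h1
      have h2 : 0 ≤ (M * ε ^ 2 - (1 - a)) * (-ψ c) := by
        have : (M * ε ^ 2 - (1 - a)) * (-ψ c) = ε ^ 2 * (M * (-ψ c)) + (1 - a) * ψ c := by ring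
        rw [this, hM]
        linarith
      exact nonneg_of_mul_nonneg_left h2 (by linarith)
    have h3 : ε • w + ε ^ 2 • (u + M • c) = t + (M * ε ^ 2 - (1 - a)) • c := by
      have : t = c + ε • w + ε ^ 2 • u - a • c := by rw [heq]; abel
      rw [this]
      module
    rw [h3]
    exact add_mem_moriCone ht (smul_mem_moriCone hcS.1 hcoef)
  have key2 : ∀ v : NS r, (∀ ε : ℝ, 0 < ε → v + ε • (u + M • c) ∈ moriCone x) →
      v ∈ moriCone x := by
    intro v hv
    have hlim : Tendsto (fun n : ℕ => v + (1 / ((n : ℝ) + 1)) • (u + M • c)) atTop (𝓝 v) := by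
      simpa using tendsto_const_nhds.add
        ((tendsto_one_div_add_atTop_nhds_zero_nat (𝕜 := ℝ)).smul_const (u + M • c))
    exact isClosed_moriCone.mem_of_tendsto hlim
      (Eventually.of_forall fun n => hv _ Nat.one_div_pos_of_nat)
  apply hw0
  -- Dividing by `ε` for both signs and letting `ε → 0` puts `w` and `-w` into the cone, which
  -- contains no line.
  refine eq_zero_of_neg_mem_moriCone (x := x) (key2 _ fun ε hε => ?_) (key2 _ fun ε hε => ?_)
  · convert smul_mem_moriCone (key ε) (inv_nonneg.2 hε.le) using 1
    match_scalars <;> field_simp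
  · convert smul_mem_moriCone (key (-ε)) (inv_nonneg.2 hε.le) using 1
    match_scalars <;> field_simp

end Isolated

end BlowUpPlane
end

noncomputable section

namespace BlowUpPlane

open Filter Topology

/-! ### Extremal rays and the quadric cone -/

section Rays

variable {r : ℕ} {x : Fin r → Plane}

lemma fst_nonneg_of_mem_moriCone {γ : NS r} (hγ : γ ∈ moriCone x) : 0 ≤ γ.1 := by
  have h : ∀ δ : NS r, inter (1, 0) δ = δ.1 := fun δ => by simp [inter]
  rw [← h]
  refine inter_nonneg_of_forall_cls (x := x) (fun C => ?_) hγ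
  rw [h]
  rcases C with i | D <;> simp [IntegralCurve.cls]

/-- Classes of `(-1)`-curves. -/
def IsMinusOneClass (x : Fin r → Plane) (c : NS r) : Prop :=
  (∃ C : IntegralCurve r, c = C.cls x) ∧ inter c c = -1 ∧ inter (canonicalClass r) c = -1

lemma IsMinusOneClass.fst_nonneg {c : NS r} (hc : IsMinusOneClass x c) : 0 ≤ c.1 := by
  obtain ⟨⟨C, rfl⟩, -⟩ := hc
  exact fst_nonneg_of_mem_moriCone (effCone_subset (cls_mem_effCone C))

lemma IsMinusOneRay.exists_isMinusOneClass (hr : 2 ≤ r) (hx : Function.Injective x)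
    {R : Set (NS r)} (hR : IsMinusOneRay x R) : ∃ c, IsMinusOneClass x c ∧ R = ray c := by
  obtain ⟨hiso, C, rfl, hK⟩ := hR
  have h1 := inter_self_neg_of_isIsolatedExtremalRay hr hiso
    (fst_nonneg_of_mem_moriCone (effCone_subset (cls_mem_effCone C))) (cls_ne_zero C)
  exact ⟨C.cls x, ⟨⟨C, rfl⟩, inter_eq_neg_one hx C h1 hK⟩, rfl⟩

/-- The conjecture sums over all `K`-negative extremal rays, isolated or not; those of nonnegative
square are absorbed by the quadric cone. -/
lemma IsKNegativeExtremalRay.subset_or_exists (hx : Function.Injective x) {R : Set (NS r)}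
    (hR : IsKNegativeExtremalRay x R) :
    R ⊆ lightCone r ∨ ∃ c, IsMinusOneClass x c ∧ R = ray c := by
  obtain ⟨hext, hK⟩ := hR
  obtain ⟨α, hα0, rfl⟩ := hext.1
  rcases le_or_gt 0 (inter α α) with h | h
  · left
    rintro _ ⟨t, ht, rfl⟩
    exact smul_mem_lightCone ⟨h, fst_nonneg_of_mem_moriCone (hext.2.1 (mem_ray_self α))⟩ ht
  · right
    obtain ⟨C, hC, hneg⟩ := exists_cls_of_isExtremalRay hx hext h
    have hKC := hK (C.cls x) (hC ▸ mem_ray_self _) (cls_ne_zero C)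
    exact ⟨C.cls x, ⟨⟨C, rfl⟩, inter_eq_neg_one hx C hneg hKC⟩, hC⟩

lemma ray_subset_add_ray {c M : NS r} (h : c - M ∈ lightCone r) :
    ray c ⊆ lightCone r + ray M := by
  rintro _ ⟨t, ht, rfl⟩
  exact ⟨t • (c - M), smul_mem_lightCone h ht, t • M, ⟨t, ht, rfl⟩, by
    simp [smul_sub]⟩

lemma subset_add_ray (M : NS r) : lightCone r ⊆ lightCone r + ray M :=
  fun q hq => ⟨q, hq, 0, ⟨0, le_rfl, by simp⟩, by simp⟩

/-- If `M² = -1` and `c - M` lies in the quadric cone for all `(-1)`-classes `c`, then the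
`(-1)`-Curves Conjecture determines the Mori cone on the half-space `M^{≥0}`. -/
lemma moriCone_inter_nonnegHalfSpace (hx : Function.Injective x) {M : NS r}
    (hMM : inter M M = -1) (hM : ∀ c, IsMinusOneClass x c → c - M ∈ lightCone r)
    (hconj : MinusOneCurvesConjecture x) :
    moriCone x ∩ nonnegHalfSpace M = quadricCone x ∩ nonnegHalfSpace M := by
  rw [MinusOneCurvesConjecture, quadricCone_eq_lightCone] at hconj
  rw [quadricCone_eq_lightCone]
  refine Set.Subset.antisymm ?_ (Set.inter_subset_inter_left _ lightCone_subset_moriCone)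
  rintro β ⟨hβ, hβM⟩
  refine ⟨⟨?_, fst_nonneg_of_mem_moriCone hβ⟩, hβM⟩
  have hadd : ∀ y ∈ lightCone r + ray M, ∀ z ∈ lightCone r + ray M,
      y + z ∈ lightCone r + ray M := by
    rintro _ ⟨p, hp, _, ⟨t, ht, rfl⟩, rfl⟩ _ ⟨q, hq, _, ⟨u, hu, rfl⟩, rfl⟩
    exact ⟨p + q, add_mem_lightCone hp hq, (t + u) • M, ⟨t + u, add_nonneg ht hu, rfl⟩, by
      simp only [add_smul]; abel⟩
  have hspan : ∀ z ∈ Submodule.span ℝ≥0 (⋃₀ {R | IsKNegativeExtremalRay x R}),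
      z ∈ lightCone r + ray M := by
    intro z hz
    induction hz using Submodule.span_induction with
    | mem z hz =>
      obtain ⟨R, hR, hzR⟩ := hz
      rcases IsKNegativeExtremalRay.subset_or_exists hx hR with h | ⟨c, hc, rfl⟩
      · exact subset_add_ray M (h hzR)
      · exact ray_subset_add_ray (hM c hc) hzR
    | zero => exact subset_add_ray M zero_mem_lightCone
    | add y z _ _ hy hz => exact hadd y hy z hz
    | smul t z _ hz =>
      obtain ⟨p, hp, _, ⟨u, hu, rfl⟩, rfl⟩ := hz
      exact ⟨(t : ℝ) • p, smul_mem_lightCone hp t.2, ((t : ℝ) * u) • M,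
        ⟨_, mul_nonneg t.2 hu, rfl⟩, by
          rw [mul_smul]; exact (smul_add (t : ℝ) p (u • M)).symm⟩
  rw [hconj] at hβ
  obtain ⟨p, hp, z, hz, rfl⟩ := hβ
  obtain ⟨q, hq, _, ⟨t, ht, rfl⟩, hqt⟩ := hadd p (subset_add_ray M hp) z (hspan z hz)
  simp only at hqt
  rw [nonnegHalfSpace, Set.mem_ofPred_eq] at hβM
  simp only at hβM ⊢
  rw [← hqt] at hβM ⊢
  simp only [inter_add_left, inter_add_right, inter_smul_left, inter_smul_right, hMM,
    inter_comm q M] at hβM ⊢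
  -- With `M² = -1`, `(q + tM)² = q² + 2t M · (q + tM) + t²`.
  nlinarith [hq.1, mul_nonneg ht hβM, mul_nonneg ht ht]

lemma inter_canonicalClass_self : inter (canonicalClass r) (canonicalClass r) = 9 - r := by
  simp [inter, canonicalClass]
  norm_num

/-- The numerical properties of the pull-back of a line. -/
lemma IsLinePullback.numerics (hx : Function.Injective x) {L : NS r} (hL : IsLinePullback x L) :
    inter L L = 1 ∧ inter (canonicalClass r) L = -3 ∧ 0 ≤ L.1 ∧
      ∀ C : IntegralCurve r, 0 ≤ inter L (C.cls x) := by
  obtain ⟨d, m, F, hF, rfl⟩ := hL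
  obtain ⟨h1, h2⟩ := hF.numerics hx
  have h1' : (d : ℝ) ^ 2 - ∑ i, (m i : ℝ) ^ 2 = 1 := by exact_mod_cast h1
  have h2' : 3 * (d : ℝ) - ∑ i, (m i : ℝ) = 3 := by exact_mod_cast h2
  refine ⟨?_, ?_, by simp, fun C => ?_⟩
  · simpa [inter, sq] using h1'
  · simp [inter, canonicalClass]
    linarith
  · rcases C with i | D
    · simp [inter, IntegralCurve.cls, Pi.single_apply]
    · have h3 : ∑ i, (multAt (x i) D.form : ℝ) * m i ≤ D.degree * d := by
        exact_mod_cast hF.sum_mul_multAt_le hx D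
      rw [inter_comm]
      simpa [inter, IntegralCurve.cls] using h3

/-- Here `(c - M)² = -2 - 2 M · c`. -/
lemma sub_mem_lightCone {c M : NS r} (hMM : inter M M = -1) (hM1 : M.1 ≤ 0) (hcc : inter c c = -1)
    (hc1 : 0 ≤ c.1) (hMc : inter M c ≤ -1) : c - M ∈ lightCone r := by
  refine ⟨?_, ?_⟩
  · rw [inter_sub_left, inter_sub_right, inter_sub_right, hcc, hMM, inter_comm c M]
    linarith
  · rw [Prod.fst_sub]
    linarith

/-- `c - M` is a null class in the light cone, orthogonal to both `M` and `c`. Pairing with it is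
nonnegative on the cone and zero on the ray of `c`, so it defines a supporting hyperplane. -/
lemma ray_subset_coneBoundary {c M : NS r} (hMM : inter M M = -1) (hM1 : M.1 < 0)
    (hcc : inter c c = -1) (hc1 : 0 ≤ c.1) (hMc : inter M c = -1) :
    ray c ⊆ coneBoundary (lightCone r + ray M) := by
  have hcM := sub_mem_lightCone hMM hM1.le hcc hc1 hMc.le
  have hsub := ray_subset_add_ray hcM
  intro z hz
  refine ⟨hsub hz, fun hzi => ?_⟩
  have hV : ∀ v ∈ lightCone r + ray M, 0 ≤ inter (c - M) v := by
    rintro _ ⟨q, hq, _, ⟨t, ht, rfl⟩, rfl⟩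
    have h0 : inter (c - M) M = 0 := by
      rw [inter_sub_left, inter_comm c M, hMc, hMM, sub_self]
    rw [inter_add_right, inter_smul_right, h0, mul_zero, add_zero]
    exact inter_nonneg_of_mem_lightCone hcM hq
  have hz0 : inter (c - M) z = 0 := by
    obtain ⟨t, ht, rfl⟩ := hz
    rw [inter_smul_right, inter_sub_left, hcc, hMc, sub_self, mul_zero]
  have hl : ((1, 0) : NS r) ∈ lightCone r + ray M :=
    subset_add_ray M (mem_lightCone_iff.2 (by simp))
  have h0 : (0 : NS r) ∈ lightCone r + ray M := subset_add_ray M zero_mem_lightCone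
  have hl0 : 0 < inter (c - M) (1, 0) := by
    simp [inter]
    linarith
  obtain ⟨y, hy, hyz⟩ := mem_intrinsicInterior.1 hzi
  let A := affineSpan ℝ (lightCone r + ray M)
  -- The path `z - ε • (1, 0)` stays in the affine span but leaves the cone at once, because `c - M`
  -- is positive on `(1, 0)`.
  let f : ℝ → A := fun ε => ⟨ε • ((0 : NS r) -ᵥ (1, 0)) +ᵥ z,
    AffineSubspace.smul_vsub_vadd_mem _ ε (subset_affineSpan ℝ _ h0) (subset_affineSpan ℝ _ hl)
      (subset_affineSpan ℝ _ (hsub hz))⟩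
  have hf : Continuous f := by
    refine Continuous.subtype_mk ?_ _
    simp only [vsub_eq_sub, vadd_eq_add]
    fun_prop
  have hf0 : f 0 = y := Subtype.ext (by simp [f, hyz])
  have hev : ∀ᶠ ε in 𝓝 (0 : ℝ), (f ε : NS r) ∈ lightCone r + ray M := by
    have h1 : ((↑) ⁻¹' (lightCone r + ray M) : Set A) ∈ 𝓝 (f 0) := by
      rw [hf0]
      exact mem_interior_iff_mem_nhds.1 hy
    exact hf.continuousAt.eventually h1
  obtain ⟨ε, hε, hε0⟩ := ((hev.filter_mono nhdsWithin_le_nhds).and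
    (self_mem_nhdsWithin : Set.Ioi (0 : ℝ) ∈ 𝓝[>] 0)).exists
  have h1 := hV _ hε
  have hε0' : 0 < ε := hε0
  simp only [f, vsub_eq_sub, vadd_eq_add, zero_sub] at h1
  rw [inter_add_right, hz0, inter_smul_right, inter_neg_right] at h1
  nlinarith

/-- The square of `t c - u M` is `-(t - u)² + (M² + 1) u²`, which is negative for `t > 0` and `u ≥
0`. -/
lemma disjoint_ray_add_ray {c M : NS r} (hMM : inter M M < -1) (hcc : inter c c = -1)
    (hMc : inter M c = -1) : Disjoint (ray c \ {0}) (lightCone r + ray M) := by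
  rw [Set.disjoint_left]
  rintro _ ⟨⟨t, ht, rfl⟩, ht0⟩ ⟨q, hq, _, ⟨u, hu, rfl⟩, heq⟩
  have hq' : q = t • c - u • M := by
    rw [← heq]
    simp
  have h1 := hq.1
  rw [hq'] at h1
  simp only [inter_sub_left, inter_sub_right, inter_smul_left, inter_smul_right, hcc, hMc,
    inter_comm c M] at h1
  have ht1 : 0 < t := lt_of_le_of_ne ht fun h => ht0 (by simp [← h])
  rcases hu.eq_or_lt with rfl | hu
  · nlinarith
  · nlinarith [sq_nonneg (t - u), mul_pos hu hu]

/-- The null class `q = σ L₀ - ∑ E i` over `i ≠ i₀`, with `σ² = r - 1`, is orthogonal to `E i₀`, and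
`K · q = σ² - 3σ > 0` as `σ > 3`. Adding `(K · q) E i₀` gives a Mori class orthogonal to `K` with
square `-(K · q)²`. -/
lemma quadricCone_ssubset_moriCone (hr : 10 < r) :
    quadricCone x ∩ nonnegHalfSpace (canonicalClass r) ⊂
      moriCone x ∩ nonnegHalfSpace (canonicalClass r) := by
  rw [quadricCone_eq_lightCone]
  refine ⟨Set.inter_subset_inter_left _ lightCone_subset_moriCone, fun hsub => ?_⟩
  have hr' : (11 : ℝ) ≤ r := by exact_mod_cast hr
  obtain ⟨σ, hσ⟩ : ∃ σ, σ = √((r : ℝ) - 1) := ⟨_, rfl⟩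
  have hσ0 : 0 ≤ σ := hσ ▸ Real.sqrt_nonneg _
  have hσ2 : σ ^ 2 = r - 1 := by rw [hσ, Real.sq_sqrt (by linarith)]
  have hσ3 : 3 < σ := by nlinarith
  let i₀ : Fin r := ⟨0, by lia⟩
  let e : NS r := (0, Pi.single i₀ 1)
  let q : NS r := (σ, fun i => (Pi.single i₀ 1 : Fin r → ℝ) i - 1)
  let K := canonicalClass r
  have hqq : inter q q = 0 := by
    have e1 : ∀ i : Fin r,
        ((Pi.single i₀ 1 : Fin r → ℝ) i - 1) * ((Pi.single i₀ 1 : Fin r → ℝ) i - 1) =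
        1 - (Pi.single i₀ 1 : Fin r → ℝ) i := fun i => by
      by_cases h : i = i₀
      · simp [h]
      · simp [h]
    simp only [inter, q, e1]
    simp [Finset.sum_sub_distrib]
    linarith
  have hqe : inter q e = 0 := by
    simp [inter, q, e, Pi.single_apply]
  have hKq : inter K q = σ ^ 2 - 3 * σ := by
    simp [inter, K, q, canonicalClass, Finset.sum_sub_distrib]
    linarith
  have hKe : inter K e = -1 := by
    simp [inter, K, e, canonicalClass]
  have hee : inter e e = -1 := by
    simp [inter, e, Pi.single_apply]
  have hε : 0 < σ ^ 2 - 3 * σ := by nlinarith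
  have hmem : q + (σ ^ 2 - 3 * σ) • e ∈ moriCone x :=
    add_mem_moriCone (lightCone_subset_moriCone ⟨hqq.ge, hσ0⟩)
      (smul_mem_moriCone (effCone_subset (exceptional_mem_effCone i₀)) hε.le)
  have hK : q + (σ ^ 2 - 3 * σ) • e ∈ nonnegHalfSpace K := by
    rw [nonnegHalfSpace, Set.mem_ofPred_eq, inter_add_right, inter_smul_right, hKq, hKe]
    linarith
  have h1 := (hsub ⟨hmem, hK⟩).1.1
  simp only [inter_add_left, inter_add_right, inter_smul_left, inter_smul_right, hqq, hqe, hee,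
    inter_comm e q] at h1
  nlinarith [mul_pos hε hε]

end Rays

end BlowUpPlane

end

/-! ### Proof of the theorem -/

open BlowUpPlane in
theorem mainTheorem2 (r : ℕ) (hr : 10 ≤ r) (x : Fin r → Plane) (hx : Function.Injective x) :
    (∀ L : NS r, IsLinePullback x L → ∀ s : ℝ, s = √((r : ℝ) - 1) - 3 →
      (∀ R, IsMinusOneRay x R → R ⊆ quadricCone x + ray (canonicalClass r - s • L)) ∧
      (MinusOneCurvesConjecture x →
        moriCone x ∩ nonnegHalfSpace (canonicalClass r - s • L) =
          quadricCone x ∩ nonnegHalfSpace (canonicalClass r - s • L))) ∧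
    (r = 10 →
      (∀ R, IsMinusOneRay x R → R ⊆ coneBoundary (quadricCone x + ray (canonicalClass r))) ∧
      (MinusOneCurvesConjecture x →
        moriCone x ∩ nonnegHalfSpace (canonicalClass r) =
          quadricCone x ∩ nonnegHalfSpace (canonicalClass r))) ∧
    (10 < r →
      (∀ R, IsMinusOneRay x R → Disjoint (R \ {0}) (quadricCone x + ray (canonicalClass r))) ∧
      quadricCone x ∩ nonnegHalfSpace (canonicalClass r) ⊂
        moriCone x ∩ nonnegHalfSpace (canonicalClass r)) := by
  have hr2 : 2 ≤ r := by lia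
  have hKK := inter_canonicalClass_self (r := r)
  have hK1 : (canonicalClass r).1 = -3 := rfl
  refine ⟨fun L hL s hs => ?_, fun h10 => ?_, fun h10 => ⟨fun R hR => ?_, ?_⟩⟩
  · obtain ⟨hLL, hKL, hL1, hLC⟩ := hL.numerics hx
    have hr' : (10 : ℝ) ≤ r := by exact_mod_cast hr
    have hsq : (s + 3) ^ 2 = r - 1 := by
      rw [hs, sub_add_cancel, Real.sq_sqrt (by linarith)]
    have hs0 : 0 ≤ s := by
      rw [hs, sub_nonneg]
      exact Real.le_sqrt_of_sq_le (by linarith)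
    -- The square is `9 - r + 6 s + s² = (s + 3)² - r`; the value of `s` is chosen to make this
    -- `-1`.
    have hMM : inter (canonicalClass r - s • L) (canonicalClass r - s • L) = -1 := by
      simp only [inter_sub_left, inter_sub_right, inter_smul_left, inter_smul_right, hKK, hLL,
        hKL, inter_comm L (canonicalClass r)]
      linarith
    have hM : ∀ c, IsMinusOneClass x c → c - (canonicalClass r - s • L) ∈ lightCone r := by
      intro c hc
      refine sub_mem_lightCone hMM ?_ hc.2.1 hc.fst_nonneg ?_
      · simp only [Prod.fst_sub, Prod.smul_fst, hK1, smul_eq_mul]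
        linarith [mul_nonneg hs0 hL1]
      · obtain ⟨C, rfl⟩ := hc.1
        rw [inter_sub_left, inter_smul_left, hc.2.2]
        linarith [mul_nonneg hs0 (hLC C)]
    refine ⟨fun R hR => ?_, moriCone_inter_nonnegHalfSpace hx hMM hM⟩
    obtain ⟨c, hc, rfl⟩ := hR.exists_isMinusOneClass hr2 hx
    rw [quadricCone_eq_lightCone]
    exact ray_subset_add_ray (hM c hc)
  · have hMM : inter (canonicalClass r) (canonicalClass r) = -1 := by
      rw [hKK, h10]
      norm_num
    refine ⟨fun R hR => ?_, moriCone_inter_nonnegHalfSpace hx hMM fun c hc =>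
      sub_mem_lightCone hMM (by rw [hK1]; norm_num) hc.2.1 hc.fst_nonneg hc.2.2.le⟩
    obtain ⟨c, hc, rfl⟩ := hR.exists_isMinusOneClass hr2 hx
    rw [quadricCone_eq_lightCone]
    exact ray_subset_coneBoundary hMM (by rw [hK1]; norm_num) hc.2.1 hc.fst_nonneg hc.2.2
  · obtain ⟨c, hc, rfl⟩ := hR.exists_isMinusOneClass hr2 hx
    rw [quadricCone_eq_lightCone]
    refine disjoint_ray_add_ray ?_ hc.2.1 hc.2.2
    rw [hKK]
    have : (10 : ℝ) < r := by exact_mod_cast h10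
    linarith
  · exact quadricCone_ssubset_moriCone h10
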